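/- **Definitions.** A completeness system on a topological space $X$ is a triple $\langle U,\le,f\rangle$ where $\le$ is a partial order on the set $U$ and $f$ maps $U$ to the open subsets of $X$, such that (0) $X=\bigcup_{u\in U}f(u)$; (1) $f(u)\subseteq\bigcup\{f(v): v<u\}$ for every $u\in U$; (2) if $\langle u_n: n\in\omega\rangle$ is strictly descending in $\le$ and $F$ is a collection of closed subsets of $X$ with the finite intersection property such that for every $n$ some element of $F$ is a subset of $\mathrm{cl}(f(u_n))$, then $\bigcap F\neq\emptyset$. A space is Čech complete if it is homeomorphic to a $G_\delta$ subspace of a compact Hausdorff space, and interpretable if it is regular Hausdorff and an open continuous image of a Čech complete space. Let $M$ be a transitive model (a set or a class) of ZFC and $\langle X,\tau\rangle\in M$ with $M\models$ "$\langle X,\tau\rangle$ is a topological space". A preinterpretation of $X$ is a $T_0$ space $\langle\hat X,\hat\tau\rangle$ (in the universe $V$) with maps $\pi: X\to\hat X$ and $\pi:\tau\to\hat\tau$ such that $x\in O\Leftrightarrow\pi(x)\in\pi(O)$; $\pi$ commutes with finite intersections of open sets and with those unions of open sets that are indexed by families in $M$; $\pi(\emptyset)=\emptyset$ and $\pi(X)=\hat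 X$; and $\pi''\tau$ is a basis of $\hat\tau$. A reduction of $\pi_0: X\to\hat X_0$ to $\pi_1: X\to\hat X_1$ is a map $h:\hat X_0\to\hat X_1$ with $\pi_1=h\circ\pi_0$ on points and $h^{-1}\pi_1(O)=\pi_0(O)$ for all $O\in\tau$; write $\pi_0\le\pi_1$ if there is one, and call $\pi_0,\pi_1$ equivalent if some reduction is a bijection. An interpretation of $X$ is a $\le$-largest preinterpretation. Uniqueness below is up to equivalence. **Theorem.** Let $M$ be a transitive model of ZFC. (1) Suppose $M\models$ "$X$ is a regular Hausdorff space and $\langle U,\le,f\rangle$ is a completeness system on $X$". For a preinterpretation $\pi: X\to\hat X$ let $\hat f(u)=\pi(f(u))$. There is a preinterpretation $\pi$, unique up to equivalence, for which $\langle U,\le,\hat f\rangle$ is a completeness system on $\hat X$, and it is the interpretation of $X$: a preinterpretation $\pi$ is an interpretation if and only if $\langle U,\le,\hat f\rangle$ is a completeness system on $\hat X$. (2) If $M\models$ "$X$ is compact Hausdorff", then $X$ has a compact preinterpretation, which is unique up to equivalence and is the interpretation of $X$; a preinterpretation of $X$ is an interpretation if and only if its target is compact, and then the target is compact Hausdorff.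 (3) Suppose $M\models$ "$d$ is a complete metric on $X$ which generates the topology of $X$", with values in the complete ordered field $\mathbb R^M$ of $M$, and let $j:\mathbb R^M\to\mathbb R$ be the unique ordered field embedding. Then $X$ has an interpretation; for every interpretation $\pi: X\to\hat X$ there is a complete metric $\hat d$ on $\hat X$ generating its topology with $\hat d(\pi(x),\pi(y))=j(d(x,y))$ for all $x,y\in X$ and with $\pi''X$ dense in $\hat X$; and conversely, if $Y$ is a complete metric space and $i: X\to Y$ is isometric with respect to $j\circ d$ and has dense range, then $i$ extends to an interpretation of $X$. Thus the interpretation is the completion of $\langle X, j\circ d\rangle$. (4) If $M\models$ "$X$ is Čech complete", then $X$ has an interpretation, and the target of every interpretation of $X$ is Čech complete. (5) If $M\models$ "$X$ is interpretable", then $X$ has an interpretation, and the target of every interpretation of $X$ is interpretable. -/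

import Mathlib

open Set Topology

universe u v

namespace TopInterp

/-! ### Structures for the language of set theory

A structure for the language of set theory is a type `W` with a binary relation `∈` on it, i.e. with
an instance `[Membership W W]`. A property of elements of `W` in which all quantifiers range over `W`
(or over the elements of an element of `W`) and in which `∈` is the relation of `W`
is the relativization of that property to `W`: it says that `W` satisfies the property. -/

/-- The only symbol of the language of set theory: a binary relation symbol. -/
inductive SetRel : ℕ → Type
  | mem : SetRel 2

/-- The first order language of set theory. -/
def setLang : FirstOrder.Language.{0, 0} := ⟨fun _ => Empty, SetRel⟩

instance setLangStructure (W : Type v) [Membership W W] : setLang.Structure W where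
  funMap := fun f _ => Empty.elim f
  RelMap := fun r => match r with
    | SetRel.mem => fun x => x 0 ∈ x 1

/-- A class `M` of sets, regarded as a structure with the true membership relation. -/
instance classMembership (M : Set ZFSet.{u}) : Membership M M := ⟨fun b a => a.1 ∈ b.1⟩

section Model

variable {W : Type v} [Membership W W]

/-- `a` is a subset of `b`. -/
def SubsetIn (a b : W) : Prop := ∀ x ∈ a, x ∈ b

/-- `m = n ∪ {n}`. -/
def IsSucc (m n : W) : Prop := ∀ x, x ∈ m ↔ x ∈ n ∨ x = n

/-- `I` contains the empty set and is closed under successors. -/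
def IsInductive (I : W) : Prop :=
  (∃ e ∈ I, ∀ x, x ∉ e) ∧ ∀ n ∈ I, ∃ m ∈ I, IsSucc m n

/-- `w` is the set of natural numbers of `W`. -/
def IsOmega (w : W) : Prop := IsInductive w ∧ ∀ I : W, IsInductive I → SubsetIn w I

/-- `z` is the unordered pair `{x, y}`. -/
def IsUPair (z x y : W) : Prop := ∀ w, w ∈ z ↔ w = x ∨ w = y

/-- `z` is the Kuratowski pair `{{x}, {x, y}}`. -/
def IsOPair (z x y : W) : Prop := ∀ w, w ∈ z ↔ IsUPair w x x ∨ IsUPair w x y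

/-- `(W, ∈)` satisfies the axioms of `ZFC`. Separation and replacement are stated for all
classes of `W` that are first order definable over `(W, ∈)` with parameters. -/
structure ModelsZFC (W : Type v) [Membership W W] : Prop where
  extensionality : ∀ a b : W, (∀ x, x ∈ a ↔ x ∈ b) → a = b
  foundation : ∀ a : W, (∃ x, x ∈ a) → ∃ x ∈ a, ∀ y ∈ x, y ∉ a
  pairing : ∀ a b : W, ∃ c : W, IsUPair c a b
  union : ∀ a : W, ∃ b : W, ∀ x, x ∈ b ↔ ∃ y ∈ a, x ∈ y
  power : ∀ a : W, ∃ b : W, ∀ x, x ∈ b ↔ SubsetIn x a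
  infinity : ∃ I : W, IsInductive I
  separation : ∀ D : Set W, (Set.univ : Set W).Definable₁ setLang D →
    ∀ a : W, ∃ b : W, ∀ x, x ∈ b ↔ x ∈ a ∧ x ∈ D
  replacement : ∀ D : Set (W × W), (Set.univ : Set W).Definable₂ setLang D →
    ∀ a : W, (∀ x ∈ a, ∀ y z, (x, y) ∈ D → (x, z) ∈ D → y = z) →
      ∃ b : W, ∀ y, y ∈ b ↔ ∃ x ∈ a, (x, y) ∈ D
  choice : ∀ a : W, (∀ x ∈ a, ∃ y, y ∈ x) →
    (∀ x ∈ a, ∀ y ∈ a, (∃ z, z ∈ x ∧ z ∈ y) → x = y) →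
      ∃ c : W, ∀ x ∈ a, ∃! y, y ∈ x ∧ y ∈ c

/-- The type of all elements of the set `a` of `W`. -/
@[ext]
structure El (a : W) : Type v where
  val : W
  mem : val ∈ a

/-- The function `F` from `a` to `b` belongs to `W`: its graph is a set of `W`. -/
def Internal {a b : W} (F : El a → El b) : Prop :=
  ∃ f : W, ∀ p, p ∈ f ↔ ∃ x : El a, IsOPair p x.1 (F x).1

/-- The function `F` from `a × b` to `c` belongs to `W`. -/
def Internal₂ {a b c : W} (F : El a → El b → El c) : Prop :=
  ∃ f : W, ∀ p, p ∈ f ↔ ∃ (x : El a) (y : El b) (q : W),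
    IsOPair q x.1 y.1 ∧ IsOPair p q (F x y).1

/-- The relation `R` between `a` and `b` belongs to `W`. -/
def InternalRel {a b : W} (R : El a → El b → Prop) : Prop :=
  ∃ r : W, ∀ p, p ∈ r ↔ ∃ (x : El a) (y : El b), R x y ∧ IsOPair p x.1 y.1

/-- `W` satisfies "`a` is finite": in `W` there is a surjection of a natural number onto `a`. -/
def FiniteIn (a : W) : Prop :=
  ∃ w : W, IsOmega w ∧ ∃ n ∈ w, ∃ F : El n → El a, Internal F ∧ Function.Surjective F

/-! ### Topological spaces in a model -/

/-- `W` satisfies "`τ` is a topology on `X`". -/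
structure IsTopIn (X τ : W) : Prop where
  sub : ∀ O ∈ τ, SubsetIn O X
  univ_mem : X ∈ τ
  inter_mem : ∀ O ∈ τ, ∀ P ∈ τ, ∀ Q : W, (∀ x, x ∈ Q ↔ x ∈ O ∧ x ∈ P) → Q ∈ τ
  union_mem : ∀ S : W, SubsetIn S τ → ∀ Q : W, (∀ x, x ∈ Q ↔ ∃ O ∈ S, x ∈ O) → Q ∈ τ

/-- `W` satisfies "`C` is a closed subset of `X`". -/
def ClosedIn (X τ C : W) : Prop :=
  SubsetIn C X ∧ ∃ O ∈ τ, ∀ x, x ∈ O ↔ x ∈ X ∧ x ∉ C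

/-- The point `x` belongs to the closure of the set `A`. -/
def InClosure (τ A x : W) : Prop := ∀ O ∈ τ, x ∈ O → ∃ y ∈ O, y ∈ A

/-- `W` satisfies "`X` is Hausdorff". -/
def HausdorffIn (X τ : W) : Prop :=
  ∀ x ∈ X, ∀ y ∈ X, x ≠ y → ∃ O ∈ τ, ∃ P ∈ τ, x ∈ O ∧ y ∈ P ∧ ∀ z ∈ O, z ∉ P

/-- `W` satisfies "points and closed sets of `X` can be separated by open sets". -/
def RegularIn (X τ : W) : Prop :=
  ∀ x ∈ X, ∀ C : W, ClosedIn X τ C → x ∉ C →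
    ∃ O ∈ τ, ∃ P ∈ τ, x ∈ O ∧ SubsetIn C P ∧ ∀ z ∈ O, z ∉ P

/-- `W` satisfies "`X` is a regular Hausdorff topological space". -/
def RegularHausdorffIn (X τ : W) : Prop :=
  IsTopIn X τ ∧ HausdorffIn X τ ∧ RegularIn X τ

/-- `W` satisfies "every open cover of `X` has a finite subcover". -/
def CompactIn (X τ : W) : Prop :=
  ∀ S : W, SubsetIn S τ → (∀ x ∈ X, ∃ O ∈ S, x ∈ O) →
    ∃ G : W, SubsetIn G S ∧ FiniteIn G ∧ ∀ x ∈ X, ∃ O ∈ G, x ∈ O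

/-- `W` satisfies "the family `F` of subsets of `X` has the finite intersection property". -/
def FIPIn (X F : W) : Prop :=
  ∀ G : W, SubsetIn G F → FiniteIn G → ∃ x ∈ X, ∀ C ∈ G, x ∈ C

/-- `W` satisfies "`⟨U, ≤, f⟩` is a completeness system on `X`". -/
structure CompletenessSystemIn (X τ U : W) (le : El U → El U → Prop) (f : El U → El τ) : Prop where
  le_internal : InternalRel le
  f_internal : Internal f
  refl : ∀ a, le a a
  antisymm : ∀ a b, le a b → le b a → a = b
  trans : ∀ a b c, le a b → le b c → le a c
  cover : ∀ x ∈ X, ∃ a, x ∈ (f a).1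
  refine : ∀ a, ∀ x ∈ (f a).1, ∃ b, (le b a ∧ b ≠ a) ∧ x ∈ (f b).1
  complete : ∀ w : W, IsOmega w → ∀ s : El w → El U, Internal s →
    (∀ n m : El w, IsSucc m.1 n.1 → le (s m) (s n) ∧ s m ≠ s n) →
    ∀ F : W, (∀ C ∈ F, ClosedIn X τ C) → FIPIn X F →
      (∀ n, ∃ C ∈ F, ∀ x ∈ C, InClosure τ (f (s n)).1 x) →
        ∃ x ∈ X, ∀ C ∈ F, x ∈ C

/-- `W` satisfies "`X` is Čech complete": `X` is, up to a homeomorphism `e`, the intersection of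
countably many open subsets `G n` of a compact Hausdorff space `K`. -/
def CechCompleteIn (X τ : W) : Prop :=
  IsTopIn X τ ∧ ∃ K σ w : W, IsTopIn K σ ∧ HausdorffIn K σ ∧ CompactIn K σ ∧ IsOmega w ∧
    ∃ (e : El X → El K) (G : El w → El σ), Internal e ∧ Internal G ∧ Function.Injective e ∧
      (∀ O : W, O ∈ τ ↔ SubsetIn O X ∧ ∃ P ∈ σ, ∀ x : El X, x.1 ∈ O ↔ (e x).1 ∈ P) ∧
      ∀ y : El K, (∃ x, e x = y) ↔ ∀ n, y.1 ∈ (G n).1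

/-- `W` satisfies "`X` is interpretable": `X` is regular Hausdorff and the image of a Čech complete
space `Y` under an open continuous map `g`. -/
def InterpretableIn (X τ : W) : Prop :=
  RegularHausdorffIn X τ ∧ ∃ Y σ : W, CechCompleteIn Y σ ∧
    ∃ g : El Y → El X, Internal g ∧ Function.Surjective g ∧
      (∀ O ∈ τ, ∃ Q ∈ σ, ∀ y : El Y, y.1 ∈ Q ↔ (g y).1 ∈ O) ∧
      (∀ Q ∈ σ, ∃ O ∈ τ, ∀ x : El X, x.1 ∈ O ↔ ∃ y : El Y, y.1 ∈ Q ∧ g y = x)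

/-- `W` satisfies "`R` is a complete ordered field", that is, `R` is the field of real numbers of
`W`: the operations and the order belong to `W`, and nonempty bounded subsets of `R` which
belong to `W` have least upper bounds. -/
structure RealFieldIn (R : W) [Field (El R)] [LinearOrder (El R)] [IsStrictOrderedRing (El R)] :
    Prop where
  add_internal : Internal₂ (fun x y : El R => x + y)
  mul_internal : Internal₂ (fun x y : El R => x * y)
  le_internal : InternalRel (fun x y : El R => x ≤ y)
  exists_lub : ∀ S : W, SubsetIn S R → (∃ x, x ∈ S) → (∃ b : El R, ∀ x : El R, x.1 ∈ S → x ≤ b) →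
    ∃ b : El R, IsLUB {x : El R | x.1 ∈ S} b

/-- `W` satisfies "`d` is a complete metric on `X` with values in `R`, and `τ` is its topology". -/
structure CompleteMetricIn (X τ : W) {R : W} [Field (El R)] [LinearOrder (El R)]
    (d : El X → El X → El R) : Prop where
  d_internal : Internal₂ d
  eq_zero : ∀ x y, d x y = 0 ↔ x = y
  comm : ∀ x y, d x y = d y x
  triangle : ∀ x y z, d x z ≤ d x y + d y z
  topology : ∀ O : W, O ∈ τ ↔ SubsetIn O X ∧
    ∀ x : El X, x.1 ∈ O → ∃ ε : El R, 0 < ε ∧ ∀ y : El X, d x y < ε → y.1 ∈ O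
  complete : ∀ w : W, IsOmega w → ∀ s : El w → El X, Internal s →
    (∀ ε : El R, 0 < ε → ∃ N : El w, ∀ m n : El w, N.1 ∈ m.1 → N.1 ∈ n.1 → d (s m) (s n) < ε) →
      ∃ x : El X, ∀ ε : El R, 0 < ε → ∃ N : El w, ∀ n : El w, N.1 ∈ n.1 → d (s n) x < ε

/-! ### Preinterpretations and interpretations -/

/-- A topological preinterpretation of the space `⟨X, τ⟩` of the model `W` with target `A`:
a map `pt` on points and a map `op` on open sets. -/
structure Preinterp (X τ : W) (A : Type u) [TopologicalSpace A] where
  pt : El X → A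
  op : El τ → Set A
  t0 : T0Space A
  mem_iff : ∀ (x : El X) (O : El τ), x.1 ∈ O.1 ↔ pt x ∈ op O
  op_inter : ∀ O P Q : El τ, (∀ x, x ∈ Q.1 ↔ x ∈ O.1 ∧ x ∈ P.1) → op Q = op O ∩ op P
  op_union : ∀ S : W, SubsetIn S τ → ∀ O : El τ, (∀ x, x ∈ O.1 ↔ ∃ P ∈ S, x ∈ P) →
    op O = {a | ∃ P : El τ, P.1 ∈ S ∧ a ∈ op P}
  op_empty : ∀ O : El τ, (∀ x, x ∉ O.1) → op O = ∅
  op_univ : ∀ O : El τ, O.1 = X → op O = Set.univ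
  basis : TopologicalSpace.IsTopologicalBasis (Set.range op)

/-- `h` is a reduction of the preinterpretation `p` to the preinterpretation `q`. -/
def IsReduction {X τ : W} {A B : Type u} [TopologicalSpace A] [TopologicalSpace B]
    (p : Preinterp X τ A) (q : Preinterp X τ B) (h : A → B) : Prop :=
  (∀ x, q.pt x = h (p.pt x)) ∧ ∀ O, h ⁻¹' (q.op O) = p.op O

/-- `p ≤ q`. -/
def Reducible {X τ : W} {A B : Type u} [TopologicalSpace A] [TopologicalSpace B]
    (p : Preinterp X τ A) (q : Preinterp X τ B) : Prop := ∃ h, IsReduction p q h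

/-- Equivalence of preinterpretations. -/
def Equivalent {X τ : W} {A B : Type u} [TopologicalSpace A] [TopologicalSpace B]
    (p : Preinterp X τ A) (q : Preinterp X τ B) : Prop :=
  ∃ h, IsReduction p q h ∧ Function.Bijective h

/-- `p` is an interpretation, i.e. the largest preinterpretation. -/
def IsInterpretation {X τ : W} {A : Type u} [TopologicalSpace A] (p : Preinterp X τ A) : Prop :=
  ∀ (B : Type u) [TopologicalSpace B] (q : Preinterp X τ B), Reducible q p

end Model

/-! ### Topological spaces in the universe -/

/-- `⟨U, ≤, f⟩` is a completeness system on the topological space `A`. -/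
structure CompletenessSystem {A : Type u} [TopologicalSpace A] {U : Type v}
    (le : U → U → Prop) (f : U → Set A) : Prop where
  isOpen : ∀ a, IsOpen (f a)
  refl : ∀ a, le a a
  antisymm : ∀ a b, le a b → le b a → a = b
  trans : ∀ a b c, le a b → le b c → le a c
  cover : ∀ x, ∃ a, x ∈ f a
  refine : ∀ a, f a ⊆ ⋃ b ∈ {b | le b a ∧ b ≠ a}, f b
  complete : ∀ s : ℕ → U, (∀ n, le (s (n + 1)) (s n) ∧ s (n + 1) ≠ s n) →
    ∀ F : Set (Set A), (∀ C ∈ F, IsClosed C) → (∀ G ⊆ F, G.Finite → (⋂₀ G).Nonempty) →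
      (∀ n, ∃ C ∈ F, C ⊆ closure (f (s n))) → (⋂₀ F).Nonempty

/-- `A` is (homeomorphic to) a `G_δ` subspace of a compact Hausdorff space. -/
def CechComplete (A : Type u) [TopologicalSpace A] : Prop :=
  ∃ (K : Type u) (_ : TopologicalSpace K) (e : A → K),
    CompactSpace K ∧ T2Space K ∧ IsEmbedding e ∧ IsGδ (Set.range e)

/-- `A` is regular Hausdorff and an open continuous image of a Čech complete space. -/
def Interpretable (A : Type u) [TopologicalSpace A] : Prop :=
  RegularSpace A ∧ T2Space A ∧ ∃ (Y : Type u) (_ : TopologicalSpace Y) (g : Y → A),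
    CechComplete Y ∧ Continuous g ∧ IsOpenMap g ∧ Function.Surjective g

end TopInterp

open TopInterp

/-! A point a of a preinterpretation is determined by `nbhd a`, the set of open sets O of M with a ∈
π(O). These sets are proper filters on τ, prime for unions of families in M (`IsPt`), and reductions
are the maps that preserve them. So the space of all such filters (`PtSpace`) is a largest
preinterpretation of any X, and a preinterpretation is an interpretation iff it realizes every
filter (`isInterpretation_iff`). It remains to compare this with completeness.

If X is regular, no filter properly contains another (`IsPt.eq_of_subset`), so a common point of the
closures of the π(O), O ∈ G, has filter G; hence complete or compact targets realize all filters.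
Conversely, an ultrafilter on the interpretation that meets every open cover of X in M converges
(`Preinterp.exists_le_nhds`). If a cover is missed, an external descending sequence witnesses this;
its finite parts lie in M and form a branch of a tree definable over M. By absoluteness of
wellfoundedness the tree has a branch in M (`exists_internal_branch`), which contradicts
completeness in M.

For compact X, finite subcovers in M stay covers. A Čech complete X is the intersection of open G n
in a compact K; filters on K containing every G n restrict to X (`IsCechEmbedding.exists_isPt`), so
the interpretation of X is the intersection of the π(G n). For interpretable X, filters lift along
the open map (`exists_isPt_lift`), so the induced map of interpretations is open and onto. For
metric X, a dense isometry into a complete space extends to an interpretation through `openExt`; its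
union clause (`openExt_sUnion`) is again a branch argument.

The classes `DefTerm` and `Dfn` let instance search verify the definability needed for separation
and replacement. -/

namespace TopInterp

/-! ### Definability over a structure for the language of set theory -/

section Definability

variable {W : Type v} [Membership W W]

open FirstOrder Language

/-- The function `t` of an assignment of values to variables is the value of a term. -/
class DefTerm (t : (ℕ → W) → W) : Prop where
  out : ∃ s : setLang[[(Set.univ : Set W)]].Term ℕ, ∀ v, s.realize v = t v

/-- The property `φ` of an assignment of values to variables is first order definable with
parameters. -/
class Dfn (φ : (ℕ → W) → Prop) : Prop where
  out : ∃ s : setLang[[(Set.univ : Set W)]].Formula ℕ, ∀ v, s.Realize v ↔ φ v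

instance DefTerm.var (i : ℕ) : DefTerm (fun v : ℕ → W => v i) := ⟨Term.var i, fun _ => rfl⟩

instance DefTerm.const (a : W) : DefTerm (fun _ : ℕ → W => a) :=
  ⟨Constants.term (Language.con setLang (⟨a, trivial⟩ : (Set.univ : Set W))), fun v => by simp⟩

instance DefTerm.relabel (t : (ℕ → W) → W) (g : ℕ → ℕ) [h : DefTerm t] :
    DefTerm (fun v : ℕ → W => t (fun k => v (g k))) := by
  obtain ⟨s, hs⟩ := h.out
  exact ⟨s.relabel g, fun v => by simp [← hs, Function.comp_def]⟩

instance Dfn.mem (s t : (ℕ → W) → W) [hs : DefTerm s] [ht : DefTerm t] :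
    Dfn (fun v => s v ∈ t v) := by
  obtain ⟨a, ha⟩ := hs.out
  obtain ⟨b, hb⟩ := ht.out
  refine ⟨Relations.formula₂ (L := setLang[[(Set.univ : Set W)]]) (Sum.inl SetRel.mem) a b,
    fun v => ?_⟩
  refine Formula.realize_rel₂.trans ?_
  rw [ha, hb]
  rfl

instance Dfn.eq (s t : (ℕ → W) → W) [hs : DefTerm s] [ht : DefTerm t] :
    Dfn (fun v => s v = t v) := by
  obtain ⟨a, ha⟩ := hs.out
  obtain ⟨b, hb⟩ := ht.out
  exact ⟨a.equal b, fun v => by rw [Formula.realize_equal, ha, hb]⟩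

instance Dfn.not (φ : (ℕ → W) → Prop) [h : Dfn φ] : Dfn (fun v => ¬ φ v) := by
  obtain ⟨a, ha⟩ := h.out
  exact ⟨a.not, fun v => by rw [Formula.realize_not, ha]⟩

instance Dfn.and (φ ψ : (ℕ → W) → Prop) [h : Dfn φ] [h' : Dfn ψ] : Dfn (fun v => φ v ∧ ψ v) := by
  obtain ⟨a, ha⟩ := h.out
  obtain ⟨b, hb⟩ := h'.out
  exact ⟨a ⊓ b, fun v => by rw [Formula.realize_inf, ha, hb]⟩

instance Dfn.imp (φ ψ : (ℕ → W) → Prop) [h : Dfn φ] [h' : Dfn ψ] :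
    Dfn (fun v => φ v → ψ v) := by
  obtain ⟨a, ha⟩ := h.out
  obtain ⟨b, hb⟩ := h'.out
  exact ⟨a.imp b, fun v => by rw [Formula.realize_imp, ha, hb]⟩

instance Dfn.or (φ ψ : (ℕ → W) → Prop) [h : Dfn φ] [h' : Dfn ψ] : Dfn (fun v => φ v ∨ ψ v) := by
  obtain ⟨a, ha⟩ := h.out
  obtain ⟨b, hb⟩ := h'.out
  exact ⟨a ⊔ b, fun v => by rw [Formula.realize_sup, ha, hb]⟩

instance Dfn.iff (φ ψ : (ℕ → W) → Prop) [h : Dfn φ] [h' : Dfn ψ] :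
    Dfn (fun v => (φ v ↔ ψ v)) := by
  obtain ⟨a, ha⟩ := h.out
  obtain ⟨b, hb⟩ := h'.out
  exact ⟨a.iff b, fun v => by rw [Formula.realize_iff, ha, hb]⟩

/-- The bound variable takes index 0 and the others move up by one; `DefTerm.relabel` absorbs the
shifts of nested quantifiers. -/
instance Dfn.ex (φ : (ℕ → W) → W → Prop) [h : Dfn (fun v => φ (fun k => v (k + 1)) (v 0))] :
    Dfn (fun v => ∃ y, φ v y) := by
  obtain ⟨a, ha⟩ := h.out
  let g : ℕ → ℕ ⊕ Unit := fun k => k.casesOn (Sum.inr ()) Sum.inl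
  refine ⟨(a.relabel g).iExs Unit, fun v => ?_⟩
  rw [Formula.realize_iExs]
  simp only [Formula.realize_relabel, ha]
  exact ⟨fun ⟨i, hi⟩ => ⟨i (), hi⟩, fun ⟨y, hy⟩ => ⟨fun _ => y, hy⟩⟩

instance Dfn.all (φ : (ℕ → W) → W → Prop) [h : Dfn (fun v => φ (fun k => v (k + 1)) (v 0))] :
    Dfn (fun v => ∀ y, φ v y) := by
  have : Dfn (fun v => ¬ ∃ y, ¬ φ v y) := Dfn.not _ (h := Dfn.ex _)
  simpa only [not_exists, not_not] using this

theorem Dfn.definable₁ {φ : W → Prop} (h : Dfn (fun v => φ (v 0))) :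
    (Set.univ : Set W).Definable₁ setLang {x | φ x} := by
  obtain ⟨a, ha⟩ := h.out
  refine ⟨a.relabel (fun _ => 0), ?_⟩
  ext x
  simp only [mem_ofPred_eq, Formula.realize_relabel, ha, Function.comp]

theorem Dfn.definable₂ {φ : W → W → Prop} (h : Dfn (fun v => φ (v 0) (v 1))) :
    (Set.univ : Set W).Definable₂ setLang {p | φ p.1 p.2} := by
  obtain ⟨a, ha⟩ := h.out
  refine ⟨a.relabel (fun k : ℕ => k.casesOn 0 (fun _ => 1)), ?_⟩
  ext x
  simp only [mem_ofPred_eq, Formula.realize_relabel, ha, Function.comp]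
  exact Iff.rfl

theorem Dfn.subst {φ : (ℕ → W) → Prop} (h : Dfn φ) (σ : ℕ → (ℕ → W) → W)
    (hσ : ∀ i, DefTerm (σ i)) : Dfn (fun v => φ (fun i => σ i v)) := by
  obtain ⟨a, ha⟩ := h.out
  choose τ hτ using fun i => (hσ i).out
  refine ⟨a.subst τ, fun v => ?_⟩
  rw [Formula.Realize, BoundedFormula.realize_subst, ← ha, Formula.Realize]
  simp only [hτ]

/-- As a local instance, this lets instance search treat a definable relation variable like an
atomic formula applied to any terms. -/
theorem Dfn.subst₂ {φ : W → W → Prop} (h : Dfn (fun v => φ (v 0) (v 1)))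
    (s t : (ℕ → W) → W) [hs : DefTerm s] [ht : DefTerm t] : Dfn (fun v => φ (s v) (t v)) :=
  h.subst (fun i => match i with | 0 => s | _ => t) fun i => match i with
    | 0 => hs
    | _ + 1 => ht

theorem Dfn.subst₃ {φ : W → W → W → Prop} (h : Dfn (fun v => φ (v 0) (v 1) (v 2)))
    (r s t : (ℕ → W) → W) [hr : DefTerm r] [hs : DefTerm s] [ht : DefTerm t] :
    Dfn (fun v => φ (r v) (s v) (t v)) :=
  h.subst (fun i => match i with | 0 => r | 1 => s | _ => t) fun i => match i with
    | 0 => hr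
    | 1 => hs
    | _ + 2 => ht

instance Dfn.const (p : Prop) : Dfn (fun _ : ℕ → W => p) := by
  by_cases hp : p
  · exact ⟨⊤, fun v => by simp [hp]⟩
  · exact ⟨⊥, fun v => by simp [hp]⟩

instance Dfn.subsetIn (s t : (ℕ → W) → W) [DefTerm s] [DefTerm t] :
    Dfn (fun v => SubsetIn (s v) (t v)) := by
  unfold SubsetIn; infer_instance

instance Dfn.isSucc (s t : (ℕ → W) → W) [DefTerm s] [DefTerm t] :
    Dfn (fun v => IsSucc (s v) (t v)) := by
  unfold IsSucc; infer_instance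

instance Dfn.isInductive (s : (ℕ → W) → W) [DefTerm s] :
    Dfn (fun v => IsInductive (s v)) := by
  unfold IsInductive; infer_instance

instance Dfn.isUPair (s t r : (ℕ → W) → W) [DefTerm s] [DefTerm t] [DefTerm r] :
    Dfn (fun v => IsUPair (s v) (t v) (r v)) := by
  unfold IsUPair; infer_instance

instance Dfn.isOPair (s t r : (ℕ → W) → W) [DefTerm s] [DefTerm t] [DefTerm r] :
    Dfn (fun v => IsOPair (s v) (t v) (r v)) := by
  unfold IsOPair; infer_instance

/-- The graph of a function between sets of `W`, as a relation on `W`. -/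
def Graph {a b : W} (F : El a → El b) (x y : W) : Prop := ∃ h : x ∈ a, (F ⟨x, h⟩).1 = y

/-- The graph of a function of two variables, as a relation on `W`. -/
def Graph₂ {a b c : W} (F : El a → El b → El c) (x y z : W) : Prop :=
  ∃ (h : x ∈ a) (h' : y ∈ b), (F ⟨x, h⟩ ⟨y, h'⟩).1 = z

/-- A relation between sets of `W`, as a relation on `W`. -/
def Lift {a b : W} (R : El a → El b → Prop) (x y : W) : Prop :=
  ∃ (h : x ∈ a) (h' : y ∈ b), R ⟨x, h⟩ ⟨y, h'⟩

@[simp] theorem graph_iff {a b : W} {F : El a → El b} {x : El a} {y : W} :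
    Graph F x.1 y ↔ (F x).1 = y := ⟨fun ⟨_, h⟩ => h, fun h => ⟨x.2, h⟩⟩

@[simp] theorem graph₂_iff {a b c : W} {F : El a → El b → El c} {x : El a} {y : El b} {z : W} :
    Graph₂ F x.1 y.1 z ↔ (F x y).1 = z := ⟨fun ⟨_, _, h⟩ => h, fun h => ⟨x.2, y.2, h⟩⟩

@[simp] theorem lift_iff {a b : W} {R : El a → El b → Prop} {x : El a} {y : El b} :
    Lift R x.1 y.1 ↔ R x y := ⟨fun ⟨_, _, h⟩ => h, fun h => ⟨x.2, y.2, h⟩⟩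

end Definability

/-! ### Transitive models -/

/-- `M` is a transitive model of `ZFC`. -/
class TransModel (M : Set ZFSet.{u}) : Prop where
  trans : ∀ x ∈ M, ∀ y ∈ x, y ∈ M
  zfc : ModelsZFC M

section Model

variable {M : Set ZFSet.{u}} [TransModel M]

theorem mem_ext {a b : M} (h : ∀ x, x ∈ a ↔ x ∈ b) : a = b := TransModel.zfc.extensionality a b h

omit [TransModel M] in
theorem mem_induction {P : M → Prop} (h : ∀ x, (∀ y ∈ x, P y) → P x) (x : M) : P x :=
  (InvImage.wf (fun x : M => x.1) ZFSet.mem_wf).induction (C := P) x fun x ih => h x ih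

theorem sep (φ : M → Prop) [h : Dfn (fun v => φ (v 0))] (a : M) :
    ∃ b : M, ∀ x, x ∈ b ↔ x ∈ a ∧ φ x := TransModel.zfc.separation _ h.definable₁ a

theorem repl (φ : M → M → Prop) [h : Dfn (fun v => φ (v 0) (v 1))] (a : M)
    (hφ : ∀ x ∈ a, ∀ y z, φ x y → φ x z → y = z) :
    ∃ b : M, ∀ y, y ∈ b ↔ ∃ x ∈ a, φ x y :=
  TransModel.zfc.replacement _ h.definable₂ a hφ

/-! ### Absoluteness of pairs; finite sets and products in the model. -/

theorem isUPair_iff {z x y : M} : IsUPair z x y ↔ z.1 = {x.1, y.1} := by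
  constructor
  · intro h
    ext w
    simp only [ZFSet.mem_insert_iff, ZFSet.mem_singleton]
    constructor
    · intro hw
      have := (h ⟨w, TransModel.trans _ z.2 w hw⟩).1 hw
      simpa [Subtype.ext_iff] using this
    · rintro (rfl | rfl)
      · exact (h x).2 (Or.inl rfl)
      · exact (h y).2 (Or.inr rfl)
  · intro h w
    change w.1 ∈ z.1 ↔ _
    rw [h]
    simp [Subtype.ext_iff]

theorem isOPair_iff_val {z x y : M} : IsOPair z x y ↔ z.1 = ZFSet.pair x.1 y.1 := by
  constructor
  · intro h
    ext w
    rw [ZFSet.pair, ZFSet.mem_pair]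
    constructor
    · intro hw
      have := (h ⟨w, TransModel.trans _ z.2 w hw⟩).1 hw
      simpa [isUPair_iff] using this
    · intro hw
      rcases hw with rfl | rfl
      · obtain ⟨c, hc⟩ := TransModel.zfc.pairing x x
        have h' := (h c).2 (Or.inl hc)
        rw [isUPair_iff] at hc
        change c.1 ∈ z.1 at h'
        rw [hc] at h'
        simpa using h'
      · obtain ⟨c, hc⟩ := TransModel.zfc.pairing x y
        have h' := (h c).2 (Or.inr hc)
        rw [isUPair_iff] at hc
        change c.1 ∈ z.1 at h'
        rwa [hc] at h'
  · intro h w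
    change w.1 ∈ z.1 ↔ _
    rw [h]
    simp [ZFSet.pair, isUPair_iff]

theorem exists_oPair (x y : M) : ∃ p : M, IsOPair p x y := by
  obtain ⟨a, ha⟩ := TransModel.zfc.pairing x x
  obtain ⟨b, hb⟩ := TransModel.zfc.pairing x y
  obtain ⟨c, hc⟩ := TransModel.zfc.pairing a b
  refine ⟨c, ?_⟩
  rw [isUPair_iff] at ha hb hc
  rw [isOPair_iff_val, hc, ha, hb]
  simp [ZFSet.pair]

/-- The ordered pair in the model. -/
noncomputable def pr (x y : M) : M := (exists_oPair x y).choose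

theorem isOPair_pr (x y : M) : IsOPair (pr x y) x y := (exists_oPair x y).choose_spec

theorem isOPair_iff {z x y : M} : IsOPair z x y ↔ z = pr x y := by
  rw [isOPair_iff_val, ← isOPair_iff_val.1 (isOPair_pr x y), Subtype.ext_iff]

theorem pr_inj {x y x' y' : M} : pr x y = pr x' y' ↔ x = x' ∧ y = y' := by
  rw [← isOPair_iff, isOPair_iff_val, isOPair_iff_val.1 (isOPair_pr x y), ZFSet.pair_inj,
    Subtype.ext_iff, Subtype.ext_iff]

theorem exists_empty : ∃ e : M, ∀ x, x ∉ e := by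
  obtain ⟨I, hI, -⟩ := TransModel.zfc.infinity (W := M)
  obtain ⟨e, -, he⟩ := hI
  exact ⟨e, he⟩

theorem exists_insert (a x : M) : ∃ b : M, ∀ y, y ∈ b ↔ y ∈ a ∨ y = x := by
  obtain ⟨c, hc⟩ := TransModel.zfc.pairing x x
  obtain ⟨d, hd⟩ := TransModel.zfc.pairing a c
  obtain ⟨b, hb⟩ := TransModel.zfc.union d
  refine ⟨b, fun y => ?_⟩
  rw [hb]
  constructor
  · rintro ⟨z, hz, hy⟩
    rcases (hd z).1 hz with rfl | rfl
    · exact Or.inl hy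
    · exact Or.inr (by simpa using (hc y).1 hy)
  · rintro (hy | rfl)
    · exact ⟨a, (hd a).2 (Or.inl rfl), hy⟩
    · exact ⟨c, (hd c).2 (Or.inr rfl), (hc y).2 (Or.inl rfl)⟩

theorem exists_of_finite {s : Set M} (hs : s.Finite) : ∃ b : M, ∀ x, x ∈ b ↔ x ∈ s := by
  induction s, hs using Set.Finite.induction_on with
  | empty =>
    obtain ⟨e, he⟩ := exists_empty (M := M)
    exact ⟨e, fun x => by simp [he]⟩
  | @insert a s _ _ ih =>
    obtain ⟨b, hb⟩ := ih
    obtain ⟨c, hc⟩ := exists_insert b a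
    exact ⟨c, fun x => by rw [hc, hb, Set.mem_insert_iff, or_comm]⟩

theorem exists_union (a b : M) : ∃ c : M, ∀ y, y ∈ c ↔ y ∈ a ∨ y ∈ b := by
  obtain ⟨d, hd⟩ := TransModel.zfc.pairing a b
  obtain ⟨c, hc⟩ := TransModel.zfc.union d
  refine ⟨c, fun y => ?_⟩
  rw [hc]
  constructor
  · rintro ⟨z, hz, hy⟩
    rcases (hd z).1 hz with rfl | rfl
    exacts [Or.inl hy, Or.inr hy]
  · rintro (hy | hy)
    exacts [⟨a, (hd a).2 (Or.inl rfl), hy⟩, ⟨b, (hd b).2 (Or.inr rfl), hy⟩]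

omit [TransModel M] in
theorem mem_el {a b : M} (h : a ∈ b) : ∃ x : El b, x.1 = a := ⟨⟨a, h⟩, rfl⟩

theorem exists_prod (a b : M) : ∃ c : M, ∀ p, p ∈ c ↔ ∃ x ∈ a, ∃ y ∈ b, p = pr x y := by
  obtain ⟨d, hd⟩ := exists_union a b
  obtain ⟨e, he⟩ := TransModel.zfc.power d
  obtain ⟨f, hf⟩ := TransModel.zfc.power e
  obtain ⟨c, hc⟩ := sep (fun p => ∃ x ∈ a, ∃ y ∈ b, IsOPair p x y) f
  refine ⟨c, fun p => ?_⟩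
  rw [hc]
  simp only [isOPair_iff, and_iff_right_iff_imp]
  rintro ⟨x, hx, y, hy, rfl⟩
  rw [hf]
  intro z hz
  rw [he]
  intro w hw
  rw [hd]
  rcases (isOPair_pr x y z).1 hz with h | h
  · rcases (h w).1 hw with rfl | rfl
    exacts [Or.inl hx, Or.inl hx]
  · rcases (h w).1 hw with rfl | rfl
    exacts [Or.inl hx, Or.inr hy]

/-! ### Functions in the model -/

/-- The graph is separated out of the product a × b, so a definable description of the values
suffices for a function to belong to M. -/
theorem internal_of_dfn {a b : M} (F : El a → El b) (φ : M → M → Prop)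
    [hφ : Dfn (fun v => φ (v 0) (v 1))]
    (h : ∀ (x : El a) (y : M), φ x.1 y ↔ (F x).1 = y) :
    Internal F := by
  have := hφ.subst₂
  obtain ⟨c, hc⟩ := exists_prod a b
  obtain ⟨f, hf⟩ := sep (fun p => ∀ x y, IsOPair p x y → φ x y) c
  refine ⟨f, fun p => ?_⟩
  simp only [hf, hc, isOPair_iff]
  constructor
  · rintro ⟨⟨x, hx, y, hy, rfl⟩, h'⟩
    refine ⟨⟨x, hx⟩, ?_⟩
    rw [(h ⟨x, hx⟩ y).1 (h' x y rfl)]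
  · rintro ⟨x, rfl⟩
    refine ⟨⟨x.1, x.2, (F x).1, (F x).2, rfl⟩, fun x' y' he => ?_⟩
    obtain ⟨rfl, rfl⟩ := pr_inj.1 he
    exact (h x _).2 rfl

theorem Internal.exists_graph {a b : M} {F : El a → El b} (hF : Internal F) :
    ∃ f : M, ∀ x y, Graph F x y ↔ ∃ p ∈ f, IsOPair p x y := by
  obtain ⟨f, hf⟩ := hF
  refine ⟨f, fun x y => ?_⟩
  simp only [hf, isOPair_iff]
  constructor
  · rintro ⟨hx, rfl⟩
    exact ⟨_, ⟨⟨x, hx⟩, rfl⟩, rfl⟩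
  · rintro ⟨_, ⟨x', rfl⟩, h⟩
    obtain ⟨rfl, rfl⟩ := pr_inj.1 h
    exact graph_iff.2 rfl

instance Dfn.graph {a b : M} (F : El a → El b) [hF : Fact (Internal F)] (s t : (ℕ → M) → M)
    [DefTerm s] [DefTerm t] : Dfn (fun v => Graph F (s v) (t v)) := by
  obtain ⟨f, hf⟩ := hF.out.exists_graph
  simp only [hf]
  infer_instance

instance Dfn.graph₂ {a b c : M} (F : El a → El b → El c) [hF : Fact (Internal₂ F)]
    (s t r : (ℕ → M) → M) [DefTerm s] [DefTerm t] [DefTerm r] :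
    Dfn (fun v => Graph₂ F (s v) (t v) (r v)) := by
  obtain ⟨f, hf⟩ := hF.out
  have : ∀ x y z, Graph₂ F x y z ↔ ∃ p ∈ f, ∃ q, IsOPair q x y ∧ IsOPair p q z := by
    intro x y z
    simp only [hf, isOPair_iff]
    constructor
    · rintro ⟨hx, hy, rfl⟩
      exact ⟨_, ⟨⟨x, hx⟩, ⟨y, hy⟩, _, rfl, rfl⟩, _, rfl, rfl⟩
    · rintro ⟨_, ⟨x', y', q, rfl, rfl⟩, q', rfl, h⟩
      obtain ⟨h', rfl⟩ := pr_inj.1 h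
      obtain ⟨rfl, rfl⟩ := pr_inj.1 h'
      exact graph₂_iff.2 rfl
  simp only [this]
  infer_instance

instance Dfn.lift {a b : M} (R : El a → El b → Prop) [hR : Fact (InternalRel R)]
    (s t : (ℕ → M) → M) [DefTerm s] [DefTerm t] : Dfn (fun v => Lift R (s v) (t v)) := by
  obtain ⟨f, hf⟩ := hR.out
  have : ∀ x y, Lift R x y ↔ ∃ p ∈ f, IsOPair p x y := by
    intro x y
    simp only [hf, isOPair_iff]
    constructor
    · rintro ⟨hx, hy, h⟩
      exact ⟨_, ⟨⟨x, hx⟩, ⟨y, hy⟩, h, rfl⟩, rfl⟩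
    · rintro ⟨_, ⟨x', y', h', rfl⟩, h⟩
      obtain ⟨rfl, rfl⟩ := pr_inj.1 h
      exact lift_iff.2 h'
  simp only [this]
  infer_instance

/-- The axiom of choice in the model, for definable relations. -/
theorem exists_internal_choice (a b : M) (φ : M → M → Prop)
    [hφ : Dfn (fun v => φ (v 0) (v 1))]
    (h : ∀ x : El a, ∃ y : El b, φ x.1 y.1) :
    ∃ F : El a → El b, Internal F ∧ ∀ x, φ x.1 (F x).1 := by
  have := hφ.subst₂
  obtain ⟨c, hc⟩ := exists_prod a b
  -- Here e is the fibre of φ over x with every value tagged by x; the tags make different fibres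
  -- disjoint, as the axiom of choice demands.
  let D : M → M → Prop := fun x e => ∀ p, p ∈ e ↔ p ∈ c ∧ ∃ y, φ x y ∧ IsOPair p x y
  have : Dfn (fun v => D (v 0) (v 1)) := by unfold D; infer_instance
  have hD : ∀ x e, D x e ↔ ∀ p, p ∈ e ↔ x ∈ a ∧ ∃ y ∈ b, φ x y ∧ p = pr x y := by
    intro x e
    refine forall_congr' fun p => ?_
    simp only [hc, isOPair_iff]
    refine iff_congr Iff.rfl ⟨?_, ?_⟩
    · rintro ⟨⟨x', hx', y', hy', rfl⟩, y, hy, h⟩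
      obtain ⟨rfl, rfl⟩ := pr_inj.1 h
      exact ⟨hx', _, hy', hy, rfl⟩
    · rintro ⟨hx, y, hy, h, rfl⟩
      exact ⟨⟨x, hx, y, hy, rfl⟩, y, h, rfl⟩
  have hD' : ∀ x e e', D x e → D x e' → e = e' := fun x e e' h h' =>
    mem_ext fun p => (h p).trans (h' p).symm
  obtain ⟨A, hA⟩ := repl D a fun x _ => hD' x
  have hex : ∀ x ∈ a, ∃ e ∈ A, D x e := by
    intro x hx
    obtain ⟨e, he⟩ := sep (fun p => ∃ y, φ x y ∧ IsOPair p x y) c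
    exact ⟨e, (hA e).2 ⟨x, hx, he⟩, he⟩
  obtain ⟨g, hg⟩ := TransModel.zfc.choice A
    (by
      intro e he
      obtain ⟨x, hx, hxe⟩ := (hA e).1 he
      obtain ⟨y, hy⟩ := h ⟨x, hx⟩
      exact ⟨pr x y.1, ((hD x e).1 hxe _).2 ⟨hx, y.1, y.2, hy, rfl⟩⟩)
    (by
      rintro e he e' he' ⟨p, hp, hp'⟩
      obtain ⟨x, hx, hxe⟩ := (hA e).1 he
      obtain ⟨x', hx', hxe'⟩ := (hA e').1 he'
      obtain ⟨_, y, _, _, rfl⟩ := ((hD x e).1 hxe p).1 hp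
      obtain ⟨_, y', _, _, h⟩ := ((hD x' e').1 hxe' _).1 hp'
      obtain ⟨rfl, rfl⟩ := pr_inj.1 h
      exact hD' x e e' hxe hxe')
  have key : ∀ x : El a, ∃ y : El b, φ x.1 y.1 ∧
      ∀ z, (z ∈ b ∧ φ x.1 z ∧ ∃ p ∈ g, IsOPair p x.1 z) ↔ y.1 = z := by
    intro x
    obtain ⟨e, he, hxe⟩ := hex x.1 x.2
    obtain ⟨p, ⟨hp, hpg⟩, hu⟩ := hg e he
    obtain ⟨_, y, hy, hφy, rfl⟩ := ((hD x.1 e).1 hxe p).1 hp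
    refine ⟨⟨y, hy⟩, hφy, fun z => ?_⟩
    simp only [isOPair_iff]
    constructor
    · rintro ⟨hz, hφz, _, hq, rfl⟩
      have := hu (pr x.1 z) ⟨((hD x.1 e).1 hxe _).2 ⟨x.2, z, hz, hφz, rfl⟩, hq⟩
      exact (pr_inj.1 this).2.symm
    · rintro rfl
      exact ⟨hy, hφy, _, hpg, rfl⟩
  choose F hF hF' using key
  exact ⟨F, internal_of_dfn F (fun x z => z ∈ b ∧ φ x z ∧ ∃ p ∈ g, IsOPair p x z) hF', hF⟩

/-! ### Natural numbers -/

theorem exists_succ (n : M) : ∃ m : M, IsSucc m n := exists_insert n n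

/-- The natural numbers of the model. -/
noncomputable def num : ℕ → M
  | 0 => (exists_empty (M := M)).choose
  | n + 1 => (exists_succ (num n)).choose

theorem isSucc_num (n : ℕ) : IsSucc (num (n + 1) : M) (num n) :=
  (exists_succ (num n : M)).choose_spec

theorem notMem_num_zero (x : M) : x ∉ (num 0 : M) := (exists_empty (M := M)).choose_spec x

theorem isSucc_unique {m m' n : M} (h : IsSucc m n) (h' : IsSucc m' n) : m = m' :=
  mem_ext fun x => (h x).trans (h' x).symm

theorem isSucc_num_iff {m : M} {n : ℕ} : IsSucc m (num n) ↔ m = num (n + 1) :=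
  ⟨fun h => isSucc_unique h (isSucc_num n), fun h => h ▸ isSucc_num n⟩

theorem mem_num {x : M} {n : ℕ} : x ∈ (num n : M) ↔ ∃ m < n, x = num m := by
  induction n with
  | zero => simp [notMem_num_zero]
  | succ n ih =>
    rw [isSucc_num n x, ih]
    constructor
    · rintro (⟨m, hm, rfl⟩ | rfl)
      exacts [⟨m, by omega, rfl⟩, ⟨n, by omega, rfl⟩]
    · rintro ⟨m, hm, rfl⟩
      rcases Nat.lt_succ_iff_lt_or_eq.1 hm with h | rfl
      exacts [Or.inl ⟨m, h, rfl⟩, Or.inr rfl]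

omit [TransModel M] in
theorem mem_irrefl' (x : M) : x ∉ x := fun h => ZFSet.mem_irrefl x.1 h

theorem num_injective : Function.Injective (num : ℕ → M) := by
  intro m n h
  by_contra hne
  rcases lt_or_gt_of_ne hne with h' | h'
  · exact mem_irrefl' (num n : M) (mem_num.2 ⟨m, h', h.symm⟩)
  · exact mem_irrefl' (num m : M) (mem_num.2 ⟨n, h', h⟩)

theorem num_mem_num {m n : ℕ} : (num m : M) ∈ (num n : M) ↔ m < n := by
  rw [mem_num]
  constructor
  · rintro ⟨k, hk, h⟩
    rwa [num_injective h]
  · exact fun h => ⟨m, h, rfl⟩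

theorem IsInductive.num_mem {I : M} (hI : IsInductive I) (n : ℕ) : num n ∈ I := by
  induction n with
  | zero =>
    obtain ⟨⟨e, he, h⟩, -⟩ := hI
    rwa [show (num 0 : M) = e from mem_ext fun x => by simp [h, notMem_num_zero]]
  | succ n ih =>
    obtain ⟨m, hm, h⟩ := hI.2 _ ih
    rwa [← isSucc_num_iff.1 h]

/-- By ∈-induction: a successor in w comes from a standard number, and an element that is neither a
successor nor standard could be deleted from w, leaving a smaller inductive set. -/
theorem IsOmega.mem_iff {w : M} (hw : IsOmega w) {x : M} : x ∈ w ↔ ∃ n, x = num n := by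
  constructor
  · induction x using mem_induction with
    | h x ih =>
      intro hx
      by_cases hs : ∃ y ∈ w, IsSucc x y
      · obtain ⟨y, hy, hxy⟩ := hs
        obtain ⟨n, rfl⟩ := ih y ((hxy y).2 (Or.inr rfl)) hy
        exact ⟨n + 1, isSucc_num_iff.1 hxy⟩
      · by_contra hn
        obtain ⟨I, hI⟩ := sep (fun y => ¬ y = x) w
        refine ((hI x).1 (hw.2 I ⟨?_, ?_⟩ x hx)).2 rfl
        · refine ⟨num 0, (hI _).2 ⟨hw.1.num_mem 0, fun h => hn ⟨0, h.symm⟩⟩, notMem_num_zero⟩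
        · intro n hn
          obtain ⟨m, hm, hmn⟩ := hw.1.2 n ((hI n).1 hn).1
          exact ⟨m, (hI m).2 ⟨hm, fun h => hs ⟨n, ((hI n).1 hn).1, h ▸ hmn⟩⟩, hmn⟩
  · rintro ⟨n, rfl⟩
    exact hw.1.num_mem n

theorem exists_omega : ∃ w : M, IsOmega w := by
  obtain ⟨I, hI⟩ := TransModel.zfc.infinity (W := M)
  obtain ⟨w, hw⟩ := sep (fun x => ∀ J : M, IsInductive J → x ∈ J) I
  have hw' : ∀ x, x ∈ w ↔ ∀ J, IsInductive J → x ∈ J := fun x =>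
    ⟨fun h => ((hw x).1 h).2, fun h => (hw x).2 ⟨h I hI, h⟩⟩
  refine ⟨w, ⟨⟨num 0, (hw' _).2 fun J hJ => hJ.num_mem 0, notMem_num_zero⟩, ?_⟩,
    fun J hJ x hx => (hw' x).1 hx J hJ⟩
  intro n hn
  obtain ⟨m, hm⟩ := exists_succ n
  refine ⟨m, (hw' _).2 fun J hJ => ?_, hm⟩
  obtain ⟨m', hm', h⟩ := hJ.2 n ((hw' n).1 hn J hJ)
  rwa [isSucc_unique hm h]

/-- The natural number `n` as an element of the set of natural numbers of the model. -/
noncomputable def IsOmega.nat {w : M} (hw : IsOmega w) (n : ℕ) : El w :=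
  ⟨num n, hw.mem_iff.2 ⟨n, rfl⟩⟩

@[simp] theorem IsOmega.nat_val {w : M} (hw : IsOmega w) (n : ℕ) : (hw.nat n).1 = num n := rfl

theorem IsOmega.exists_nat {w : M} (hw : IsOmega w) (x : El w) : ∃ n, x = hw.nat n := by
  obtain ⟨n, hn⟩ := hw.mem_iff.1 x.2
  exact ⟨n, El.ext hn⟩

theorem IsOmega.nat_injective {w : M} (hw : IsOmega w) : Function.Injective hw.nat :=
  fun _ _ h => num_injective (congrArg El.val h)

theorem IsOmega.isSucc_iff {w : M} (hw : IsOmega w) {m n : El w} :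
    IsSucc m.1 n.1 ↔ ∃ k, m = hw.nat (k + 1) ∧ n = hw.nat k := by
  obtain ⟨n, rfl⟩ := hw.exists_nat n
  rw [hw.nat_val, isSucc_num_iff]
  constructor
  · exact fun h => ⟨n, El.ext h, rfl⟩
  · rintro ⟨k, rfl, h⟩
    rw [hw.nat_injective h, hw.nat_val]

theorem FiniteIn.finite {a : M} (h : FiniteIn a) : {x | x ∈ a}.Finite := by
  obtain ⟨w, hw, n, hn, F, -, hF⟩ := h
  obtain ⟨k, rfl⟩ := hw.mem_iff.1 hn
  let G : Fin k → M := fun i => (F ⟨num i, num_mem_num.2 i.2⟩).1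
  refine (Set.finite_range G).subset fun x hx => ?_
  obtain ⟨y, hy⟩ := hF ⟨x, hx⟩
  obtain ⟨m, hm, h⟩ := mem_num.1 y.2
  refine ⟨⟨m, hm⟩, ?_⟩
  have : y = ⟨num m, num_mem_num.2 hm⟩ := El.ext h
  simp only [G, ← this, hy]

/-- `a` is the image of a natural number under a set of pairs; `w` is the set of all natural
numbers. -/
def IsFinite (w a : M) : Prop := ∃ n ∈ w, ∃ h : M,
  (∀ y ∈ a, ∃ x ∈ n, ∃ p ∈ h, IsOPair p x y) ∧
    ∀ x y z, (∃ p ∈ h, IsOPair p x y) → (∃ p ∈ h, IsOPair p x z) → y = z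

instance Dfn.isFinite (w : M) (s : (ℕ → M) → M) [DefTerm s] :
    Dfn (fun v => IsFinite w (s v)) := by
  unfold IsFinite; infer_instance

/-- Unlike `FiniteIn`, which quantifies over typed functions, `IsFinite` is visibly a formula and
can be used inside definable relations. A finite enumeration is a finite set of pairs, hence an
element of M. -/
theorem isFinite_iff {w : M} (hw : IsOmega w) {a : M} : IsFinite w a ↔ {x | x ∈ a}.Finite := by
  simp only [IsFinite, isOPair_iff, exists_eq_right]
  constructor
  · rintro ⟨n, hn, h, h₁, h₂⟩
    obtain ⟨k, rfl⟩ := hw.mem_iff.1 hn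
    have hk : {x : M | x ∈ (num k : M)}.Finite :=
      (Set.finite_range fun i : Fin k => (num i : M)).subset fun x hx => by
        obtain ⟨m, hm, rfl⟩ := mem_num.1 hx
        exact ⟨⟨m, hm⟩, rfl⟩
    have : Nonempty M := ⟨w⟩
    refine (hk.image fun x => Classical.epsilon fun y => pr x y ∈ h).subset fun y hy => ?_
    obtain ⟨x, hx, hxy⟩ := h₁ y hy
    exact ⟨x, hx, h₂ x _ _ (Classical.epsilon_spec (p := fun y => pr x y ∈ h) ⟨y, hxy⟩) hxy⟩
  · intro hf
    obtain ⟨k, f, hf'⟩ : ∃ (k : ℕ) (f : Fin k → M), {x | x ∈ a} = Set.range f := by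
      have := hf.to_subtype
      let e := Finite.equivFin {x | x ∈ a}
      refine ⟨_, fun i => (e.symm i).1, ?_⟩
      ext x
      constructor
      · exact fun hx => ⟨e ⟨x, hx⟩, by simp⟩
      · rintro ⟨i, rfl⟩
        exact (e.symm i).2
    obtain ⟨h, hh⟩ := exists_of_finite (Set.finite_range fun i : Fin k => pr (num i) (f i))
    refine ⟨num k, hw.mem_iff.2 ⟨k, rfl⟩, h, fun y hy => ?_, fun x y z => ?_⟩
    · have hy' : y ∈ {x | x ∈ a} := hy
      rw [hf'] at hy'
      obtain ⟨i, rfl⟩ := hy'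
      exact ⟨num i, num_mem_num.2 i.2, (hh _).2 ⟨i, rfl⟩⟩
    · rw [hh, hh]
      rintro ⟨i, hi⟩ ⟨j, hj⟩
      obtain ⟨rfl, rfl⟩ := pr_inj.1 hi
      obtain ⟨h, rfl⟩ := pr_inj.1 hj
      rw [Fin.ext (num_injective h)]

/-- Recursion along the natural numbers of the model. -/
theorem exists_internal_rec {w : M} (hw : IsOmega w) {B : M} (g : El B → El B) (hg : Internal g)
    (b : El B) : ∃ s : El w → El B, Internal s ∧ ∀ n, s (hw.nat n) = g^[n] b := by
  have := Fact.mk hg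
  -- The set h is a history of the recursion: each of its pairs is the initial one or follows by g
  -- from another pair of h.
  let φ : M → M → Prop := fun n t => ∃ h : M, (∃ p ∈ h, IsOPair p n t) ∧ ∀ p ∈ h,
    IsOPair p (num 0) b.1 ∨
      ∃ k z m y, IsOPair p m y ∧ IsSucc m k ∧ Graph g z y ∧ ∃ q ∈ h, IsOPair q k z
  have hφ : ∀ (n : ℕ) t, φ (num n) t ↔ (g^[n] b).1 = t := by
    intro n t
    constructor
    · simp only [φ, isOPair_iff, exists_eq_right]
      rintro ⟨h, hp, hh⟩
      induction n generalizing t with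
      | zero =>
        rcases hh _ hp with h | ⟨k, z, m, y, h, h', -⟩
        · exact (pr_inj.1 h).2.symm
        · obtain ⟨rfl, rfl⟩ := pr_inj.1 h
          exact absurd ((h' k).2 (Or.inr rfl)) (notMem_num_zero k)
      | succ n ih =>
        rcases hh _ hp with h | ⟨k, z, m, y, h, h', hzy, hq⟩
        · exact absurd (num_injective (pr_inj.1 h).1) (by omega)
        · obtain ⟨rfl, rfl⟩ := pr_inj.1 h
          have hk : k = num n := by
            obtain ⟨i, hi, rfl⟩ := mem_num.1 ((h' k).2 (Or.inr rfl))
            rw [isSucc_num_iff] at h'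
            rw [show n = i by have := num_injective h'; omega]
          subst hk
          rw [Function.iterate_succ_apply']
          have := ih z hq
          subst this
          exact graph_iff.1 hzy
    · rintro rfl
      obtain ⟨h, hh⟩ := exists_of_finite
        (Set.finite_range fun i : Fin (n + 1) => pr (num i) (g^[i] b).1)
      refine ⟨h, ⟨_, (hh _).2 ⟨Fin.last n, rfl⟩, isOPair_pr _ _⟩, fun p hp => ?_⟩
      obtain ⟨⟨i, hi⟩, rfl⟩ := (hh p).1 hp
      rcases i with _ | i
      · exact Or.inl (isOPair_pr _ _)
      · refine Or.inr ⟨num i, _, num (i + 1), _, isOPair_pr _ _, isSucc_num i, ?_, _,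
          (hh _).2 ⟨⟨i, by omega⟩, rfl⟩, isOPair_pr _ _⟩
        rw [graph_iff, Function.iterate_succ_apply']
  let s : El w → El B := fun x => g^[(hw.exists_nat x).choose] b
  have hs : ∀ n, s (hw.nat n) = g^[n] b := fun n => by
    have := hw.nat_injective (hw.exists_nat (hw.nat n)).choose_spec
    simp only [s, ← this]
  refine ⟨s, internal_of_dfn s φ fun x y => ?_, hs⟩
  obtain ⟨n, rfl⟩ := hw.exists_nat x
  rw [hs]
  exact hφ n y

/-! ### Absoluteness of wellfoundedness -/

section Rank

variable (C : M) (ρ : M → M → Prop)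

/-- `g` is a partial collapsing map for the relation `ρ` on `C`. -/
def IsCollapse (g : M) : Prop := ∀ p ∈ g, ∃ x z, IsOPair p x z ∧
  (∀ y ∈ C, ρ x y → ∃ w ∈ z, ∃ q ∈ g, IsOPair q y w) ∧
    ∀ w ∈ z, ∃ y ∈ C, ρ x y ∧ ∃ q ∈ g, IsOPair q y w

/-- A partial collapsing map sends `x` to `z`. -/
def Collapses (x z : M) : Prop := ∃ g, IsCollapse C ρ g ∧ ∃ q ∈ g, IsOPair q x z

instance Dfn.collapses
    [hρ : Dfn (fun v => ρ (v 0) (v 1))]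
    (s t : (ℕ → M) → M) [DefTerm s] [DefTerm t] : Dfn (fun v => Collapses C ρ (s v) (t v)) := by
  have := hρ.subst₂
  unfold Collapses IsCollapse; infer_instance

variable {C ρ}

theorem IsCollapse.spec {g : M} (hg : IsCollapse C ρ g) {x z : M} (h : pr x z ∈ g) :
    (∀ y ∈ C, ρ x y → ∃ w ∈ z, pr y w ∈ g) ∧ ∀ w ∈ z, ∃ y ∈ C, ρ x y ∧ pr y w ∈ g := by
  obtain ⟨x', z', h', hh⟩ := hg _ h
  simp only [isOPair_iff, exists_eq_right] at h' hh
  obtain ⟨rfl, rfl⟩ := pr_inj.1 h'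
  exact hh

theorem collapses_iff {x z : M} : Collapses C ρ x z ↔ ∃ g, IsCollapse C ρ g ∧ pr x z ∈ g := by
  simp only [Collapses, isOPair_iff, exists_eq_right]

/-- Induction runs along ∈ on the value, so ρ need not be wellfounded: the elements of both values
are collapses of the ρ-successors of x. -/
theorem Collapses.unique {x z z' : M} (h : Collapses C ρ x z) (h' : Collapses C ρ x z') :
    z = z' := by
  induction z using mem_induction generalizing x z' with
  | h z ih =>
    obtain ⟨g, hg, hx⟩ := collapses_iff.1 h
    obtain ⟨g', hg', hx'⟩ := collapses_iff.1 h'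
    refine mem_ext fun w => ⟨fun hw => ?_, fun hw => ?_⟩
    · obtain ⟨y, hy, hxy, hw'⟩ := (hg.spec hx).2 w hw
      obtain ⟨v, hv, hv'⟩ := (hg'.spec hx').1 y hy hxy
      rwa [ih w hw (collapses_iff.2 ⟨g, hg, hw'⟩) (collapses_iff.2 ⟨g', hg', hv'⟩)]
    · obtain ⟨y, hy, hxy, hw'⟩ := (hg'.spec hx').2 w hw
      obtain ⟨v, hv, hv'⟩ := (hg.spec hx).1 y hy hxy
      rwa [← ih v hv (collapses_iff.2 ⟨g, hg, hv'⟩) (collapses_iff.2 ⟨g', hg', hw'⟩)]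

/-- Along a ρ-chain the values would form an infinite ∈-descent. -/
theorem not_collapses_of_chain {p : ℕ → M} (hp : ∀ n, p n ∈ C) (h : ∀ n, ρ (p n) (p (n + 1)))
    (n : ℕ) (z : M) : ¬ Collapses C ρ (p n) z := by
  induction z using mem_induction generalizing n with
  | h z ih =>
    intro hc
    obtain ⟨g, hg, hx⟩ := collapses_iff.1 hc
    obtain ⟨w, hw, hw'⟩ := (hg.spec hx).1 _ (hp (n + 1)) (h n)
    exact ih w hw (n + 1) (collapses_iff.2 ⟨g, hg, hw'⟩)

/-- The value Z is the set of collapses of the ρ-successors of x. The witness adds the pair (x, Z)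
to all pairs (y, z) with y ∈ C ∪ {x} and z a collapse of y. -/
theorem exists_collapses
    [hρ : Dfn (fun v => ρ (v 0) (v 1))] {x : M}
    (h : ∀ y ∈ C, ρ x y → ∃ z, Collapses C ρ y z) : ∃ z, Collapses C ρ x z := by
  have := hρ.subst₂
  obtain ⟨Z, hZ⟩ := repl (fun y z => ρ x y ∧ Collapses C ρ y z) C
    fun y _ z z' h h' => h.2.unique h'.2
  obtain ⟨C', hC'⟩ := exists_insert C x
  obtain ⟨G, hG⟩ := repl (fun y p => ∃ z, IsOPair p y z ∧ Collapses C ρ y z) C'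
    (by
      rintro y _ p p' ⟨z, hz, h⟩ ⟨z', hz', h'⟩
      rw [isOPair_iff] at hz hz'
      rw [hz, hz', h.unique h'])
  obtain ⟨G', hG'⟩ := exists_insert G (pr x Z)
  have hGC : ∀ y ∈ C', ∀ z, Collapses C ρ y z → pr y z ∈ G' := fun y hy z hz =>
    (hG' _).2 (Or.inl ((hG _).2 ⟨y, hy, z, isOPair_pr y z, hz⟩))
  refine ⟨Z, collapses_iff.2 ⟨G', fun p hp => ?_, (hG' _).2 (Or.inr rfl)⟩⟩
  simp only [isOPair_iff, exists_eq_right]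
  rcases (hG' p).1 hp with hp | rfl
  · obtain ⟨y, -, z, hpz, hc⟩ := (hG p).1 hp
    rw [isOPair_iff] at hpz
    refine ⟨y, z, hpz, fun t ht hyt => ?_, fun t ht => ?_⟩
    · obtain ⟨g, hg, hx⟩ := collapses_iff.1 hc
      obtain ⟨w, hw, hw'⟩ := (hg.spec hx).1 t ht hyt
      exact ⟨w, hw, hGC t ((hC' _).2 (Or.inl ht)) w (collapses_iff.2 ⟨g, hg, hw'⟩)⟩
    · obtain ⟨g, hg, hx⟩ := collapses_iff.1 hc
      obtain ⟨s, hs, hys, hst⟩ := (hg.spec hx).2 t ht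
      exact ⟨s, hs, hys, hGC s ((hC' _).2 (Or.inl hs)) t (collapses_iff.2 ⟨g, hg, hst⟩)⟩
  · refine ⟨x, Z, rfl, fun y hy hxy => ?_, fun w hw => ?_⟩
    · obtain ⟨z, hz⟩ := h y hy hxy
      exact ⟨z, (hZ z).2 ⟨y, hy, hxy, hz⟩, hGC y ((hC' _).2 (Or.inl hy)) z hz⟩
    · obtain ⟨y, hy, hxy, hc⟩ := (hZ w).1 hw
      exact ⟨y, hy, hxy, hGC y ((hC' _).2 (Or.inl hy)) w hc⟩

end Rank

/-- If a definable relation has an infinite chain, then it has one in the model. -/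
theorem exists_internal_chain {w : M} (hw : IsOmega w) (C : M) (ρ : M → M → Prop)
    [hρ : Dfn (fun v => ρ (v 0) (v 1))]
    (p : ℕ → El C) (hp : ∀ n, ρ (p n).1 (p (n + 1)).1) :
    ∃ t : El w → El C, Internal t ∧ t (hw.nat 0) = p 0 ∧
      ∀ n, ρ (t (hw.nat n)).1 (t (hw.nat (n + 1))).1 := by
  have := hρ.subst₂
  -- B is the illfounded part of C. It contains `p 0`, and each of its elements has a ρ-successor in
  -- B, so choice and recursion in M produce a chain inside it.
  obtain ⟨B, hB⟩ := sep (fun x => ¬ ∃ z, Collapses C ρ x z) C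
  obtain ⟨g, hg, hg'⟩ := exists_internal_choice B B (fun x y => ρ x y) (by
    intro x
    by_contra hx
    push Not at hx
    refine ((hB x.1).1 x.2).2 (exists_collapses fun y hy hxy => ?_)
    by_contra hy'
    exact hx ⟨y, (hB y).2 ⟨hy, hy'⟩⟩ hxy)
  have hp0 : (p 0).1 ∈ B := (hB _).2 ⟨(p 0).2, fun ⟨z, hz⟩ =>
    not_collapses_of_chain (fun n => (p n).2) hp 0 z hz⟩
  obtain ⟨s, hs, hs'⟩ := exists_internal_rec hw g hg ⟨(p 0).1, hp0⟩
  have := Fact.mk hs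
  refine ⟨fun n => ⟨(s n).1, ((hB _).1 (s n).2).1⟩,
    internal_of_dfn _ (fun n x => Graph s n x) fun n x => graph_iff, ?_, fun n => ?_⟩
  · exact El.ext (congrArg El.val (hs' 0) :)
  · have := hg' (s (hw.nat n))
    rwa [hs', ← Function.iterate_succ_apply' g, ← hs', ← hs'] at this

/-- If there is an infinite branch through a definable tree, then there is one in the model. -/
theorem exists_internal_branch {w : M} (hw : IsOmega w) (B : M) (φ : M → M → M → Prop)
    [hφ : Dfn (fun v => φ (v 0) (v 1) (v 2))]
    (b : ℕ → El B) (hb : ∀ n, φ (num n) (b n).1 (b (n + 1)).1) :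
    ∃ s : El w → El B, Internal s ∧ s (hw.nat 0) = b 0 ∧
      ∀ n, φ (num n) (s (hw.nat n)).1 (s (hw.nat (n + 1))).1 := by
  have := hφ.subst₃
  obtain ⟨C, hC⟩ := exists_prod w B
  -- Storing the level in the node turns the level-dependent φ into a single relation on w × B.
  obtain ⟨t, ht, ht0, htn⟩ := exists_internal_chain hw C
    (fun p q => ∃ n m x y, IsOPair p n x ∧ IsOPair q m y ∧ IsSucc m n ∧ φ n x y)
    (fun n => ⟨pr (num n) (b n).1, (hC _).2 ⟨_, hw.mem_iff.2 ⟨n, rfl⟩, _, (b n).2, rfl⟩⟩)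
    (fun n => ⟨_, _, _, _, isOPair_pr _ _, isOPair_pr _ _, isSucc_num n, hb n⟩)
  simp only [isOPair_iff] at htn
  have key : ∀ n, ∃ y : El B, (t (hw.nat n)).1 = pr (num n) y.1 := by
    intro n
    induction n with
    | zero => exact ⟨b 0, by rw [ht0]⟩
    | succ n ih =>
      obtain ⟨y, hy⟩ := ih
      obtain ⟨k, m, x, z, h₁, h₂, h₃, -⟩ := htn n
      obtain ⟨rfl, rfl⟩ := pr_inj.1 (hy.symm.trans h₁)
      rw [isSucc_num_iff] at h₃
      subst h₃
      obtain ⟨_, _, z', hz', h⟩ := (hC _).1 (t (hw.nat (n + 1))).2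
      obtain ⟨rfl, rfl⟩ := pr_inj.1 (h₂.symm.trans h)
      exact ⟨⟨_, hz'⟩, h₂⟩
  have key' : ∀ x : El w, ∃ y : El B, (t x).1 = pr x.1 y.1 := by
    intro x
    obtain ⟨n, rfl⟩ := hw.exists_nat x
    exact key n
  choose s hs using key'
  have := Fact.mk ht
  refine ⟨s, internal_of_dfn s (fun n y => ∃ p, Graph t n p ∧ IsOPair p n y) fun n y => ?_, ?_,
    fun n => ?_⟩
  · simp only [graph_iff, isOPair_iff, exists_eq_left', hs, pr_inj, true_and]
  · have := hs (hw.nat 0)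
    rw [ht0] at this
    exact El.ext (pr_inj.1 this).2.symm
  · obtain ⟨k, m, x, z, h₁, h₂, h₃, h⟩ := htn n
    rw [hs] at h₁ h₂
    obtain ⟨rfl, rfl⟩ := pr_inj.1 h₁
    obtain ⟨rfl, rfl⟩ := pr_inj.1 h₂
    exact h

end Model

section Points

variable {M : Set ZFSet.{u}} [TransModel M] {X τ : M}

/-! ### Points of a space of the model -/

/-- `G` is the set of all open sets containing some ideal point of `X`: a proper filter of open sets
which is prime with respect to unions of families of the model. -/
structure IsPt (X τ : M) (G : Set (El τ)) : Prop where
  univ : ∀ O : El τ, O.1 = X → O ∈ G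
  nonempty : ∀ O ∈ G, ∃ x, x ∈ O.1
  inter : ∀ O ∈ G, ∀ P ∈ G, ∀ Q : El τ, (∀ x, x ∈ Q.1 ↔ x ∈ O.1 ∧ x ∈ P.1) → Q ∈ G
  mono : ∀ O ∈ G, ∀ P : El τ, SubsetIn O.1 P.1 → P ∈ G
  prime : ∀ S : M, SubsetIn S τ → ∀ O ∈ G, (∀ x, x ∈ O.1 ↔ ∃ P ∈ S, x ∈ P) → ∃ P ∈ G, P.1 ∈ S

theorem exists_inter (hT : IsTopIn X τ) (O P : El τ) :
    ∃ Q : El τ, ∀ x, x ∈ Q.1 ↔ x ∈ O.1 ∧ x ∈ P.1 := by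
  obtain ⟨Q, hQ⟩ := sep (fun x => x ∈ P.1) O.1
  exact ⟨⟨Q, hT.inter_mem _ O.2 _ P.2 Q hQ⟩, hQ⟩

theorem exists_iUnion (hT : IsTopIn X τ) (φ : M → Prop) [hφ : Dfn (fun v => φ (v 0))] :
    ∃ Q : El τ, ∀ x, x ∈ Q.1 ↔ ∃ P : El τ, φ P.1 ∧ x ∈ P.1 := by
  obtain ⟨S, hS⟩ := sep φ τ
  obtain ⟨Q, hQ⟩ := TransModel.zfc.union S
  refine ⟨⟨Q, hT.union_mem S (fun P hP => ((hS P).1 hP).1) Q hQ⟩, fun x => (hQ x).trans ?_⟩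
  constructor
  · rintro ⟨P, hP, hx⟩
    exact ⟨⟨P, ((hS P).1 hP).1⟩, ((hS P).1 hP).2, hx⟩
  · rintro ⟨P, hP, hx⟩
    exact ⟨P.1, (hS _).2 ⟨P.2, hP⟩, hx⟩

theorem exists_empty_open (hT : IsTopIn X τ) : ∃ Q : El τ, ∀ x, x ∉ Q.1 := by
  obtain ⟨Q, hQ⟩ := exists_iUnion hT (fun _ => False)
  exact ⟨Q, fun x hx => by simpa using (hQ x).1 hx⟩

/-- Primeness speaks of exact unions; the union of the open sets with φ contains O, so it is in G by
monotonicity. -/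
theorem IsPt.cover {G : Set (El τ)} (hG : IsPt X τ G) (hT : IsTopIn X τ) (φ : M → Prop)
    [hφ : Dfn (fun v => φ (v 0))] {O : El τ} (hO : O ∈ G)
    (h : ∀ x ∈ O.1, ∃ P : El τ, φ P.1 ∧ x ∈ P.1) : ∃ P ∈ G, φ P.1 := by
  obtain ⟨S, hS⟩ := sep φ τ
  obtain ⟨Q, hQ⟩ := exists_iUnion hT φ
  obtain ⟨P, hP, hPS⟩ := hG.prime S (fun P hP => ((hS P).1 hP).1) Q
    (hG.mono O hO Q fun x hx => (hQ x).2 (h x hx)) (fun x => by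
      rw [hQ]
      constructor
      · rintro ⟨P, hP, hx⟩
        exact ⟨P.1, (hS _).2 ⟨P.2, hP⟩, hx⟩
      · rintro ⟨P, hP, hx⟩
        exact ⟨⟨P, ((hS P).1 hP).1⟩, ((hS P).1 hP).2, hx⟩)
  exact ⟨P, hP, ((hS _).1 hPS).2⟩

theorem IsPt.cover_univ {G : Set (El τ)} (hG : IsPt X τ G) (hT : IsTopIn X τ) (φ : M → Prop)
    [hφ : Dfn (fun v => φ (v 0))] (h : ∀ x ∈ X, ∃ P : El τ, φ P.1 ∧ x ∈ P.1) : ∃ P ∈ G, φ P.1 :=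
  hG.cover hT φ (O := ⟨X, hT.univ_mem⟩) (hG.univ _ rfl) h

theorem IsPt.exists_mem {G : Set (El τ)} (hG : IsPt X τ G) (hT : IsTopIn X τ) {O P : El τ}
    (hO : O ∈ G) (hP : P ∈ G) : ∃ x, x ∈ O.1 ∧ x ∈ P.1 := by
  obtain ⟨Q, hQ⟩ := exists_inter hT O P
  obtain ⟨x, hx⟩ := hG.nonempty Q (hG.inter O hO P hP Q hQ)
  exact ⟨x, (hQ x).1 hx⟩

/-- The set `P` has its closure inside the set `O`. -/
def Inside (X τ P O : M) : Prop := ∀ x ∈ X, x ∈ O ∨ ∃ Q ∈ τ, x ∈ Q ∧ ∀ y ∈ Q, y ∉ P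

instance Dfn.inside (X τ : M) (s t : (ℕ → M) → M) [DefTerm s] [DefTerm t] :
    Dfn (fun v => Inside X τ (s v) (t v)) := by
  unfold Inside; infer_instance

omit [TransModel M] in
theorem Inside.subset {P O : M} (h : Inside X τ P O) (hP : SubsetIn P X) : SubsetIn P O := by
  intro x hx
  rcases h x (hP x hx) with h | ⟨Q, -, hxQ, hQ⟩
  exacts [h, absurd hx (hQ x hxQ)]

/-- Every point of an open set has a neighborhood whose closure lies in the open set. -/
def IsReg (X τ : M) : Prop := ∀ O : El τ, ∀ x ∈ O.1, ∃ P : El τ, x ∈ P.1 ∧ Inside X τ P.1 O.1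

theorem exists_compl (a b : M) : ∃ c : M, ∀ x, x ∈ c ↔ x ∈ a ∧ x ∉ b := sep (fun x => x ∉ b) a

theorem RegularIn.isReg (hT : IsTopIn X τ) (h : RegularIn X τ) : IsReg X τ := by
  intro O x hx
  obtain ⟨C, hC⟩ := exists_compl X O.1
  obtain ⟨P, hP, Q, hQ, hxP, hCQ, hPQ⟩ := h x (hT.sub _ O.2 x hx) C
    ⟨fun y hy => ((hC y).1 hy).1, O.1, O.2, fun y => by
      rw [hC]
      exact ⟨fun hy => ⟨hT.sub _ O.2 y hy, fun h => h.2 hy⟩,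
        fun h => by_contra fun hy => h.2 ⟨h.1, hy⟩⟩⟩
    (fun h => ((hC x).1 h).2 hx)
  refine ⟨⟨P, hP⟩, hxP, fun y hy => or_iff_not_imp_left.2 fun hyO => ?_⟩
  exact ⟨Q, hQ, hCQ y ((hC y).2 ⟨hy, hyO⟩), fun z hz hz' => hPQ z hz' hz⟩

/-- In M, the set O and the open sets disjoint from P cover X, so G contains a member of this cover.
This carries closure conditions over to ideal points. -/
theorem IsPt.inside_cases {G : Set (El τ)} (hG : IsPt X τ G) (hT : IsTopIn X τ) {P : M} {O : El τ}
    (h : Inside X τ P O.1) : O ∈ G ∨ ∃ Q ∈ G, ∀ y ∈ Q.1, y ∉ P := by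
  obtain ⟨Q, hQ, hQ'⟩ := hG.cover_univ hT (fun Q => SubsetIn Q O.1 ∨ ∀ y ∈ Q, y ∉ P) (by
    intro x hx
    rcases h x hx with hx | ⟨Q, hQ, hxQ, hQP⟩
    exacts [⟨O, Or.inl fun _ h => h, hx⟩, ⟨⟨Q, hQ⟩, Or.inr hQP, hxQ⟩])
  exact hQ'.imp (hG.mono Q hQ O) fun h => ⟨Q, hQ, h⟩

theorem IsPt.exists_inside {G : Set (El τ)} (hG : IsPt X τ G) (hT : IsTopIn X τ) (hR : IsReg X τ)
    {O : El τ} (hO : O ∈ G) : ∃ P ∈ G, Inside X τ P.1 O.1 :=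
  hG.cover hT (fun P => Inside X τ P O.1) hO fun x hx => by
    obtain ⟨P, hxP, hP⟩ := hR O x hx
    exact ⟨P, hP, hxP⟩

/-- For P ∈ H with closure inside O ∈ H, the alternative to O ∈ G is a member of G, hence of H,
disjoint from P. -/
theorem IsPt.eq_of_subset {G H : Set (El τ)} (hG : IsPt X τ G) (hH : IsPt X τ H)
    (hT : IsTopIn X τ) (hR : IsReg X τ) (h : G ⊆ H) : G = H := by
  refine h.antisymm fun O hO => ?_
  obtain ⟨P, hP, hPO⟩ := hH.exists_inside hT hR hO
  rcases hG.inside_cases hT hPO with h' | ⟨Q, hQ, hQP⟩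
  · exact h'
  · obtain ⟨x, hx, hx'⟩ := hH.exists_mem hT (h hQ) hP
    exact absurd hx' (hQP x hx)

/-- The image of a point under a continuous map of the model. -/
theorem IsPt.map {Y σ : M} {G : Set (El σ)} (hG : IsPt Y σ G) (hS : IsTopIn Y σ)
    {g : El Y → El X} (hg : Internal g)
    (hc : ∀ O ∈ τ, ∃ Q ∈ σ, ∀ y : El Y, y.1 ∈ Q ↔ (g y).1 ∈ O) :
    IsPt X τ {O : El τ | ∃ Q ∈ G, ∀ y : El Y, y.1 ∈ Q.1 ↔ (g y).1 ∈ O.1} := by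
  have := Fact.mk hg
  have hsub : ∀ {Q : El σ} {z}, z ∈ Q.1 → z ∈ Y := fun {Q z} hz => hS.sub _ Q.2 z hz
  constructor
  · rintro O hO
    exact ⟨⟨Y, hS.univ_mem⟩, hG.univ _ rfl, fun y => by simp only [hO, y.2, (g y).2]⟩
  · rintro O ⟨Q, hQ, h⟩
    obtain ⟨y, hy⟩ := hG.nonempty Q hQ
    exact ⟨_, (h ⟨y, hsub hy⟩).1 hy⟩
  · rintro O ⟨Q, hQ, h⟩ P ⟨R, hR, h'⟩ O' hO'
    obtain ⟨Q', hQ'⟩ := exists_inter hS Q R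
    exact ⟨Q', hG.inter Q hQ R hR Q' hQ', fun y => by rw [hQ', hO', h, h']⟩
  · rintro O ⟨Q, hQ, h⟩ P hOP
    obtain ⟨R, hR, h'⟩ := hc P.1 P.2
    exact ⟨⟨R, hR⟩, hG.mono Q hQ _ fun y hy =>
      (h' ⟨y, hsub hy⟩).2 (hOP _ ((h ⟨y, hsub hy⟩).1 hy)), h'⟩
  · rintro S hSτ O ⟨Q, hQ, h⟩ hO
    obtain ⟨R, hR, P, hP, hRP⟩ := hG.cover hS
      (fun R => ∃ P ∈ S, ∀ y ∈ Y, (y ∈ R ↔ ∃ x ∈ P, Graph g y x)) hQ (by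
        intro y hy
        obtain ⟨P, hP, hyP⟩ := (hO _).1 ((h ⟨y, hsub hy⟩).1 hy)
        obtain ⟨R, hR, h'⟩ := hc P (hSτ P hP)
        refine ⟨⟨R, hR⟩, ⟨P, hP, fun z hz => (h' ⟨z, hz⟩).trans ?_⟩, (h' _).2 hyP⟩
        exact ⟨fun hz' => ⟨_, hz', hz, rfl⟩, fun ⟨_, hx, hx'⟩ => by
          obtain ⟨_, rfl⟩ := hx'
          exact hx⟩)
    refine ⟨⟨P, hSτ P hP⟩, ⟨R, hR, fun y => (hRP y.1 y.2).trans ?_⟩, hP⟩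
    simp only [graph_iff, exists_eq_right']

/-! ### Preinterpretations -/

namespace Preinterp

variable {A B : Type u} [TopologicalSpace A] [TopologicalSpace B]

/-- The open sets of the model which contain the point `a` of a preinterpretation. -/
def nbhd (p : Preinterp X τ A) (a : A) : Set (El τ) := {O | a ∈ p.op O}

omit [TransModel M] in
theorem mem_nbhd {p : Preinterp X τ A} {a : A} {O : El τ} : O ∈ p.nbhd a ↔ a ∈ p.op O := Iff.rfl

omit [TransModel M] in
theorem op_mono (p : Preinterp X τ A) {O P : El τ} (h : SubsetIn O.1 P.1) : p.op O ⊆ p.op P := by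
  rw [p.op_inter P O O fun x => ⟨fun hx => ⟨h x hx, hx⟩, fun hx => hx.2⟩]
  exact inter_subset_left

omit [TransModel M] in
theorem isPt_nbhd (p : Preinterp X τ A) (a : A) : IsPt X τ (p.nbhd a) where
  univ O hO := by rw [mem_nbhd, p.op_univ O hO]; trivial
  nonempty O hO := by
    by_contra h
    push Not at h
    rw [mem_nbhd, p.op_empty O h] at hO
    exact hO
  inter O hO P hP Q hQ := by
    rw [mem_nbhd, p.op_inter O P Q hQ]
    exact ⟨hO, hP⟩
  mono O hO P h := p.op_mono h hO
  prime S hS O hO h := by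
    rw [mem_nbhd, p.op_union S hS O h] at hO
    obtain ⟨P, hP, h⟩ := hO
    exact ⟨P, h, hP⟩

omit [TransModel M] in
theorem isOpen_op (p : Preinterp X τ A) (O : El τ) : IsOpen (p.op O) :=
  p.basis.isOpen ⟨O, rfl⟩

omit [TransModel M] in
theorem mem_nhds_iff (p : Preinterp X τ A) {a : A} {s : Set A} :
    s ∈ 𝓝 a ↔ ∃ O ∈ p.nbhd a, p.op O ⊆ s := by
  rw [p.basis.mem_nhds_iff]
  constructor
  · rintro ⟨_, ⟨O, rfl⟩, h, h'⟩
    exact ⟨O, h, h'⟩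
  · rintro ⟨O, h, h'⟩
    exact ⟨_, ⟨O, rfl⟩, h, h'⟩

omit [TransModel M] in
theorem nbhd_injective (p : Preinterp X τ A) : Function.Injective p.nbhd := by
  intro a b h
  have := p.t0
  have hs : 𝓝 a = 𝓝 b := by
    ext s
    rw [p.mem_nhds_iff, p.mem_nhds_iff, h]
  exact Inseparable.eq hs

omit [TransModel M] in
theorem nbhd_pt (p : Preinterp X τ A) (x : El X) : p.nbhd (p.pt x) = {O | x.1 ∈ O.1} := by
  ext O
  exact (p.mem_iff x O).symm

omit [TransModel M] in
theorem nonempty_of_mem (p : Preinterp X τ A) {O : El τ} {a : A} (h : a ∈ p.op O) :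
    ∃ x, x ∈ O.1 := (p.isPt_nbhd a).nonempty O h

theorem exists_mem_inter (p : Preinterp X τ A) (hT : IsTopIn X τ) {O P : El τ} {a : A}
    (h : a ∈ p.op O) (h' : a ∈ p.op P) : ∃ x, x ∈ O.1 ∧ x ∈ P.1 :=
  (p.isPt_nbhd a).exists_mem hT h h'

theorem closure_op_subset (p : Preinterp X τ A) (hT : IsTopIn X τ) {P O : El τ}
    (h : Inside X τ P.1 O.1) : closure (p.op P) ⊆ p.op O := by
  intro a ha
  rcases (p.isPt_nbhd a).inside_cases hT h with h' | ⟨Q, hQ, hQP⟩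
  · exact h'
  · obtain ⟨b, hb, hb'⟩ := mem_closure_iff.1 ha _ (p.isOpen_op Q) hQ
    obtain ⟨x, hx, hx'⟩ := p.exists_mem_inter hT hb hb'
    exact absurd hx' (hQP x hx)

theorem regularSpace (p : Preinterp X τ A) (hT : IsTopIn X τ) (hR : IsReg X τ) :
    RegularSpace A := by
  refine RegularSpace.of_exists_mem_nhds_isClosed_subset fun a s hs => ?_
  obtain ⟨O, hO, h⟩ := p.mem_nhds_iff.1 hs
  obtain ⟨P, hP, hPO⟩ := (p.isPt_nbhd a).exists_inside hT hR hO
  exact ⟨closure (p.op P), Filter.mem_of_superset ((p.isOpen_op P).mem_nhds hP) subset_closure,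
    isClosed_closure, (p.closure_op_subset hT hPO).trans h⟩

theorem t2Space (p : Preinterp X τ A) (hT : IsTopIn X τ) (hR : IsReg X τ) : T2Space A := by
  have := p.regularSpace hT hR
  have := p.t0
  have : T3Space A := ⟨⟩
  infer_instance

-- Since a point is determined by its filter, preserving filters already forces compatibility with
-- the maps on points.
omit [TransModel M] in
theorem isReduction_of_nbhd {p : Preinterp X τ A} {q : Preinterp X τ B} {h : A → B}
    (hh : ∀ a, q.nbhd (h a) = p.nbhd a) : IsReduction p q h := by
  constructor
  · intro x
    apply q.nbhd_injective
    rw [hh, p.nbhd_pt, q.nbhd_pt]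
  · intro O
    ext a
    rw [mem_preimage, ← mem_nbhd, ← mem_nbhd, hh]

omit [TransModel M] in
theorem nbhd_of_isReduction {p : Preinterp X τ A} {q : Preinterp X τ B} {h : A → B}
    (hh : IsReduction p q h) (a : A) : q.nbhd (h a) = p.nbhd a := by
  ext O
  rw [mem_nbhd, mem_nbhd, ← hh.2 O, mem_preimage]

end Preinterp

/-! ### The space of all points -/

/-- `El a` lives one universe above `u`; smallness brings the space of points down to `Type u`,
where preinterpretations are compared. -/
instance small_el (a : M) : Small.{u} (El a) :=
  small_of_injective (β := {x : ZFSet.{u} // x ∈ (a.1 : ZFSet.{u})})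
    (f := fun x : El a => ⟨x.1.1, x.2⟩) fun x y h => by
      have := congrArg Subtype.val h
      exact El.ext (Subtype.ext this)

/-- The space of all points of `X`. -/
def PtSpace (X τ : M) : Type u := Shrink.{u} {G : Set (El τ) // IsPt X τ G}

namespace PtSpace

noncomputable def equiv (X τ : M) : PtSpace X τ ≃ {G : Set (El τ) // IsPt X τ G} :=
  (equivShrink _).symm

/-- The set of all points of an open set. -/
def op (O : El τ) : Set (PtSpace X τ) := {a | O ∈ (equiv X τ a).1}

omit [TransModel M] in
theorem mem_op {O : El τ} {a : PtSpace X τ} : a ∈ op O ↔ O ∈ (equiv X τ a).1 := Iff.rfl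

instance : TopologicalSpace (PtSpace X τ) := TopologicalSpace.generateFrom (Set.range op)

omit [TransModel M] in
theorem isPt (a : PtSpace X τ) : IsPt X τ (equiv X τ a).1 := (equiv X τ a).2

omit [TransModel M] in
theorem op_inter {O P Q : El τ} (h : ∀ x, x ∈ Q.1 ↔ x ∈ O.1 ∧ x ∈ P.1) :
    (op Q : Set (PtSpace X τ)) = op O ∩ op P := by
  ext a
  refine ⟨fun ha => ⟨?_, ?_⟩, fun ha => (isPt a).inter O ha.1 P ha.2 Q h⟩
  · exact (isPt a).mono Q ha O fun x hx => ((h x).1 hx).1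
  · exact (isPt a).mono Q ha P fun x hx => ((h x).1 hx).2

omit [TransModel M] in
theorem op_univ {O : El τ} (h : O.1 = X) : (op O : Set (PtSpace X τ)) = Set.univ :=
  eq_univ_of_forall fun a => (isPt a).univ O h

theorem basis (hT : IsTopIn X τ) :
    TopologicalSpace.IsTopologicalBasis (Set.range (op : El τ → Set (PtSpace X τ))) where
  exists_subset_inter := by
    rintro _ ⟨O, rfl⟩ _ ⟨P, rfl⟩ a ha
    obtain ⟨Q, hQ⟩ := exists_inter hT O P
    exact ⟨op Q, ⟨Q, rfl⟩, by rwa [op_inter hQ], (op_inter hQ).subset⟩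
  sUnion_eq := eq_univ_of_forall fun a =>
    ⟨op ⟨X, hT.univ_mem⟩, ⟨_, rfl⟩, by rw [op_univ rfl]; trivial⟩
  eq_generateFrom := rfl

omit [TransModel M] in
theorem isPt_of_mem (x : El X) : IsPt X τ {O | x.1 ∈ O.1} where
  univ O hO := by rw [mem_ofPred_eq, hO]; exact x.2
  nonempty O hO := ⟨x.1, hO⟩
  inter O hO P hP Q hQ := (hQ _).2 ⟨hO, hP⟩
  mono O hO P h := h _ hO
  prime S hS O hO h := by
    obtain ⟨P, hP, hx⟩ := (h _).1 hO
    exact ⟨⟨P, hS P hP⟩, hx, hP⟩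

/-- The preinterpretation by all points. -/
noncomputable def preinterp (hT : IsTopIn X τ) : Preinterp X τ (PtSpace X τ) where
  pt x := (equiv X τ).symm ⟨_, isPt_of_mem x⟩
  op := op
  t0 := by
    refine ⟨fun a b h => (equiv X τ).injective (Subtype.ext ?_)⟩
    ext O
    exact h.mem_open_iff ((basis hT).isOpen ⟨O, rfl⟩)
  mem_iff x O := by rw [mem_op, Equiv.apply_symm_apply]; rfl
  op_inter _ _ _ h := op_inter h
  op_union S hS O h := by
    ext a
    constructor
    · intro ha
      obtain ⟨P, hP, hPS⟩ := (isPt a).prime S hS O ha h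
      exact ⟨P, hPS, hP⟩
    · rintro ⟨P, hPS, hP⟩
      exact (isPt a).mono P hP O fun x hx => (h x).2 ⟨P.1, hPS, hx⟩
  op_empty O h := by
    refine eq_empty_of_forall_notMem fun a ha => ?_
    obtain ⟨x, hx⟩ := (isPt a).nonempty O ha
    exact h x hx
  op_univ _ h := op_univ h
  basis := basis hT

theorem preinterp_nbhd (hT : IsTopIn X τ) {G : Set (El τ)} (hG : IsPt X τ G) :
    (preinterp hT).nbhd ((equiv X τ).symm ⟨G, hG⟩) = G := by
  ext O
  change O ∈ (equiv X τ ((equiv X τ).symm ⟨G, hG⟩)).1 ↔ O ∈ G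
  rw [Equiv.apply_symm_apply]

end PtSpace

/-- A reduction of `PtSpace.preinterp` to p sends the point G to one with filter G; conversely,
choosing realizations of the filters of q defines a reduction of q to p. -/
theorem isInterpretation_iff (hT : IsTopIn X τ) {A : Type u} [TopologicalSpace A]
    {p : Preinterp X τ A} : IsInterpretation p ↔ ∀ G, IsPt X τ G → ∃ a, p.nbhd a = G := by
  constructor
  · intro h G hG
    obtain ⟨f, hf⟩ := h _ (PtSpace.preinterp hT)
    exact ⟨_, (Preinterp.nbhd_of_isReduction hf _).trans (PtSpace.preinterp_nbhd hT hG)⟩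
  · intro h B _ q
    choose f hf using fun b => h (q.nbhd b) (q.isPt_nbhd b)
    exact ⟨f, Preinterp.isReduction_of_nbhd hf⟩

theorem PtSpace.isInterpretation (hT : IsTopIn X τ) : IsInterpretation (PtSpace.preinterp hT) :=
  (isInterpretation_iff hT).2 fun _ hG => ⟨_, PtSpace.preinterp_nbhd hT hG⟩

theorem exists_isInterpretation (hT : IsTopIn X τ) :
    ∃ (A : Type u) (_ : TopologicalSpace A) (p : Preinterp X τ A), IsInterpretation p :=
  ⟨_, _, _, PtSpace.isInterpretation hT⟩

omit [TransModel M] in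
theorem IsInterpretation.equivalent {A B : Type u} [TopologicalSpace A] [TopologicalSpace B]
    {p : Preinterp X τ A} {q : Preinterp X τ B} (hp : IsInterpretation p)
    (hq : IsInterpretation q) : Equivalent p q := by
  obtain ⟨f, hf⟩ := hq A p
  obtain ⟨g, hg⟩ := hp B q
  have hf' := Preinterp.nbhd_of_isReduction hf
  have hg' := Preinterp.nbhd_of_isReduction hg
  exact ⟨f, hf, Function.bijective_iff_has_inverse.2
    ⟨g, fun a => p.nbhd_injective (by rw [hg', hf']), fun b => q.nbhd_injective (by rw [hf', hg'])⟩⟩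

/-! ### Limits of ultrafilters -/

namespace Preinterp

variable {A : Type u} [TopologicalSpace A]

/-- The trace of V is regularized because the hypothesis concerns covers of all of X. If P is inside
O and P is V-large, a family with union O, refined by regularity, becomes a cover of X on adding the
open sets disjoint from P, and none of the added sets is V-large. -/
theorem isPt_ultrafilter (p : Preinterp X τ A) (hT : IsTopIn X τ) (hR : IsReg X τ)
    (V : Ultrafilter A)
    (h : ∀ S : M, SubsetIn S τ → (∀ x ∈ X, ∃ P ∈ S, x ∈ P) → ∃ P : El τ, P.1 ∈ S ∧ p.op P ∈ V) :
    IsPt X τ {O | ∃ P : El τ, Inside X τ P.1 O.1 ∧ p.op P ∈ V} := by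
  have hne : ∀ {P Q : El τ}, p.op P ∈ V → p.op Q ∈ V → ∃ x, x ∈ P.1 ∧ x ∈ Q.1 := by
    intro P Q hP hQ
    obtain ⟨a, ha⟩ := V.nonempty_of_mem (Filter.inter_mem hP hQ)
    exact p.exists_mem_inter hT ha.1 ha.2
  constructor
  · intro O hO
    refine ⟨O, fun x hx => Or.inl (hO ▸ hx), ?_⟩
    rw [p.op_univ O hO]
    exact Filter.univ_mem
  · rintro O ⟨P, hP, hPV⟩
    obtain ⟨x, hx, -⟩ := hne hPV hPV
    exact ⟨x, hP.subset (hT.sub _ P.2) x hx⟩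
  · rintro O ⟨P, hP, hPV⟩ O' ⟨P', hP', hPV'⟩ Q hQ
    obtain ⟨R, hR⟩ := exists_inter hT P P'
    refine ⟨R, fun x hx => ?_, by rw [p.op_inter _ _ _ hR]; exact Filter.inter_mem hPV hPV'⟩
    rcases hP x hx with h₁ | ⟨N, hN, hxN, hNP⟩
    · rcases hP' x hx with h₂ | ⟨N, hN, hxN, hNP⟩
      · exact Or.inl ((hQ x).2 ⟨h₁, h₂⟩)
      · exact Or.inr ⟨N, hN, hxN, fun y hy hy' => hNP y hy ((hR y).1 hy').2⟩
    · exact Or.inr ⟨N, hN, hxN, fun y hy hy' => hNP y hy ((hR y).1 hy').1⟩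
  · rintro O ⟨P, hP, hPV⟩ Q hQ
    exact ⟨P, fun x hx => (hP x hx).imp_left (hQ x), hPV⟩
  · rintro S hS O ⟨P, hP, hPV⟩ hO
    obtain ⟨T, hTS⟩ := sep (fun Q => (∃ W ∈ S, Inside X τ Q W) ∨ ∀ y ∈ Q, y ∉ P.1) τ
    obtain ⟨Q, hQ, hQV⟩ := h T (fun Q hQ => ((hTS Q).1 hQ).1) (by
      intro x hx
      rcases hP x hx with hxO | ⟨N, hN, hxN, hNP⟩
      · obtain ⟨W, hW, hxW⟩ := (hO x).1 hxO
        obtain ⟨Q, hxQ, hQ⟩ := hR ⟨W, hS W hW⟩ x hxW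
        exact ⟨Q.1, (hTS _).2 ⟨Q.2, Or.inl ⟨W, hW, hQ⟩⟩, hxQ⟩
      · exact ⟨N, (hTS _).2 ⟨hN, Or.inr hNP⟩, hxN⟩)
    rcases ((hTS _).1 hQ).2 with ⟨W, hW, hQW⟩ | hQP
    · exact ⟨⟨W, hS W hW⟩, ⟨Q, hQW, hQV⟩, hW⟩
    · obtain ⟨x, hx, hx'⟩ := hne hQV hPV
      exact absurd hx' (hQP x hx)

theorem exists_le_nhds (p : Preinterp X τ A) (hp : IsInterpretation p) (hT : IsTopIn X τ)
    (hR : IsReg X τ) (V : Ultrafilter A)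
    (h : ∀ S : M, SubsetIn S τ → (∀ x ∈ X, ∃ P ∈ S, x ∈ P) → ∃ P : El τ, P.1 ∈ S ∧ p.op P ∈ V) :
    ∃ a, (V : Filter A) ≤ 𝓝 a := by
  obtain ⟨a, ha⟩ := (isInterpretation_iff hT).1 hp _ (p.isPt_ultrafilter hT hR V h)
  refine ⟨a, fun s hs => ?_⟩
  obtain ⟨O, hO, hOs⟩ := p.mem_nhds_iff.1 hs
  rw [ha] at hO
  obtain ⟨P, hP, hPV⟩ := hO
  exact Filter.mem_of_superset hPV ((p.op_mono (hP.subset (hT.sub _ P.2))).trans hOs)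

/-- A point of `X` which is a cluster point of the closures of its neighborhoods is realized. -/
theorem nbhd_eq_of_mem_closure (p : Preinterp X τ A) (hT : IsTopIn X τ) (hR : IsReg X τ)
    {G : Set (El τ)} (hG : IsPt X τ G) {a : A} (h : ∀ O ∈ G, a ∈ closure (p.op O)) :
    p.nbhd a = G := by
  refine (hG.eq_of_subset (p.isPt_nbhd a) hT hR fun O hO => ?_).symm
  obtain ⟨P, hP, hPO⟩ := hG.exists_inside hT hR hO
  exact p.closure_op_subset hT hPO (h P hP)

/-- The closures of the neighborhoods of a point of `X` have the finite intersection property. -/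
theorem nonempty_sInter_closure (p : Preinterp X τ A) (hT : IsTopIn X τ) {G : Set (El τ)}
    (hG : IsPt X τ G) {F : Set (Set A)} (hF : F ⊆ (fun O => closure (p.op O)) '' G)
    (hfin : F.Finite) : (⋂₀ F).Nonempty := by
  have : ∃ O ∈ G, p.op O ⊆ ⋂₀ F := by
    induction F, hfin using Set.Finite.induction_on with
    | empty => exact ⟨⟨X, hT.univ_mem⟩, hG.univ _ rfl, by simp⟩
    | @insert C F _ _ ih =>
      obtain ⟨O, hO, h⟩ := ih ((subset_insert _ _).trans hF)
      obtain ⟨P, hP, rfl⟩ := hF (mem_insert _ _)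
      obtain ⟨Q, hQ⟩ := exists_inter hT O P
      refine ⟨Q, hG.inter O hO P hP Q hQ, ?_⟩
      rw [p.op_inter _ _ _ hQ, sInter_insert]
      exact fun a ha => ⟨subset_closure ha.2, h ha.1⟩
  obtain ⟨O, hO, h⟩ := this
  obtain ⟨x, hx⟩ := hG.nonempty O hO
  exact ⟨_, h ((p.mem_iff ⟨x, hT.sub _ O.2 x hx⟩ O).1 hx)⟩

end Preinterp

end Points

/-! ### Completeness systems -/

section Completeness

variable {M : Set ZFSet.{u}} [TransModel M] {X τ U : M} {le : El U → El U → Prop}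
  {f : El U → El τ}

instance Dfn.inClosure (τ : M) (s t : (ℕ → M) → M) [DefTerm s] [DefTerm t] :
    Dfn (fun v => InClosure τ (s v) (t v)) := by
  unfold InClosure; infer_instance

theorem IsPt.exists_mem_system {G : Set (El τ)} (hG : IsPt X τ G) (hT : IsTopIn X τ)
    (hU : CompletenessSystemIn X τ U le f) : ∃ a, f a ∈ G := by
  have := Fact.mk hU.f_internal
  obtain ⟨P, hP, u, hu, hP'⟩ := hG.cover_univ hT (fun P => ∃ u, Graph f u P) (by
    intro x hx
    obtain ⟨a, ha⟩ := hU.cover x hx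
    exact ⟨f a, ⟨a.1, graph_iff.2 rfl⟩, ha⟩)
  exact ⟨⟨u, hu⟩, by rwa [El.ext hP']⟩

theorem IsPt.exists_lt_system {G : Set (El τ)} (hG : IsPt X τ G) (hT : IsTopIn X τ)
    (hU : CompletenessSystemIn X τ U le f) {a : El U} (ha : f a ∈ G) :
    ∃ b, (le b a ∧ b ≠ a) ∧ f b ∈ G := by
  have := Fact.mk hU.f_internal
  have := Fact.mk hU.le_internal
  obtain ⟨P, hP, u, ⟨⟨hu, _, hle⟩, hne⟩, _, hP'⟩ := hG.cover hT
    (fun P => ∃ u, (Lift le u a.1 ∧ ¬ u = a.1) ∧ Graph f u P) ha (by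
      intro x hx
      obtain ⟨b, hb, hxb⟩ := hU.refine a x hx
      exact ⟨f b, ⟨b.1, ⟨lift_iff.2 hb.1, fun h => hb.2 (El.ext h)⟩, graph_iff.2 rfl⟩, hxb⟩)
  exact ⟨⟨u, hu⟩, ⟨hle, fun h => hne (congrArg El.val h)⟩, by rwa [El.ext hP']⟩

/-- Conditions (0) and (1) give every filter G a descending sequence in U with f-values in G.
Condition (2) then yields a common point of the closures of the π(O), O ∈ G. -/
theorem isInterpretation_of_completenessSystem (hT : IsTopIn X τ) (hR : IsReg X τ)
    (hU : CompletenessSystemIn X τ U le f) {A : Type u} [TopologicalSpace A]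
    (p : Preinterp X τ A) (hp : CompletenessSystem le (fun a => p.op (f a))) :
    IsInterpretation p := by
  rw [isInterpretation_iff hT]
  intro G hG
  obtain ⟨a₀, h₀⟩ := hG.exists_mem_system hT hU
  choose next hnext hG' using fun a : {a // f a ∈ G} => hG.exists_lt_system hT hU a.2
  let s : ℕ → {a // f a ∈ G} := fun n => (fun a => ⟨next a, hG' a⟩)^[n] ⟨a₀, h₀⟩
  have hs : ∀ n, (s (n + 1)).1 = next (s n) := fun n => by
    simp only [s, Function.iterate_succ_apply']
  obtain ⟨a, ha⟩ := hp.complete (fun n => (s n).1) (fun n => by rw [hs]; exact hnext (s n))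
    ((fun O => closure (p.op O)) '' G)
    (by rintro _ ⟨O, -, rfl⟩; exact isClosed_closure)
    (fun F hF hfin => p.nonempty_sInter_closure hT hG hF hfin)
    (fun n => ⟨_, ⟨_, (s n).2, rfl⟩, subset_rfl⟩)
  exact ⟨a, p.nbhd_eq_of_mem_closure hT hR hG fun O hO => ha _ ⟨O, hO, rfl⟩⟩

/-- Otherwise g and the open sets missing some f u, u ∈ t, cover X in M, hence their images cover
the target. A point of the V-large intersection of the closures and the complements lies in none of
these images. -/
theorem exists_mem_closure_of_ultrafilter (hT : IsTopIn X τ) (hf : Internal f) {A : Type u}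
    [TopologicalSpace A] (p : Preinterp X τ A) (V : Ultrafilter A) {t g : M}
    (ht : {x | x ∈ t}.Finite) (htU : SubsetIn t U)
    (htV : ∀ u : El U, u.1 ∈ t → closure (p.op (f u)) ∈ V)
    (hg : {x | x ∈ g}.Finite) (hgτ : SubsetIn g τ) (hgV : ∀ P : El τ, P.1 ∈ g → p.op P ∉ V) :
    ∃ x ∈ X, (∀ u ∈ t, ∀ o, Graph f u o → InClosure τ o x) ∧ ∀ O ∈ g, x ∉ O := by
  have := Fact.mk hf
  by_contra hcon
  push Not at hcon
  have h₁ : (⋂ u ∈ {x | x ∈ t}, {a | ∀ h : u ∈ U, a ∈ closure (p.op (f ⟨u, h⟩))}) ∈ V := by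
    rw [← Ultrafilter.mem_coe, Filter.biInter_mem ht]
    exact fun u hu => Filter.mem_of_superset (htV ⟨u, htU u hu⟩ hu) fun a ha _ => ha
  have h₂ : (⋂ P ∈ {x | x ∈ g}, {a | ∀ h : P ∈ τ, a ∉ p.op ⟨P, h⟩}) ∈ V := by
    rw [← Ultrafilter.mem_coe, Filter.biInter_mem hg]
    exact fun P hP => Filter.mem_of_superset
      (Ultrafilter.compl_mem_iff_notMem.2 (hgV ⟨P, hgτ P hP⟩ hP)) fun a ha _ => ha
  obtain ⟨a, ha₁, ha₂⟩ := V.nonempty_of_mem (Filter.inter_mem h₁ h₂)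
  simp only [mem_iInter, mem_ofPred_eq] at ha₁ ha₂
  obtain ⟨P, hP, h⟩ := (p.isPt_nbhd a).cover_univ hT
    (fun P => P ∈ g ∨ ∃ u ∈ t, ∃ o, Graph f u o ∧ ∀ y ∈ P, y ∉ o) (by
      intro x hx
      by_cases hxt : ∀ u ∈ t, ∀ o, Graph f u o → InClosure τ o x
      · obtain ⟨O, hO, hxO⟩ := hcon x hx hxt
        exact ⟨⟨O, hgτ O hO⟩, Or.inl hO, hxO⟩
      · unfold InClosure at hxt
        push Not at hxt
        obtain ⟨u, hu, o, ho, P, hP, hxP, h⟩ := hxt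
        exact ⟨⟨P, hP⟩, Or.inr ⟨u, hu, o, ho, h⟩, hxP⟩)
  rcases h with h | ⟨u, hu, o, ⟨huU, rfl⟩, ho⟩
  · exact ha₂ P.1 h P.2 hP
  · obtain ⟨b, hb, hb'⟩ := mem_closure_iff.1 (ha₁ u hu huU) _ (p.isOpen_op P) hP
    obtain ⟨x, hx, hx'⟩ := p.exists_mem_inter hT hb hb'
    exact ho x hx hx'

/-- The intersection of the closures of the sets `f u`, `u ∈ t`, is not covered by
finitely many elements of `S`. -/
def Uncovered (X τ w S : M) (f : El U → El τ) (t : M) : Prop :=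
  ∀ g, SubsetIn g S → IsFinite w g →
    ∃ x ∈ X, (∀ u ∈ t, ∀ o, Graph f u o → InClosure τ o x) ∧ ∀ O ∈ g, x ∉ O

/-- The set `t'` is obtained from `t` by adding the lower bound `v`. -/
def Extends (le : El U → El U → Prop) (t t' v : M) : Prop :=
  (∀ u, u ∈ t' ↔ u ∈ t ∨ u = v) ∧ ∀ u ∈ t, Lift le v u ∧ ¬ v = u

theorem exists_closed_compl (hT : IsTopIn X τ) (O : El τ) :
    ∃ C : M, ClosedIn X τ C ∧ ∀ x, x ∈ C ↔ x ∈ X ∧ x ∉ O.1 := by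
  obtain ⟨C, hC⟩ := exists_compl X O.1
  refine ⟨C, ⟨fun y hy => ((hC y).1 hy).1, O.1, O.2, fun y => ?_⟩, hC⟩
  rw [hC]
  exact ⟨fun hy => ⟨hT.sub _ O.2 y hy, fun h => h.2 hy⟩,
    fun h => by_contra fun hy => h.2 ⟨h.1, hy⟩⟩

theorem exists_closure (hT : IsTopIn X τ) (o : M) :
    ∃ C : M, ClosedIn X τ C ∧ ∀ x, x ∈ C ↔ x ∈ X ∧ InClosure τ o x := by
  obtain ⟨P, hP⟩ := exists_iUnion hT (fun P => ∀ y ∈ P, y ∉ o)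
  obtain ⟨C, hC, hC'⟩ := exists_closed_compl hT P
  refine ⟨C, hC, fun x => ?_⟩
  rw [hC', hP]
  refine and_congr_right fun _ => ⟨fun h O hO hx => ?_, fun h ⟨Q, hQ, hx⟩ => ?_⟩
  · by_contra hcon
    push Not at hcon
    exact h ⟨⟨O, hO⟩, hcon, hx⟩
  · obtain ⟨y, hy, hy'⟩ := h Q.1 Q.2 hx
    exact hQ y hy hy'

/-- A cover of `X` in the model does not admit a descending sequence in the model all of whose
initial segments are uncovered. -/
theorem false_of_uncovered (hT : IsTopIn X τ) (hU : CompletenessSystemIn X τ U le f) {w S B : M}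
    (hw : IsOmega w) (hSτ : SubsetIn S τ) (hS : ∀ x ∈ X, ∃ P ∈ S, x ∈ P) (T : El w → El B)
    (hTi : Internal T) (hTe : ∀ n, ∃ v ∈ U, Extends le (T (hw.nat n)).1 (T (hw.nat (n + 1))).1 v)
    (hTu : ∀ n, Uncovered X τ w S f (T (hw.nat (n + 1))).1) : False := by
  have := Fact.mk hU.f_internal
  have := Fact.mk hU.le_internal
  have := Fact.mk hTi
  obtain ⟨v, hv, hv'⟩ := exists_internal_choice w U (fun n v => ∃ m t t', IsSucc m n ∧
    Graph T n t ∧ Graph T m t' ∧ (∀ u, u ∈ t' ↔ u ∈ t ∨ u = v) ∧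
      ∀ u ∈ t, Lift le v u ∧ ¬ v = u) (by
    intro x
    obtain ⟨n, rfl⟩ := hw.exists_nat x
    obtain ⟨v, hv, h⟩ := hTe n
    exact ⟨⟨v, hv⟩, _, _, _, isSucc_num n, graph_iff.2 rfl, (graph_iff (x := hw.nat (n + 1))).2 rfl,
      h⟩)
  have := Fact.mk hv
  have hext : ∀ n, Extends le (T (hw.nat n)).1 (T (hw.nat (n + 1))).1 (v (hw.nat n)).1 := by
    intro n
    obtain ⟨m, t, t', hm, ht, ht', h⟩ := hv' (hw.nat n)
    rw [hw.nat_val, isSucc_num_iff] at hm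
    subst hm
    rw [graph_iff] at ht
    have ht'' := (graph_iff (x := hw.nat (n + 1))).1 ht'
    subst ht
    subst ht''
    exact h
  have hmem : ∀ n k, n < k → (v (hw.nat n)).1 ∈ (T (hw.nat k)).1 := by
    intro n k hk
    induction k with
    | zero => omega
    | succ k ih =>
      rcases Nat.lt_succ_iff_lt_or_eq.1 hk with h | rfl
      · exact ((hext k).1 _).2 (Or.inl (ih h))
      · exact ((hext n).1 _).2 (Or.inr rfl)
  obtain ⟨PX, hPX⟩ := TransModel.zfc.power X
  -- F consists of the complements of members of S and the closures of the f (v n). It has empty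
  -- intersection because S covers X, while `Uncovered` amounts to its finite intersection property.
  obtain ⟨F, hF⟩ := sep (fun C => (∃ O ∈ S, ∀ x, x ∈ C ↔ x ∈ X ∧ x ∉ O) ∨
    ∃ n ∈ w, ∃ u o, Graph v n u ∧ Graph f u o ∧ ∀ x, x ∈ C ↔ x ∈ X ∧ InClosure τ o x) PX
  have hF' : ∀ C, C ∈ F ↔ (∃ O ∈ S, ∀ x, x ∈ C ↔ x ∈ X ∧ x ∉ O) ∨
      ∃ n, ∀ x, x ∈ C ↔ x ∈ X ∧ InClosure τ (f (v (hw.nat n))).1 x := by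
    intro C
    rw [hF, hPX]
    constructor
    · rintro ⟨-, h | ⟨n, hn, u, o, hu, ho, h⟩⟩
      · exact Or.inl h
      · obtain ⟨k, rfl⟩ := hw.mem_iff.1 hn
        have hu' := (graph_iff (x := hw.nat k)).1 hu
        subst hu'
        rw [graph_iff] at ho
        subst ho
        exact Or.inr ⟨k, h⟩
    · rintro (h | ⟨n, h⟩)
      · obtain ⟨O, hO, h⟩ := h
        exact ⟨fun x hx => ((h x).1 hx).1, Or.inl ⟨O, hO, h⟩⟩
      · exact ⟨fun x hx => ((h x).1 hx).1, Or.inr ⟨num n, (hw.nat n).2, _, _,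
          (graph_iff (x := hw.nat n)).2 rfl, graph_iff.2 rfl, h⟩⟩
  have hFc : ∀ C ∈ F, ClosedIn X τ C := by
    intro C hC
    rcases (hF' C).1 hC with ⟨O, hO, h⟩ | ⟨n, h⟩
    · obtain ⟨D, hD, hD'⟩ := exists_closed_compl hT ⟨O, hSτ O hO⟩
      rwa [mem_ext fun x => (h x).trans (hD' x).symm]
    · obtain ⟨D, hD, hD'⟩ := exists_closure hT (f (v (hw.nat n))).1
      rwa [mem_ext fun x => (h x).trans (hD' x).symm]
  have hFIP : FIPIn X F := by
    intro G hGF hG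
    have hGfin := hG.finite
    have hidx : ∀ C, ∃ k, C ∈ F → (∃ O ∈ S, ∀ x, x ∈ C ↔ x ∈ X ∧ x ∉ O) ∨
        ∀ x, x ∈ C ↔ x ∈ X ∧ InClosure τ (f (v (hw.nat k))).1 x := by
      intro C
      by_cases hC : C ∈ F
      · rcases (hF' C).1 hC with h | ⟨n, h⟩
        exacts [⟨0, fun _ => Or.inl h⟩, ⟨n, fun _ => Or.inr h⟩]
      · exact ⟨0, fun h => absurd h hC⟩
    choose k hk using hidx
    -- A finite G uses only indices up to N, and all the corresponding v n belong to T (N + 1).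
    obtain ⟨N, hN⟩ := (hGfin.image k).bddAbove
    choose c hc using exists_compl X
    obtain ⟨g, hg⟩ := sep (fun O => ∃ C ∈ G, ∀ x, x ∈ C ↔ x ∈ X ∧ x ∉ O) S
    obtain ⟨x, hx, hxt, hxg⟩ := hTu N g (fun O hO => ((hg O).1 hO).1)
      ((isFinite_iff hw).2 ((hGfin.image c).subset (by
        intro O hO
        obtain ⟨hOS, C, hC, h⟩ := (hg O).1 hO
        refine ⟨C, hC, mem_ext fun x => ?_⟩
        rw [hc, h]
        exact ⟨fun h => by_contra fun hn => h.2 ⟨h.1, hn⟩,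
          fun hx => ⟨hT.sub _ (hSτ O hOS) x hx, fun h => h.2 hx⟩⟩)))
    refine ⟨x, hx, fun C hC => ?_⟩
    rcases hk C (hGF C hC) with ⟨O, hO, h⟩ | h
    · exact (h x).2 ⟨hx, hxg O ((hg O).2 ⟨hO, C, hC, h⟩)⟩
    · exact (h x).2 ⟨hx, hxt _ (hmem _ _ (Nat.lt_succ_of_le (hN ⟨C, hC, rfl⟩))) _
        (graph_iff.2 rfl)⟩
  obtain ⟨x, hx, hxF⟩ := hU.complete w hw v hv (by
      intro n m hmn
      obtain ⟨k, rfl, rfl⟩ := hw.isSucc_iff.1 hmn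
      obtain ⟨h₁, h₂⟩ := (hext (k + 1)).2 _ (hmem k (k + 1) (Nat.lt_succ_self k))
      exact ⟨lift_iff.1 h₁, fun h => h₂ (congrArg El.val h)⟩) F hFc hFIP (by
      intro n
      obtain ⟨k, rfl⟩ := hw.exists_nat n
      obtain ⟨C, -, hC⟩ := exists_closure hT (f (v (hw.nat k))).1
      exact ⟨C, (hF' C).2 (Or.inr ⟨k, hC⟩), fun x hx => ((hC x).1 hx).2⟩)
  obtain ⟨O, hO, hxO⟩ := hS x hx
  obtain ⟨C, -, hC⟩ := exists_closed_compl hT ⟨O, hSτ O hO⟩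
  exact ((hC x).1 (hxF C ((hF' C).2 (Or.inl ⟨O, hO, hC⟩)))).2 hxO

/-- The sequence s need not be in M, but the sets t n = {s i | i < n} are. If no member of S were
V-large, they would form a branch of the tree of finite descending sets uncovered by S. This tree is
definable over M, so it has a branch in M, which `false_of_uncovered` excludes. -/
theorem exists_mem_of_descending (hT : IsTopIn X τ) (hU : CompletenessSystemIn X τ U le f)
    {A : Type u} [TopologicalSpace A] (p : Preinterp X τ A) (V : Ultrafilter A) (s : ℕ → El U)
    (hs : ∀ n, le (s (n + 1)) (s n) ∧ s (n + 1) ≠ s n) (hV : ∀ n, closure (p.op (f (s n))) ∈ V)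
    (S : M) (hSτ : SubsetIn S τ) (hS : ∀ x ∈ X, ∃ P ∈ S, x ∈ P) :
    ∃ P : El τ, P.1 ∈ S ∧ p.op P ∈ V := by
  have := Fact.mk hU.f_internal
  have := Fact.mk hU.le_internal
  by_contra hcon
  push Not at hcon
  obtain ⟨w, hw⟩ := exists_omega (M := M)
  obtain ⟨B, hB⟩ := TransModel.zfc.power U
  have hlt : ∀ n k, n < k → le (s k) (s n) ∧ s k ≠ s n := by
    intro n k hk
    induction k with
    | zero => omega
    | succ k ih =>
      rcases Nat.lt_succ_iff_lt_or_eq.1 hk with h | rfl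
      · refine ⟨hU.trans _ _ _ (hs k).1 (ih h).1, fun he => (hs k).2 ?_⟩
        exact hU.antisymm _ _ (hs k).1 (he ▸ (ih h).1)
      · exact hs n
  choose t ht using fun n => exists_of_finite (Set.finite_range fun i : Fin n => (s i).1)
  have ht' : ∀ n x, x ∈ t n ↔ ∃ i < n, (s i).1 = x := by
    intro n x
    rw [ht]
    exact ⟨fun ⟨i, hi⟩ => ⟨i, i.2, hi⟩, fun ⟨i, hi, h⟩ => ⟨⟨i, hi⟩, h⟩⟩
  have htU : ∀ n, SubsetIn (t n) U := by
    intro n x hx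
    obtain ⟨i, -, rfl⟩ := (ht' n x).1 hx
    exact (s i).2
  have hunc : ∀ n, Uncovered X τ w S f (t n) := by
    intro n g hg hgf
    refine exists_mem_closure_of_ultrafilter hT hU.f_internal p V ?_ (htU n) ?_
      ((isFinite_iff hw).1 hgf) (fun P hP => hSτ P (hg P hP)) fun P hP => hcon P (hg _ hP)
    · exact (Set.finite_range fun i : Fin n => (s i).1).subset fun x hx => (ht n x).1 hx
    · intro u hu
      obtain ⟨i, -, h⟩ := (ht' n _).1 hu
      rw [← show s i = u from El.ext h]
      exact hV i
  obtain ⟨T, hTi, -, hTn⟩ := exists_internal_branch hw B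
    (fun _ t t' => (∃ v ∈ U, (∀ u, u ∈ t' ↔ u ∈ t ∨ u = v) ∧ ∀ u ∈ t, Lift le v u ∧ ¬ v = u) ∧
      ∀ g, SubsetIn g S → IsFinite w g →
        ∃ x ∈ X, (∀ u ∈ t', ∀ o, Graph f u o → InClosure τ o x) ∧ ∀ O ∈ g, x ∉ O)
    (fun n => ⟨t n, (hB _).2 (htU n)⟩) (by
      refine fun n => ⟨⟨(s n).1, (s n).2, fun u => ?_, fun u hu => ?_⟩, hunc (n + 1)⟩
      · simp only [ht']
        constructor
        · rintro ⟨i, hi, rfl⟩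
          rcases Nat.lt_succ_iff_lt_or_eq.1 hi with h | rfl
          exacts [Or.inl ⟨i, h, rfl⟩, Or.inr rfl]
        · rintro (⟨i, hi, rfl⟩ | rfl)
          exacts [⟨i, Nat.lt_succ_of_lt hi, rfl⟩, ⟨n, Nat.lt_succ_self n, rfl⟩]
      · obtain ⟨i, hi, rfl⟩ := (ht' n u).1 hu
        exact ⟨lift_iff.2 (hlt i n hi).1, fun h => (hlt i n hi).2 (El.ext h)⟩)
  exact false_of_uncovered hT hU hw hSτ hS T hTi (fun n => (hTn n).1) fun n => (hTn n).2

theorem exists_mem_sInter {A : Type u} [TopologicalSpace A] {F : Set (Set A)}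
    (hF : ∀ C ∈ F, IsClosed C) (hfip : ∀ G ⊆ F, G.Finite → (⋂₀ G).Nonempty)
    (h : ∀ V : Ultrafilter A, (∀ C ∈ F, C ∈ V) → ∃ a, (V : Filter A) ≤ 𝓝 a) :
    (⋂₀ F).Nonempty := by
  have := Filter.generate_neBot_iff.2 hfip
  have hV : ∀ C ∈ F, C ∈ Ultrafilter.of (Filter.generate F) := fun C hC =>
    Ultrafilter.of_le _ (Filter.mem_generate_of_mem hC)
  obtain ⟨a, ha⟩ := h _ hV
  exact ⟨a, fun C hC => isClosed_iff_ultrafilter.1 (hF C hC) a _ ha (hV C hC)⟩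

theorem completenessSystem_of_isInterpretation (hT : IsTopIn X τ) (hR : IsReg X τ)
    (hU : CompletenessSystemIn X τ U le f) {A : Type u} [TopologicalSpace A]
    (p : Preinterp X τ A) (hp : IsInterpretation p) :
    CompletenessSystem le (fun a => p.op (f a)) where
  isOpen a := p.isOpen_op _
  refl := hU.refl
  antisymm := hU.antisymm
  trans := hU.trans
  cover a := (p.isPt_nbhd a).exists_mem_system hT hU
  refine a x hx := by
    obtain ⟨b, hb, h⟩ := (p.isPt_nbhd x).exists_lt_system hT hU hx
    simp only [mem_iUnion]
    exact ⟨b, hb, h⟩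
  complete s hs F hF hfip hFs :=
    exists_mem_sInter hF hfip fun V hV => p.exists_le_nhds hp hT hR V fun S hSτ hS =>
      exists_mem_of_descending hT hU p V s hs (fun n => by
        obtain ⟨C, hC, h⟩ := hFs n
        exact Filter.mem_of_superset (hV C hC) h) S hSτ hS

theorem completenessSystem_iff (hT : IsTopIn X τ) (hR : IsReg X τ)
    (hU : CompletenessSystemIn X τ U le f) {A : Type u} [TopologicalSpace A]
    (p : Preinterp X τ A) :
    CompletenessSystem le (fun a => p.op (f a)) ↔ IsInterpretation p :=
  ⟨isInterpretation_of_completenessSystem hT hR hU p,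
    completenessSystem_of_isInterpretation hT hR hU p⟩

end Completeness

/-! ### Compact Hausdorff spaces -/

section Compact

variable {M : Set ZFSet.{u}} [TransModel M] {X τ : M}

theorem CompactIn.exists_finite (hC : CompactIn X τ) (φ : M → Prop)
    [hφ : Dfn (fun v => φ (v 0))] (h : ∀ x ∈ X, ∃ P : El τ, φ P.1 ∧ x ∈ P.1) :
    ∃ g : M, {O | O ∈ g}.Finite ∧ (∀ O ∈ g, O ∈ τ ∧ φ O) ∧ ∀ x ∈ X, ∃ O ∈ g, x ∈ O := by
  obtain ⟨S, hS⟩ := sep φ τ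
  obtain ⟨g, hg, hfin, hgX⟩ := hC S (fun P hP => ((hS P).1 hP).1) (fun x hx => by
    obtain ⟨P, hP, hxP⟩ := h x hx
    exact ⟨P.1, (hS _).2 ⟨P.2, hP⟩, hxP⟩)
  exact ⟨g, hfin.finite, fun O hO => (hS O).1 (hg O hO), hgX⟩

theorem exists_nbhd_of_finite (hT : IsTopIn X τ) {x : M} (hx : x ∈ X) {s : Set M}
    (hs : s.Finite) (ψ : M → M → Prop) (hψ : ∀ Q N N', SubsetIn N' N → ψ Q N → ψ Q N')
    (h : ∀ Q ∈ s, ∃ N : El τ, x ∈ N.1 ∧ ψ Q N.1) : ∃ N : El τ, x ∈ N.1 ∧ ∀ Q ∈ s, ψ Q N.1 := by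
  induction s, hs using Set.Finite.induction_on with
  | empty => exact ⟨⟨X, hT.univ_mem⟩, hx, by simp⟩
  | @insert Q s _ _ ih =>
    obtain ⟨N, hN, hN'⟩ := ih fun R hR => h R (mem_insert_of_mem _ hR)
    obtain ⟨N₂, hN₂, hN₂'⟩ := h Q (mem_insert _ _)
    obtain ⟨N₃, hN₃⟩ := exists_inter hT N N₂
    refine ⟨N₃, (hN₃ x).2 ⟨hN, hN₂⟩, ?_⟩
    rintro R (rfl | hR)
    · exact hψ _ _ _ (fun y hy => ((hN₃ y).1 hy).2) hN₂'
    · exact hψ _ _ _ (fun y hy => ((hN₃ y).1 hy).1) (hN' R hR)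

theorem CompactIn.isReg (hC : CompactIn X τ) (hT : IsTopIn X τ) (hH : HausdorffIn X τ) :
    IsReg X τ := by
  intro O x hx
  have hxX := hT.sub _ O.2 x hx
  obtain ⟨g, hfin, hg, hgX⟩ := hC.exists_finite
    (fun Q => SubsetIn Q O.1 ∨ ∃ N ∈ τ, x ∈ N ∧ ∀ y ∈ Q, y ∉ N) (by
      intro y hy
      by_cases hyO : y ∈ O.1
      · exact ⟨O, Or.inl fun _ h => h, hyO⟩
      · obtain ⟨N, hN, Q, hQ, hxN, hyQ, hNQ⟩ := hH x hxX y hy fun h => hyO (h ▸ hx)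
        exact ⟨⟨Q, hQ⟩, Or.inr ⟨N, hN, hxN, fun z hz hz' => hNQ z hz' hz⟩, hyQ⟩)
  obtain ⟨N, hxN, hN⟩ := exists_nbhd_of_finite hT hxX hfin
    (fun Q N => SubsetIn Q O.1 ∨ ∀ y ∈ Q, y ∉ N)
    (fun Q N N' hN h => h.imp_right fun h y hy hy' => h y hy (hN y hy')) (by
      intro Q hQ
      rcases (hg Q hQ).2 with h | ⟨N, hN, hxN, h⟩
      exacts [⟨O, hx, Or.inl h⟩, ⟨⟨N, hN⟩, hxN, Or.inr h⟩])
  refine ⟨N, hxN, fun y hy => ?_⟩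
  obtain ⟨Q, hQ, hyQ⟩ := hgX y hy
  exact (hN Q hQ).imp (fun h => h y hyQ) fun h => ⟨Q, (hg Q hQ).1, hyQ, h⟩

/-- If A is compact, the closures of the π(O), O ∈ G, have a common point. Conversely, a cover in M
has a finite subcover in M whose images still cover A, so every ultrafilter contains one of them. -/
theorem compactSpace_iff (hT : IsTopIn X τ) (hR : IsReg X τ) (hC : CompactIn X τ) {A : Type u}
    [TopologicalSpace A] (p : Preinterp X τ A) : CompactSpace A ↔ IsInterpretation p := by
  constructor
  · intro _
    rw [isInterpretation_iff hT]
    intro G hG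
    obtain ⟨a, ha⟩ := exists_mem_sInter (F := (fun O => closure (p.op O)) '' G)
      (by rintro _ ⟨O, -, rfl⟩; exact isClosed_closure)
      (fun F hF hfin => p.nonempty_sInter_closure hT hG hF hfin) (fun V _ => by
        obtain ⟨a, -, ha⟩ := isCompact_univ.ultrafilter_le_nhds V (by simp)
        exact ⟨a, ha⟩)
    exact ⟨a, p.nbhd_eq_of_mem_closure hT hR hG fun O hO => ha _ ⟨O, hO, rfl⟩⟩
  · intro hp
    refine ⟨isCompact_iff_ultrafilter_le_nhds.2 fun V _ => ?_⟩
    obtain ⟨a, ha⟩ := p.exists_le_nhds hp hT hR V (by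
      intro S hSτ hS
      obtain ⟨g, hfin, hg, hgX⟩ := hC.exists_finite (fun P => P ∈ S) (fun x hx => by
        obtain ⟨P, hP, hxP⟩ := hS x hx
        exact ⟨⟨P, hSτ P hP⟩, hP, hxP⟩)
      by_contra hcon
      push Not at hcon
      have h : (⋂ P ∈ {x | x ∈ g}, {a | ∀ h : P ∈ τ, a ∉ p.op ⟨P, h⟩}) ∈ V := by
        rw [← Ultrafilter.mem_coe, Filter.biInter_mem hfin]
        exact fun P hP => Filter.mem_of_superset
          (Ultrafilter.compl_mem_iff_notMem.2 (hcon ⟨P, (hg P hP).1⟩ (hg P hP).2)) fun a ha _ => ha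
      obtain ⟨a, ha⟩ := V.nonempty_of_mem h
      simp only [mem_iInter, mem_ofPred_eq] at ha
      obtain ⟨P, hP, hPg⟩ := (p.isPt_nbhd a).cover_univ hT (fun P => P ∈ g) (fun x hx => by
        obtain ⟨P, hP, hxP⟩ := hgX x hx
        exact ⟨⟨P, (hg P hP).1⟩, hP, hxP⟩)
      exact ha P.1 hPg P.2 hP)
    exact ⟨a, trivial, ha⟩

end Compact

/-! ### Čech complete spaces -/

section Cech

variable {M : Set ZFSet.{u}} [TransModel M]

/-- The map `e` is a homeomorphism of `X` with the intersection of the open subsets `G n` of the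
compact Hausdorff space `K`, in the model. -/
structure IsCechEmbedding (X τ K σ w : M) (e : El X → El K) (G : El w → El σ) : Prop where
  top : IsTopIn X τ
  topK : IsTopIn K σ
  hausdorff : HausdorffIn K σ
  compact : CompactIn K σ
  omega : IsOmega w
  e_internal : Internal e
  G_internal : Internal G
  mem_iff : ∀ O : M, O ∈ τ ↔ SubsetIn O X ∧ ∃ P ∈ σ, ∀ x : El X, x.1 ∈ O ↔ (e x).1 ∈ P
  range : ∀ y : El K, (∃ x, e x = y) ↔ ∀ n, y.1 ∈ (G n).1

omit [TransModel M] in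
theorem CechCompleteIn.exists_embedding {X τ : M} (h : CechCompleteIn X τ) :
    ∃ (K σ w : M) (e : El X → El K) (G : El w → El σ), IsCechEmbedding X τ K σ w e G := by
  obtain ⟨hT, K, σ, w, hK, hH, hC, hw, e, G, he, hG, -, h₁, h₂⟩ := h
  exact ⟨K, σ, w, e, G, hT, hK, hH, hC, hw, he, hG, h₁, h₂⟩

namespace IsCechEmbedding

variable {X τ K σ w : M} {e : El X → El K} {G : El w → El σ}

theorem isReg (h : IsCechEmbedding X τ K σ w e G) : IsReg K σ :=
  h.compact.isReg h.topK h.hausdorff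

theorem exists_preimage (h : IsCechEmbedding X τ K σ w e G) (P : El σ) :
    ∃ O : El τ, ∀ x : El X, x.1 ∈ O.1 ↔ (e x).1 ∈ P.1 := by
  have := Fact.mk h.e_internal
  obtain ⟨O, hO⟩ := sep (fun x => ∃ y ∈ P.1, Graph e x y) X
  have hO' : ∀ x : El X, x.1 ∈ O ↔ (e x).1 ∈ P.1 := by
    intro x
    simp only [hO, x.2, graph_iff, true_and, exists_eq_right']
  exact ⟨⟨O, (h.mem_iff O).2 ⟨fun x hx => ((hO x).1 hx).1, P.1, P.2, hO'⟩⟩, hO'⟩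

omit [TransModel M] in
theorem exists_extension (h : IsCechEmbedding X τ K σ w e G) (O : El τ) :
    ∃ P : El σ, ∀ x : El X, x.1 ∈ O.1 ↔ (e x).1 ∈ P.1 := by
  obtain ⟨-, P, hP, hOP⟩ := (h.mem_iff O.1).1 O.2
  exact ⟨⟨P, hP⟩, hOP⟩

/-- Regularity and H give such a sequence outside M, and the branch theorem gives one in M although
H need not be there. Not being contained in Q is the first order remnant of Q ∉ H. -/
theorem exists_internal_inside (h : IsCechEmbedding X τ K σ w e G) {H : Set (El σ)}
    (hH : IsPt K σ H) (hG : ∀ n, G n ∈ H) {P Q : El σ} (hP : P ∈ H) (hQ : Q ∉ H) :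
    ∃ s : El w → El σ, Internal s ∧ s (h.omega.nat 0) = P ∧ ∀ n,
      Inside K σ (s (h.omega.nat (n + 1))).1 (s (h.omega.nat n)).1 ∧
      Inside K σ (s (h.omega.nat (n + 1))).1 (G (h.omega.nat n)).1 ∧
      ∃ x ∈ (s (h.omega.nat (n + 1))).1, x ∉ Q.1 := by
  have := Fact.mk h.G_internal
  have step : ∀ (n : ℕ) (P : {P // P ∈ H}), ∃ P' : {P // P ∈ H}, Inside K σ P'.1.1 P.1.1 ∧
      Inside K σ P'.1.1 (G (h.omega.nat n)).1 ∧ ∃ x ∈ P'.1.1, x ∉ Q.1 := by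
    rintro n ⟨P, hP⟩
    obtain ⟨R, hR⟩ := exists_inter h.topK P (G (h.omega.nat n))
    obtain ⟨P', hP', hPR⟩ := hH.exists_inside h.topK h.isReg (hH.inter P hP _ (hG _) R hR)
    refine ⟨⟨P', hP'⟩, fun x hx => (hPR x hx).imp_left fun h => ((hR x).1 h).1,
      fun x hx => (hPR x hx).imp_left fun h => ((hR x).1 h).2, ?_⟩
    by_contra hcon
    push Not at hcon
    exact hQ (hH.mono P' hP' Q hcon)
  choose next h₁ h₂ h₃ using step
  let b : ℕ → {P // P ∈ H} := fun n => n.rec ⟨P, hP⟩ fun n P => next n P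
  obtain ⟨s, hs, hs0, hsn⟩ := exists_internal_branch h.omega σ
    (fun n P P' => Inside K σ P' P ∧ (∀ o, Graph G n o → Inside K σ P' o) ∧ ∃ x ∈ P', x ∉ Q.1)
    (fun n => (b n).1) (fun n => ⟨h₁ n (b n), fun o ho => by
      have := (graph_iff (x := h.omega.nat n)).1 ho
      subst this
      exact h₂ n (b n), h₃ n (b n)⟩)
  exact ⟨s, hs, hs0, fun n => ⟨(hsn n).1, (hsn n).2.1 _ ((graph_iff (x := h.omega.nat n)).2 rfl),
    (hsn n).2.2⟩⟩

/-- A filter containing every G n sees only traces on X. If Q ∉ H, take the sequence of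
`exists_internal_inside`: a point of all closures of the s n lies in P and in every G n, so it comes
from X and lies in Q. Compactness in M puts some s n inside Q, a contradiction. -/
theorem mem_of_preimage_subset (h : IsCechEmbedding X τ K σ w e G) {H : Set (El σ)}
    (hH : IsPt K σ H) (hG : ∀ n, G n ∈ H) {P Q : El σ} (hP : P ∈ H)
    (hPQ : ∀ x, (e x).1 ∈ P.1 → (e x).1 ∈ Q.1) : Q ∈ H := by
  by_contra hQ
  obtain ⟨s, hs, hs0, hsn⟩ := h.exists_internal_inside hH hG hP hQ
  have := Fact.mk hs
  have hsub : ∀ n k, n ≤ k → SubsetIn (s (h.omega.nat k)).1 (s (h.omega.nat n)).1 := by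
    intro n k hk
    induction k, hk using Nat.le_induction with
    | base => exact fun _ h => h
    | succ k _ ih =>
      exact fun x hx => ih x ((hsn k).1.subset (h.topK.sub _ (s _).2) x hx)
  obtain ⟨g, hfin, hg, hgK⟩ := h.compact.exists_finite
    (fun N => SubsetIn N Q.1 ∨ ∃ n ∈ w, ∃ o, Graph s n o ∧ ∀ y ∈ N, y ∉ o) (by
      intro z hz
      by_contra hcon
      push Not at hcon
      have hzQ : z ∉ Q.1 := fun hzQ => hcon Q (Or.inl fun _ h => h) hzQ
      have hin : ∀ n O, Inside K σ (s (h.omega.nat n)).1 O → z ∈ O := by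
        intro n O hO
        rcases hO z hz with hzO | ⟨N, hN, hzN, hNs⟩
        · exact hzO
        · exact absurd hzN (hcon ⟨N, hN⟩ (Or.inr ⟨num n, (h.omega.nat n).2, _,
            (graph_iff (x := h.omega.nat n)).2 rfl, hNs⟩))
      obtain ⟨x, hx⟩ := (h.range ⟨z, hz⟩).2 fun n => by
        obtain ⟨k, rfl⟩ := h.omega.exists_nat n
        exact hin (k + 1) _ (hsn k).2.1
      have hzP := hin 1 _ (hsn 0).1
      rw [hs0] at hzP
      have hxz : (e x).1 = z := congrArg El.val hx
      rw [← hxz] at hzP hzQ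
      exact hzQ (hPQ x hzP))
  have hidx : ∀ N, ∃ n, N ∈ g → SubsetIn N Q.1 ∨ ∀ y ∈ N, y ∉ (s (h.omega.nat n)).1 := by
    intro N
    by_cases hN : N ∈ g
    · rcases (hg N hN).2 with h' | ⟨n, hn, o, ho, h'⟩
      · exact ⟨0, fun _ => Or.inl h'⟩
      · obtain ⟨k, rfl⟩ := h.omega.mem_iff.1 hn
        have := (graph_iff (x := h.omega.nat k)).1 ho
        subst this
        exact ⟨k, fun _ => Or.inr h'⟩
    · exact ⟨0, fun h => absurd h hN⟩
  choose k hk using hidx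
  obtain ⟨N, hN⟩ := (hfin.image k).bddAbove
  obtain ⟨x, hx, hxQ⟩ := (hsn N).2.2
  obtain ⟨O, hO, hxO⟩ := hgK x (h.topK.sub _ (s _).2 x hx)
  rcases hk O hO with h' | h'
  · exact hxQ (h' x hxO)
  · exact h' x hxO (hsub _ _ ((hN ⟨O, hO, rfl⟩).trans (Nat.le_succ N)) x hx)

/-- The filter on X consists of the traces of members of H. Independence of the chosen extension,
properness, monotonicity and primeness all rest on `mem_of_preimage_subset`. -/
theorem exists_isPt (h : IsCechEmbedding X τ K σ w e G) {H : Set (El σ)}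
    (hH : IsPt K σ H) (hG : ∀ n, G n ∈ H) : ∃ H', IsPt X τ H' ∧
      ∀ (O : El τ) (P : El σ), (∀ x : El X, x.1 ∈ O.1 ↔ (e x).1 ∈ P.1) → (O ∈ H' ↔ P ∈ H) := by
  have := Fact.mk h.e_internal
  have key : ∀ {P Q : El σ}, P ∈ H → (∀ x, (e x).1 ∈ P.1 → (e x).1 ∈ Q.1) → Q ∈ H :=
    fun hP hPQ => h.mem_of_preimage_subset hH hG hP hPQ
  have hX : ∀ {O : El τ} {x}, x ∈ O.1 → x ∈ X := fun {O x} hx => h.top.sub _ O.2 x hx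
  refine ⟨{O | ∃ P ∈ H, ∀ x : El X, x.1 ∈ O.1 ↔ (e x).1 ∈ P.1}, ⟨?_, ?_, ?_, ?_, ?_⟩, ?_⟩
  · intro O hO
    exact ⟨⟨K, h.topK.univ_mem⟩, hH.univ _ rfl, fun x => by simp only [hO, x.2, (e x).2]⟩
  · rintro O ⟨P, hP, hOP⟩
    by_contra hcon
    push Not at hcon
    obtain ⟨E, hE⟩ := exists_empty_open h.topK
    obtain ⟨x, hx⟩ := hH.nonempty E (key hP fun x hx => absurd ((hOP x).2 hx) (hcon _))
    exact hE x hx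
  · rintro O ⟨P, hP, hOP⟩ O' ⟨P', hP', hOP'⟩ Q hQ
    obtain ⟨R, hR⟩ := exists_inter h.topK P P'
    exact ⟨R, hH.inter P hP P' hP' R hR, fun x => by rw [hQ, hR, hOP, hOP']⟩
  · rintro O ⟨P, hP, hOP⟩ O' hOO'
    obtain ⟨P', hP'⟩ := h.exists_extension O'
    exact ⟨P', key hP fun x hx => (hP' x).1 (hOO' _ ((hOP x).2 hx)), hP'⟩
  · rintro S hS O ⟨P, hP, hOP⟩ hO
    have hφ : ∀ (W R : M), (∀ x ∈ X, (x ∈ W ↔ ∃ y ∈ R, Graph e x y)) ↔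
        ∀ x : El X, x.1 ∈ W ↔ (e x).1 ∈ R := by
      intro W R
      refine ⟨fun h x => (h x.1 x.2).trans ?_, fun h x hx => (h ⟨x, hx⟩).trans ?_⟩
      · simp only [graph_iff, exists_eq_right']
      · simp only [graph_iff (x := ⟨x, hx⟩), exists_eq_right']
    obtain ⟨Q, hQ⟩ := exists_iUnion h.topK
      (fun R => ∃ W ∈ S, ∀ x ∈ X, (x ∈ W ↔ ∃ y ∈ R, Graph e x y))
    obtain ⟨R, hR, W, hW, hWR⟩ := hH.cover h.topK
      (fun R => ∃ W ∈ S, ∀ x ∈ X, (x ∈ W ↔ ∃ y ∈ R, Graph e x y)) (O := Q)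
      (key hP fun x hx => by
        obtain ⟨W, hW, hxW⟩ := (hO _).1 ((hOP x).2 hx)
        obtain ⟨R, hR⟩ := h.exists_extension ⟨W, hS W hW⟩
        exact (hQ _).2 ⟨R, ⟨W, hW, (hφ _ _).2 hR⟩, (hR x).1 hxW⟩)
      (fun z hz => (hQ z).1 hz)
    exact ⟨⟨W, hS W hW⟩, ⟨R, hR, (hφ _ _).1 hWR⟩, hW⟩
  · intro O P hOP
    refine ⟨?_, fun hP => ⟨P, hP, hOP⟩⟩
    rintro ⟨P', hP', hOP'⟩
    exact key hP' fun x hx => (hOP x).1 ((hOP' x).2 hx)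

/-- Pushing filters forward along e embeds A in the compact space of points of K; by `exists_isPt`
the range is the intersection of the sets π(G n). -/
theorem cechComplete (h : IsCechEmbedding X τ K σ w e G) {A : Type u} [TopologicalSpace A]
    (p : Preinterp X τ A) (hp : IsInterpretation p) : CechComplete A := by
  let q := PtSpace.preinterp h.topK
  have hq : IsInterpretation q := PtSpace.isInterpretation h.topK
  have hc : CompactSpace (PtSpace K σ) := (compactSpace_iff h.topK h.isReg h.compact q).2 hq
  have ht : T2Space (PtSpace K σ) := q.t2Space h.topK h.isReg
  choose E hE using fun a => (isInterpretation_iff h.topK).1 hq _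
    ((p.isPt_nbhd a).map h.top h.e_internal fun P hP => by
      obtain ⟨O, hO⟩ := h.exists_preimage ⟨P, hP⟩
      exact ⟨O.1, O.2, hO⟩)
  have hext : ∀ {O O' : El τ} {P : El σ}, (∀ x : El X, x.1 ∈ O.1 ↔ (e x).1 ∈ P.1) →
      (∀ x : El X, x.1 ∈ O'.1 ↔ (e x).1 ∈ P.1) → O = O' := by
    intro O O' P hO hO'
    refine El.ext (mem_ext fun x => ⟨fun hx => ?_, fun hx => ?_⟩)
    · have := h.top.sub _ O.2 x hx
      exact (hO' ⟨x, this⟩).2 ((hO ⟨x, this⟩).1 hx)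
    · have := h.top.sub _ O'.2 x hx
      exact (hO ⟨x, this⟩).2 ((hO' ⟨x, this⟩).1 hx)
  have hop : ∀ {O : El τ} {P : El σ}, (∀ x : El X, x.1 ∈ O.1 ↔ (e x).1 ∈ P.1) →
      ∀ a, E a ∈ q.op P ↔ a ∈ p.op O := by
    intro O P hOP a
    change P ∈ q.nbhd (E a) ↔ _
    rw [hE]
    constructor
    · rintro ⟨O', hO', hOP'⟩
      rwa [hext hOP hOP']
    · exact fun ha => ⟨O, ha, hOP⟩
  have := p.t0
  refine ⟨PtSpace K σ, inferInstance, E, hc, ht, IsInducing.isEmbedding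
    (isInducing_iff_nhds.2 fun a => ?_), ?_⟩
  · ext s
    rw [p.mem_nhds_iff, Filter.mem_comap]
    constructor
    · rintro ⟨O, hO, hOs⟩
      obtain ⟨P, hP⟩ := h.exists_extension O
      exact ⟨q.op P, (q.isOpen_op P).mem_nhds ((hop hP a).2 hO),
        fun b hb => hOs ((hop hP b).1 hb)⟩
    · rintro ⟨t, ht, hts⟩
      obtain ⟨P, hP, hPt⟩ := q.mem_nhds_iff.1 ht
      obtain ⟨O, hO⟩ := h.exists_preimage P
      exact ⟨O, (hop hO a).1 hP, fun b hb => hts (hPt ((hop hO b).2 hb))⟩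
  · have : Set.range E = ⋂ n : ℕ, q.op (G (h.omega.nat n)) := by
      ext b
      rw [mem_iInter]
      constructor
      · rintro ⟨a, rfl⟩ n
        exact (hop (O := ⟨X, h.top.univ_mem⟩) (fun x => ⟨fun _ => (h.range (e x)).1 ⟨x, rfl⟩ _,
          fun _ => x.2⟩) a).2 (by rw [p.op_univ _ rfl]; trivial)
      · intro hb
        obtain ⟨H', hH', hH⟩ := h.exists_isPt (q.isPt_nbhd b) (fun n => by
          obtain ⟨k, rfl⟩ := h.omega.exists_nat n
          exact hb k)
        obtain ⟨a, rfl⟩ := (isInterpretation_iff h.top).1 hp H' hH'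
        refine ⟨a, q.nbhd_injective ?_⟩
        ext P
        obtain ⟨O, hO⟩ := h.exists_preimage P
        exact (hop hO a).trans (hH O P hO)
    rw [this]
    exact IsGδ.iInter_of_isOpen fun n => q.isOpen_op _

end IsCechEmbedding

end Cech

/-! ### Interpretable spaces -/

section Interpretable

variable {M : Set ZFSet.{u}} [TransModel M] {X τ Y ρ K σ w : M} {e : El Y → El K}
  {G : El w → El σ} {g : El Y → El X}

/-- Each Q n has an image containing a member of H. The images under the open map of small open
pieces of Q n cover that member in M, and primeness of H selects the next piece. -/
theorem exists_refining_sequence (h : IsCechEmbedding Y ρ K σ w e G) (hT : IsTopIn X τ)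
    (hg : Internal g)
    (hgo : ∀ Q ∈ ρ, ∃ O ∈ τ, ∀ x : El X, x.1 ∈ O ↔ ∃ y : El Y, y.1 ∈ Q ∧ g y = x)
    {H : Set (El τ)} (hH : IsPt X τ H) {Q₀ : El ρ}
    (hQ₀ : ∃ O ∈ H, ∀ x ∈ O.1, ∃ y ∈ Q₀.1, Graph g y x) (R : ℕ → El σ)
    (hR : ∀ n (y : El Y), y.1 ∈ Q₀.1 → (e y).1 ∈ (R n).1) :
    ∃ (Q : ℕ → El ρ) (P : ℕ → El σ), ∀ n, SubsetIn (Q (n + 1)).1 (Q n).1 ∧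
      Inside K σ (P n).1 (R n).1 ∧ (∀ y : El Y, y.1 ∈ (Q (n + 1)).1 → (e y).1 ∈ (P n).1) ∧
      ∃ O ∈ H, ∀ x ∈ O.1, ∃ y ∈ (Q n).1, Graph g y x := by
  have := Fact.mk hg
  have := Fact.mk h.e_internal
  let St := {Q : El ρ // SubsetIn Q.1 Q₀.1 ∧ ∃ O ∈ H, ∀ x ∈ O.1, ∃ y ∈ Q.1, Graph g y x}
  have step : ∀ (n : ℕ) (Q : St), ∃ (Q' : St) (P : El σ), SubsetIn Q'.1.1 Q.1.1 ∧
      Inside K σ P.1 (R n).1 ∧ ∀ y : El Y, y.1 ∈ Q'.1.1 → (e y).1 ∈ P.1 := by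
    rintro n ⟨Q, hQ, O, hO, hOQ⟩
    obtain ⟨O', hO', Q', hQ', P, hP, hQQ', hPR, hQP, hOQ'⟩ := hH.cover hT
      (fun O' => ∃ Q' ∈ ρ, ∃ P ∈ σ, SubsetIn Q' Q.1 ∧ Inside K σ P (R n).1 ∧
        (∀ y ∈ Q', ∃ z ∈ P, Graph e y z) ∧ ∀ x ∈ O', ∃ y ∈ Q', Graph g y x) hO (by
        intro x hx
        obtain ⟨y, hy, hyx⟩ := hOQ x hx
        have hyY := h.top.sub _ Q.2 y hy
        obtain ⟨P, hyP, hPR⟩ := h.isReg (R n) _ (hR n ⟨y, hyY⟩ (hQ y hy))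
        obtain ⟨N, hN⟩ := h.exists_preimage P
        obtain ⟨Q', hQ'⟩ := exists_inter h.top Q N
        obtain ⟨O', hO', hOQ'⟩ := hgo Q'.1 Q'.2
        refine ⟨⟨O', hO'⟩, ⟨Q'.1, Q'.2, P.1, P.2, fun z hz => ((hQ' z).1 hz).1, hPR, ?_, ?_⟩, ?_⟩
        · intro z hz
          have hz' := (hQ' z).1 hz
          have hzY := h.top.sub _ Q.2 z hz'.1
          exact ⟨_, (hN ⟨z, hzY⟩).1 hz'.2, hzY, rfl⟩
        · intro x' hx'
          obtain ⟨z, hz, hzx⟩ := (hOQ' ⟨x', hT.sub _ hO' x' hx'⟩).1 hx'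
          exact ⟨z.1, hz, graph_iff.2 (congrArg El.val hzx)⟩
        · refine (hOQ' ⟨x, hT.sub _ O.2 x hx⟩).2 ⟨⟨y, hyY⟩, (hQ' y).2 ⟨hy, (hN ⟨y, hyY⟩).2 hyP⟩,
            El.ext ((graph_iff (x := ⟨y, hyY⟩)).1 hyx)⟩)
    refine ⟨⟨⟨Q', hQ'⟩, fun y hy => hQ y (hQQ' y hy), O', hO', hOQ'⟩, ⟨P, hP⟩, hQQ', hPR,
      fun y hy => ?_⟩
    obtain ⟨z, hz, hyz⟩ := hQP y.1 hy
    rw [graph_iff] at hyz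
    rwa [hyz]
  choose next P h₁ h₂ h₃ using step
  let b : ℕ → St := fun n => n.rec ⟨Q₀, fun _ h => h, hQ₀⟩ fun n Q => next n Q
  exact ⟨fun n => (b n).1, fun n => P n (b n), fun n =>
    ⟨h₁ n (b n), h₂ n (b n), h₃ n (b n), (b n).2.2⟩⟩

/-- The sets of y ∈ Q n with g y ∈ O, for O ∈ H, are directed downwards, and nonempty because the
image of Q n contains a member of H, which meets O. -/
theorem exists_ultrafilter (hT : IsTopIn X τ) {H : Set (El τ)} (hH : IsPt X τ H) (Q : ℕ → M)
    (hQ : ∀ n, SubsetIn (Q (n + 1)) (Q n))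
    (hQH : ∀ n, ∃ O ∈ H, ∀ x ∈ O.1, ∃ y ∈ Q n, Graph g y x) :
    ∃ V : Ultrafilter (El Y), (∀ n, {y | y.1 ∈ Q n} ∈ V) ∧ ∀ O ∈ H, {y | (g y).1 ∈ O.1} ∈ V := by
  have hQ' : ∀ n k, n ≤ k → SubsetIn (Q k) (Q n) := by
    intro n k hk
    induction k, hk using Nat.le_induction with
    | base => exact fun _ h => h
    | succ k _ ih => exact fun x hx => ih x (hQ k x hx)
  let F : Set (Set (El Y)) := {D | ∃ n, ∃ O ∈ H, {y | y.1 ∈ Q n ∧ (g y).1 ∈ O.1} ⊆ D}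
  obtain ⟨O₁, hO₁, -⟩ := hQH 0
  have hF : ∀ t ⊆ F, t.Finite → (⋂₀ t).Nonempty := by
    intro t ht hfin
    have : ⋂₀ t ∈ F := by
      induction t, hfin using Set.Finite.induction_on with
      | empty => exact ⟨0, O₁, hO₁, by simp⟩
      | @insert C t _ _ ih =>
        obtain ⟨n, O, hO, h⟩ := ih ((subset_insert _ _).trans ht)
        obtain ⟨m, P, hP, h'⟩ := ht (mem_insert _ _)
        obtain ⟨R, hR⟩ := exists_inter hT O P
        refine ⟨max n m, R, hH.inter O hO P hP R hR, ?_⟩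
        rw [sInter_insert]
        rintro y ⟨hy, hyR⟩
        exact ⟨h' ⟨hQ' _ _ (le_max_right _ _) _ hy, ((hR _).1 hyR).2⟩,
          h ⟨hQ' _ _ (le_max_left _ _) _ hy, ((hR _).1 hyR).1⟩⟩
    obtain ⟨n, O, hO, h⟩ := this
    obtain ⟨P, hP, hPQ⟩ := hQH n
    obtain ⟨x, hxO, hxP⟩ := hH.exists_mem hT hO hP
    obtain ⟨y, hy, hyY, rfl⟩ := hPQ x hxP
    exact ⟨⟨y, hyY⟩, h ⟨hy, hxO⟩⟩
  have := Filter.generate_neBot_iff.2 hF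
  have hV : ∀ D ∈ F, D ∈ Ultrafilter.of (Filter.generate F) := fun D hD =>
    Ultrafilter.of_le _ (Filter.mem_generate_of_mem hD)
  exact ⟨_, fun n => hV _ ⟨n, O₁, hO₁, fun y hy => hy.1⟩,
    fun O hO => hV _ ⟨0, O, hO, fun y hy => hy.2⟩⟩

/-- The ultrafilter on Y has a limit k in the compact interpretation of K. As P n has closure inside
R n, the point k lies in the extension of Q₀ and in every G n, so it yields a filter on Y containing
Q₀. Its image is H because the ultrafilter contains the preimage of every member of H. -/
theorem exists_isPt_lift (h : IsCechEmbedding Y ρ K σ w e G) (hT : IsTopIn X τ) (hR : IsReg X τ)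
    (hg : Internal g) (hgc : ∀ O ∈ τ, ∃ Q ∈ ρ, ∀ y : El Y, y.1 ∈ Q ↔ (g y).1 ∈ O)
    (hgo : ∀ Q ∈ ρ, ∃ O ∈ τ, ∀ x : El X, x.1 ∈ O ↔ ∃ y : El Y, y.1 ∈ Q ∧ g y = x)
    {H : Set (El τ)} (hH : IsPt X τ H) {Q₀ : El ρ}
    (hQ₀ : ∃ O ∈ H, ∀ x ∈ O.1, ∃ y ∈ Q₀.1, Graph g y x) :
    ∃ H', IsPt Y ρ H' ∧ Q₀ ∈ H' ∧
      {O : El τ | ∃ Q ∈ H', ∀ y : El Y, y.1 ∈ Q.1 ↔ (g y).1 ∈ O.1} = H := by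
  have := Fact.mk hg
  let q := PtSpace.preinterp h.topK
  have hc : CompactSpace (PtSpace K σ) := (compactSpace_iff h.topK h.isReg h.compact q).2
    (PtSpace.isInterpretation h.topK)
  obtain ⟨R₀, hR₀⟩ := h.exists_extension Q₀
  -- R 0 takes care of Q₀; the sets G k are shifted by one.
  let R : ℕ → El σ := fun n => n.casesOn R₀ fun k => G (h.omega.nat k)
  obtain ⟨Q, P, hQP⟩ := exists_refining_sequence h hT hg hgo hH hQ₀ R (by
    rintro (_ | n) y hy
    · exact (hR₀ y).1 hy
    · exact (h.range (e y)).1 ⟨y, rfl⟩ _)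
  obtain ⟨V, hVQ, hVH⟩ := exists_ultrafilter (g := g) hT hH (fun n => (Q n).1) (fun n => (hQP n).1)
    fun n => (hQP n).2.2.2
  obtain ⟨k, -, hk⟩ := isCompact_univ.ultrafilter_le_nhds (V.map fun y => q.pt (e y)) (by simp)
  have hkV : ∀ P ∈ q.nbhd k, {y | (e y).1 ∈ P.1} ∈ V := by
    intro P hP
    have : q.op P ∈ V.map fun y => q.pt (e y) := hk ((q.isOpen_op P).mem_nhds hP)
    refine Filter.mem_of_superset (Ultrafilter.mem_map.1 this) fun y hy => ?_
    exact (q.mem_iff _ _).2 hy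
  have hkR : ∀ n, R n ∈ q.nbhd k := by
    intro n
    rcases (q.isPt_nbhd k).inside_cases h.topK (hQP n).2.1 with h' | ⟨N, hN, hNP⟩
    · exact h'
    · obtain ⟨y, hy, hy'⟩ := V.nonempty_of_mem (Filter.inter_mem (hVQ (n + 1)) (hkV N hN))
      exact absurd ((hQP n).2.2.1 y hy) (hNP _ hy')
  obtain ⟨H', hH', hHk⟩ := h.exists_isPt (q.isPt_nbhd k) (fun n => by
    obtain ⟨m, rfl⟩ := h.omega.exists_nat n
    exact hkR (m + 1))
  have hHV : ∀ N ∈ H', {y : El Y | y.1 ∈ N.1} ∈ V := by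
    intro N hN
    obtain ⟨P, hP⟩ := h.exists_extension N
    exact Filter.mem_of_superset (hkV P ((hHk N P hP).1 hN)) fun y hy => (hP y).2 hy
  refine ⟨H', hH', (hHk Q₀ R₀ hR₀).2 (hkR 0), ?_⟩
  refine (hH.eq_of_subset (hH'.map h.top hg hgc) hT hR fun O hO => ?_).symm
  obtain ⟨O', hO', hOO'⟩ := hH.exists_inside hT hR hO
  -- Open sets with image inside O or disjoint from O' cover Y; the second kind is excluded since
  -- the preimage of O' is V-large.
  obtain ⟨N, hN, hNO⟩ := hH'.cover_univ h.top
    (fun N => (∀ y ∈ N, ∃ x ∈ O.1, Graph g y x) ∨ ∀ y ∈ N, ∀ x ∈ O'.1, ¬ Graph g y x) (by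
      intro y hy
      rcases hOO' _ (g ⟨y, hy⟩).2 with hyO | ⟨W, hW, hyW, hWO⟩
      · obtain ⟨N, hN, hNO⟩ := hgc O.1 O.2
        exact ⟨⟨N, hN⟩, Or.inl fun z hz => ⟨_, (hNO ⟨z, h.top.sub _ hN z hz⟩).1 hz, _, rfl⟩,
          (hNO _).2 hyO⟩
      · obtain ⟨N, hN, hNW⟩ := hgc W hW
        refine ⟨⟨N, hN⟩, Or.inr fun z hz x hx hzx => ?_, (hNW _).2 hyW⟩
        obtain ⟨hzY, rfl⟩ := hzx
        exact hWO _ ((hNW ⟨z, hzY⟩).1 hz) hx)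
  obtain ⟨O₂, hO₂, hgO⟩ := hgc O.1 O.2
  refine ⟨⟨O₂, hO₂⟩, ?_, hgO⟩
  rcases hNO with hNO | hNO
  · refine hH'.mono N hN _ fun y hy => ?_
    obtain ⟨x, hx, hyY, rfl⟩ := hNO y hy
    exact (hgO ⟨y, hyY⟩).2 hx
  · obtain ⟨y, hy, hy'⟩ := V.nonempty_of_mem (Filter.inter_mem (hHV N hN) (hVH O' hO'))
    exact absurd (graph_iff.2 rfl) (hNO y.1 hy _ hy')

theorem InterpretableIn.isReg (h : InterpretableIn X τ) : IsReg X τ := h.1.2.2.isReg h.1.1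

/-- `IsPt.map` induces the map E between interpretations. Lifting with Q₀ = Q shows that E maps π(Q)
onto π of the image of Q; lifting with Q₀ = Y shows that E is onto. -/
theorem InterpretableIn.interpretable (hX : InterpretableIn X τ) {A : Type u} [TopologicalSpace A]
    (p : Preinterp X τ A) (hp : IsInterpretation p) : Interpretable A := by
  have hT := hX.1.1
  have hR := hX.isReg
  obtain ⟨-, Y, ρ, hY, g, hg, hgs, hgc, hgo⟩ := hX
  obtain ⟨K, σ, w, e, G, h⟩ := hY.exists_embedding
  let q := PtSpace.preinterp h.top
  have hq : IsInterpretation q := PtSpace.isInterpretation h.top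
  choose E hE using fun b => (isInterpretation_iff hT).1 hp _ ((q.isPt_nbhd b).map h.top hg hgc)
  have hlift : ∀ (a : A) (Q : El ρ), (∃ O ∈ p.nbhd a, ∀ x ∈ O.1, ∃ y ∈ Q.1, Graph g y x) →
      ∃ b ∈ q.op Q, E b = a := by
    intro a Q hQ
    obtain ⟨H', hH', hQH, hHa⟩ := exists_isPt_lift h hT hR hg hgc hgo (p.isPt_nbhd a) hQ
    obtain ⟨b, rfl⟩ := (isInterpretation_iff h.top).1 hq H' hH'
    exact ⟨b, hQH, p.nbhd_injective ((hE b).trans hHa)⟩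
  refine ⟨p.regularSpace hT hR, p.t2Space hT hR, PtSpace Y ρ, inferInstance, E,
    h.cechComplete q hq, ?_, ?_, ?_⟩
  · rw [p.basis.continuous_iff]
    rintro _ ⟨O, rfl⟩
    obtain ⟨Q, hQ, hQO⟩ := hgc O.1 O.2
    have : E ⁻¹' p.op O = q.op ⟨Q, hQ⟩ := by
      ext b
      change O ∈ p.nbhd (E b) ↔ _
      rw [hE]
      constructor
      · rintro ⟨Q', hQ', hQO'⟩
        refine q.op_mono (fun y hy => ?_) hQ'
        exact (hQO ⟨y, h.top.sub _ Q'.2 y hy⟩).2 ((hQO' ⟨y, h.top.sub _ Q'.2 y hy⟩).1 hy)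
      · exact fun hb => ⟨⟨Q, hQ⟩, hb, hQO⟩
    rw [this]
    exact q.isOpen_op _
  · rw [q.basis.isOpenMap_iff]
    rintro _ ⟨Q, rfl⟩
    obtain ⟨O, hO, hOQ⟩ := hgo Q.1 Q.2
    have : E '' q.op Q = p.op ⟨O, hO⟩ := by
      ext a
      constructor
      · rintro ⟨b, hb, rfl⟩
        change _ ∈ p.nbhd (E b)
        rw [hE]
        obtain ⟨Q', hQ', hQO'⟩ := hgc O hO
        refine ⟨⟨Q', hQ'⟩, q.op_mono (fun y hy => ?_) hb, hQO'⟩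
        have hyY := h.top.sub _ Q.2 y hy
        exact (hQO' ⟨y, hyY⟩).2 ((hOQ _).2 ⟨_, hy, rfl⟩)
      · intro ha
        obtain ⟨b, hb, hba⟩ := hlift a Q ⟨_, ha, fun x hx => by
          obtain ⟨y, hy, hyx⟩ := (hOQ ⟨x, hT.sub _ hO x hx⟩).1 hx
          exact ⟨y.1, hy, graph_iff.2 (congrArg El.val hyx)⟩⟩
        exact ⟨b, hb, hba⟩
    rw [this]
    exact p.isOpen_op _
  · intro a
    obtain ⟨b, -, hb⟩ := hlift a ⟨Y, h.top.univ_mem⟩ ⟨⟨X, hT.univ_mem⟩,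
      (p.isPt_nbhd a).univ _ rfl, fun x hx => by
        obtain ⟨y, hy⟩ := hgs ⟨x, hx⟩
        exact ⟨y.1, y.2, graph_iff.2 (congrArg El.val hy)⟩⟩
    exact ⟨b, hb⟩

end Interpretable

/-! ### The real numbers of the model -/

section RealField

variable {M : Set ZFSet.{u}} [TransModel M] {R : M} [Field (El R)] [LinearOrder (El R)]
  [IsStrictOrderedRing (El R)]

theorem RealFieldIn.exists_internal_pow (hR : RealFieldIn R) {w : M} (hw : IsOmega w) (c : El R) :
    ∃ s : El w → El R, Internal s ∧ ∀ n, s (hw.nat n) = c ^ n := by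
  have := Fact.mk hR.mul_internal
  obtain ⟨s, hs, hs'⟩ := exists_internal_rec hw (fun x : El R => c * x)
    (internal_of_dfn _ (fun x y => Graph₂ (fun x y : El R => x * y) c.1 x y) fun x y => graph₂_iff)
    1
  exact ⟨s, hs, fun n => by rw [hs', mul_left_iterate_apply_one]⟩

/-- By internal recursion the powers of 2 form a set of M. If bounded, they have a least upper bound
b ≥ 1, and doubling gives b ≤ b / 2. -/
theorem RealFieldIn.archimedean (hR : RealFieldIn R) : Archimedean (El R) := by
  rw [archimedean_iff_nat_lt]
  by_contra hcon
  push Not at hcon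
  obtain ⟨x, hx⟩ := hcon
  obtain ⟨w, hw⟩ := exists_omega (M := M)
  obtain ⟨s, hs, hsn⟩ := hR.exists_internal_pow hw 2
  have := Fact.mk hs
  obtain ⟨S, hS⟩ := sep (fun y => ∃ n, Graph s n y) R
  have hS' : ∀ y : El R, y.1 ∈ S ↔ ∃ n, (2 : El R) ^ n = y := by
    intro y
    rw [hS]
    constructor
    · rintro ⟨-, n, hn, h⟩
      obtain ⟨k, hk⟩ := hw.exists_nat ⟨n, hn⟩
      rw [hk, hsn] at h
      exact ⟨k, El.ext h⟩
    · rintro ⟨n, rfl⟩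
      exact ⟨((2 : El R) ^ n).2, (hw.nat n).1, graph_iff.2 (by rw [hsn])⟩
  obtain ⟨b, hb⟩ := hR.exists_lub S (fun y hy => ((hS y).1 hy).1)
    ⟨(1 : El R).1, (hS' 1).2 ⟨0, pow_zero _⟩⟩
    ⟨x, fun y hy => by
      obtain ⟨n, rfl⟩ := (hS' y).1 hy
      exact_mod_cast hx (2 ^ n)⟩
  have h1 : (1 : El R) ≤ b := hb.1 ((hS' 1).2 ⟨0, pow_zero _⟩)
  have h2 : b ≤ b / 2 := hb.2 fun y hy => by
    obtain ⟨n, rfl⟩ := (hS' y).1 hy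
    have : (2 : El R) ^ (n + 1) ≤ b := hb.1 ((hS' _).2 ⟨n + 1, rfl⟩)
    rw [pow_succ] at this
    linarith
  linarith

omit [TransModel M] in
theorem exists_map_lt [Archimedean (El R)] (j : El R →+*o ℝ) {δ : ℝ} (hδ : 0 < δ) :
    ∃ ε : El R, 0 < ε ∧ j ε < δ := by
  obtain ⟨q, hq, hqδ⟩ := exists_rat_btwn hδ
  exact ⟨q, by exact_mod_cast hq, by rwa [map_ratCast]⟩

omit [TransModel M] [IsStrictOrderedRing (El R)] in
theorem map_lt_map_iff' (j : El R →+*o ℝ) {a b : El R} : j a < j b ↔ a < b :=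
  ((OrderHomClass.mono j).strictMono_of_injective (RingHom.injective (j : El R →+* ℝ))).lt_iff_lt

end RealField

/-! ### Complete metric spaces -/

section Metric

variable {M : Set ZFSet.{u}} [TransModel M] {X τ R : M} [Field (El R)] [LinearOrder (El R)]
  [IsStrictOrderedRing (El R)] {d : El X → El X → El R}

/-- All distances between points of `P` are smaller than `ε`. -/
def Small (d : El X → El X → El R) (P ε : M) : Prop :=
  ∀ x ∈ P, ∀ y ∈ P, ∃ r, Graph₂ d x y r ∧ ¬ Lift (fun a b : El R => a ≤ b) ε r

instance Dfn.small [Fact (Internal₂ d)] [Fact (InternalRel fun a b : El R => a ≤ b)]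
    (s t : (ℕ → M) → M) [DefTerm s] [DefTerm t] : Dfn (fun v => Small d (s v) (t v)) := by
  unfold Small; infer_instance

omit [TransModel M] [Field (El R)] [IsStrictOrderedRing (El R)] in
theorem small_iff {P : M} (hP : SubsetIn P X) {ε : El R} :
    Small d P ε.1 ↔ ∀ x y : El X, x.1 ∈ P → y.1 ∈ P → d x y < ε := by
  constructor
  · intro h x y hx hy
    obtain ⟨r, hr, h⟩ := h x.1 hx y.1 hy
    rw [graph₂_iff] at hr
    subst hr
    rwa [lift_iff, not_le] at h
  · intro h x hx y hy
    refine ⟨_, ⟨hP x hx, hP y hy, rfl⟩, ?_⟩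
    rw [lift_iff, not_le]
    exact h ⟨x, _⟩ ⟨y, _⟩ hx hy

omit [TransModel M] [IsStrictOrderedRing (El R)] in
theorem CompleteMetricIn.self (hd : CompleteMetricIn X τ d) (x : El X) : d x x = 0 :=
  (hd.eq_zero x x).2 rfl

theorem CompleteMetricIn.exists_ball (hR : RealFieldIn R) (hd : CompleteMetricIn X τ d)
    (x : El X) (ε : El R) : ∃ B : El τ, ∀ y : El X, y.1 ∈ B.1 ↔ d x y < ε := by
  have := Fact.mk hd.d_internal
  have := Fact.mk hR.le_internal
  obtain ⟨B, hB⟩ := sep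
    (fun y => ∃ r, Graph₂ d x.1 y r ∧ ¬ Lift (fun a b : El R => a ≤ b) ε.1 r) X
  have hB' : ∀ y : El X, y.1 ∈ B ↔ d x y < ε := by
    intro y
    simp only [hB, y.2, graph₂_iff, true_and, exists_eq_left', lift_iff, not_le]
  refine ⟨⟨B, (hd.topology B).2 ⟨fun y hy => ((hB y).1 hy).1, fun y hy => ?_⟩⟩, hB'⟩
  refine ⟨ε - d x y, sub_pos.2 ((hB' y).1 hy), fun z hz => (hB' z).2 ?_⟩
  have := hd.triangle x y z
  linarith

omit [TransModel M] [IsStrictOrderedRing (El R)] in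
theorem CompleteMetricIn.exists_radius (hd : CompleteMetricIn X τ d) {O : El τ} {x : El X}
    (hx : x.1 ∈ O.1) : ∃ ε : El R, 0 < ε ∧ ∀ y : El X, d x y < ε → y.1 ∈ O.1 :=
  ((hd.topology O.1).1 O.2).2 x hx

theorem CompleteMetricIn.isReg (hT : IsTopIn X τ) (hR : RealFieldIn R)
    (hd : CompleteMetricIn X τ d) : IsReg X τ := by
  intro O x hx
  obtain ⟨x, rfl⟩ := mem_el (hT.sub _ O.2 x hx)
  obtain ⟨ε, hε, h⟩ := hd.exists_radius hx
  obtain ⟨P, hP⟩ := hd.exists_ball hR x (ε / 2)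
  refine ⟨P, (hP x).2 (by rw [hd.self]; linarith), fun y hy => or_iff_not_imp_left.2 fun hyO => ?_⟩
  obtain ⟨y, rfl⟩ := mem_el hy
  obtain ⟨Q, hQ⟩ := hd.exists_ball hR y (ε / 2)
  refine ⟨Q.1, Q.2, (hQ y).2 (by rw [hd.self]; linarith), fun z hz hz' => ?_⟩
  obtain ⟨z, rfl⟩ := mem_el (hT.sub _ Q.2 z hz)
  refine hyO (h y ?_)
  have h₁ := hd.triangle x z y
  have h₂ := (hQ z).1 hz
  have h₃ := (hP z).1 hz'
  rw [hd.comm z y] at h₁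
  linarith

variable {A : Type u} [MetricSpace A] {i : El X → A} {j : El R →+*o ℝ}

/-- The largest open subset of `A` whose preimage under `i` is contained in `O`. -/
def openExt (i : El X → A) (O : El τ) : Set A :=
  {a | ∃ ε > 0, ∀ x : El X, dist (i x) a < ε → x.1 ∈ O.1}

omit [TransModel M] in
theorem isOpen_openExt (O : El τ) : IsOpen (openExt i O) := by
  rw [Metric.isOpen_iff]
  rintro a ⟨ε, hε, h⟩
  refine ⟨ε / 2, by positivity, fun b hb => ⟨ε / 2, by positivity, fun x hx => h x ?_⟩⟩
  have := dist_triangle (i x) b a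
  rw [Metric.mem_ball] at hb
  linarith

omit [TransModel M] in
theorem openExt_mono {O P : El τ} (h : SubsetIn O.1 P.1) : openExt i O ⊆ openExt i P :=
  fun _ ⟨ε, hε, h'⟩ => ⟨ε, hε, fun x hx => h _ (h' x hx)⟩

omit [TransModel M] in
theorem openExt_inter {O P Q : El τ} (h : ∀ x, x ∈ Q.1 ↔ x ∈ O.1 ∧ x ∈ P.1) :
    openExt i Q = openExt i O ∩ openExt i P := by
  refine Subset.antisymm (subset_inter (openExt_mono fun x hx => ((h x).1 hx).1)
    (openExt_mono fun x hx => ((h x).1 hx).2)) ?_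
  rintro a ⟨⟨ε, hε, h₁⟩, δ, hδ, h₂⟩
  exact ⟨min ε δ, lt_min hε hδ, fun x hx => (h _).2 ⟨h₁ x (hx.trans_le (min_le_left _ _)),
    h₂ x (hx.trans_le (min_le_right _ _))⟩⟩

omit [TransModel M] in
theorem exists_of_mem_openExt (hi : DenseRange i) {O : El τ} {a : A} (ha : a ∈ openExt i O) {δ : ℝ}
    (hδ : 0 < δ) : ∃ x : El X, x.1 ∈ O.1 ∧ dist (i x) a < δ := by
  obtain ⟨ε, hε, h⟩ := ha
  obtain ⟨x, hx⟩ := hi.exists_dist_lt a (lt_min hε hδ)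
  rw [dist_comm] at hx
  exact ⟨x, h x (hx.trans_le (min_le_left _ _)), hx.trans_le (min_le_right _ _)⟩

variable (hT : IsTopIn X τ) (hR : RealFieldIn R) (hd : CompleteMetricIn X τ d)
  (hij : ∀ x y, dist (i x) (i y) = j (d x y))

include hR hd hij

omit [TransModel M] [IsStrictOrderedRing (El R)] hR in
theorem mem_openExt_iff {x : El X} {O : El τ} : x.1 ∈ O.1 ↔ i x ∈ openExt i O := by
  constructor
  · intro hx
    obtain ⟨ε, hε, h⟩ := hd.exists_radius hx
    refine ⟨j ε, by simpa using (map_lt_map_iff' j).2 hε, fun y hy => h y ?_⟩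
    rwa [hij, map_lt_map_iff', hd.comm] at hy
  · rintro ⟨ε, hε, h⟩
    exact h x (by rwa [dist_self])

theorem exists_small_openExt (hi : DenseRange i) (a : A) {δ : ℝ} (hδ : 0 < δ) :
    ∃ P : El τ, a ∈ openExt i P ∧ ∀ x : El X, x.1 ∈ P.1 → dist (i x) a < δ := by
  obtain ⟨x, hx⟩ := hi.exists_dist_lt a (show 0 < δ / 4 by positivity)
  rw [dist_comm] at hx
  -- The radius must come from `El R`, and j fixes rationals. As x is within δ/4 of a and δ/4 < q <
  -- δ/2, the q-ball at x captures the points near a and stays within δ of a.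
  obtain ⟨q, hq, hq'⟩ := exists_rat_btwn (show δ / 4 < δ / 2 by linarith)
  have hjq : j (q : El R) = q := map_ratCast j q
  obtain ⟨B, hB⟩ := hd.exists_ball hR x (q : El R)
  have hB' : ∀ y : El X, y.1 ∈ B.1 ↔ dist (i x) (i y) < q := fun y => by
    rw [hB, hij, ← hjq, map_lt_map_iff']
  refine ⟨B, ⟨q - δ / 4, by linarith, fun y hy => (hB' y).2 ?_⟩, fun y hy => ?_⟩
  · have := dist_triangle (i x) a (i y)
    rw [dist_comm a] at this
    linarith
  · have := dist_triangle (i y) (i x) a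
    have h' := (hB' y).1 hy
    rw [dist_comm] at h'
    linarith

theorem isTopologicalBasis_openExt (hi : DenseRange i) :
    TopologicalSpace.IsTopologicalBasis (Set.range (openExt i : El τ → Set A)) := by
  refine TopologicalSpace.isTopologicalBasis_of_isOpen_of_nhds
    (by rintro _ ⟨O, rfl⟩; exact isOpen_openExt O) fun a s ha hs => ?_
  obtain ⟨δ, hδ, h⟩ := Metric.isOpen_iff.1 hs a ha
  obtain ⟨P, hP, hPa⟩ := exists_small_openExt hR hd hij hi a (show 0 < δ / 2 by positivity)
  refine ⟨_, ⟨P, rfl⟩, hP, fun b hb => h ?_⟩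
  obtain ⟨x, hx, hxb⟩ := exists_of_mem_openExt hi hb (show 0 < δ / 2 by positivity)
  have := dist_triangle b (i x) a
  have := hPa x hx
  rw [dist_comm] at hxb
  rw [Metric.mem_ball]
  linarith

include hT

omit hR hij in
/-- There is no sequence in the model of shrinking open sets not contained in any element of an
open cover. -/
theorem false_of_shrinking [Archimedean (El R)] {w S O B : M} (hw : IsOmega w)
    (hSτ : SubsetIn S τ) (hO : ∀ x, x ∈ O ↔ ∃ P ∈ S, x ∈ P) {δ : El R} (hδ : 0 < δ)
    (hB : ∀ x z : El X, x.1 ∈ B → d x z < δ → z.1 ∈ O) (s : El w → El τ) (hs : Internal s)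
    (hs0 : (s (hw.nat 0)).1 = B)
    (hsn : ∀ n, SubsetIn (s (hw.nat (n + 1))).1 (s (hw.nat n)).1 ∧
      Small d (s (hw.nat (n + 1))).1 ((1 / 2 : El R) ^ n).1 ∧
      (∃ x, x ∈ (s (hw.nat (n + 1))).1) ∧ ∀ Q ∈ S, ¬ SubsetIn (s (hw.nat (n + 1))).1 Q) :
    False := by
  have := Fact.mk hs
  have hsub : ∀ n k, n ≤ k → SubsetIn (s (hw.nat k)).1 (s (hw.nat n)).1 := by
    intro n k hk
    induction k, hk using Nat.le_induction with
    | base => exact fun _ h => h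
    | succ k _ ih => exact fun x hx => ih x ((hsn k).1 x hx)
  have hsX : ∀ n, SubsetIn (s (hw.nat n)).1 X := fun n => hT.sub _ (s (hw.nat n)).2
  obtain ⟨x, hx, hx'⟩ := exists_internal_choice w X
    (fun n x => ∃ m P, IsSucc m n ∧ Graph s m P ∧ x ∈ P) (by
      intro n
      obtain ⟨n, rfl⟩ := hw.exists_nat n
      obtain ⟨x, hx⟩ := (hsn n).2.2.1
      exact ⟨⟨x, hsX _ x hx⟩, _, _, isSucc_num n, (graph_iff (x := hw.nat (n + 1))).2 rfl, hx⟩)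
  have hxs : ∀ n, (x (hw.nat n)).1 ∈ (s (hw.nat (n + 1))).1 := by
    intro n
    obtain ⟨m, P, hm, hP, h⟩ := hx' (hw.nat n)
    rw [hw.nat_val, isSucc_num_iff] at hm
    subst hm
    rwa [← (graph_iff (x := hw.nat (n + 1))).1 hP] at h
  have hpow : ∀ ε : El R, 0 < ε → ∃ N : ℕ, (1 / 2 : El R) ^ N < ε := fun ε hε =>
    exists_pow_lt_of_lt_one hε (by norm_num)
  obtain ⟨y, hy⟩ := hd.complete w hw x hx (by
    intro ε hε
    obtain ⟨N, hN⟩ := hpow ε hε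
    refine ⟨hw.nat N, fun m n hm hn => ?_⟩
    obtain ⟨m, rfl⟩ := hw.exists_nat m
    obtain ⟨n, rfl⟩ := hw.exists_nat n
    rw [hw.nat_val, hw.nat_val, num_mem_num] at hm hn
    exact ((small_iff (hsX _)).1 (hsn N).2.1 _ _ (hsub _ _ (by omega) _ (hxs m))
      (hsub _ _ (by omega) _ (hxs n))).trans hN)
  have hlim : ∀ ε : El R, 0 < ε → ∃ N : ℕ, ∀ n, N < n → d (x (hw.nat n)) y < ε := by
    intro ε hε
    obtain ⟨N, hN⟩ := hy ε hε
    obtain ⟨N, rfl⟩ := hw.exists_nat N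
    exact ⟨N, fun n hn => hN _ (num_mem_num.2 hn)⟩
  obtain ⟨N, hN⟩ := hlim δ hδ
  have hyO : y.1 ∈ O := by
    refine hB (x (hw.nat (N + 1))) y ?_ (hN _ (Nat.lt_succ_self N))
    rw [← hs0]
    exact hsub 0 _ (Nat.zero_le _) _ (hxs _)
  obtain ⟨Q, hQ, hyQ⟩ := (hO _).1 hyO
  obtain ⟨ε, hε, hεQ⟩ := hd.exists_radius (O := ⟨Q, hSτ Q hQ⟩) hyQ
  obtain ⟨N₁, hN₁⟩ := hlim (ε / 2) (by linarith)
  obtain ⟨N₂, hN₂⟩ := hpow (ε / 2) (by linarith)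
  -- For this n, x n is within ε/2 of y and s (n + 1) has distances below ε/2, so s (n + 1) lies in
  -- the ε-ball at y, inside Q.
  let n := max N₁ N₂ + 1
  refine (hsn n).2.2.2 Q hQ fun z hz => ?_
  refine hεQ ⟨z, hsX _ z hz⟩ ?_
  have h₁ := hd.triangle y (x (hw.nat n)) ⟨z, hsX _ z hz⟩
  have h₂ := (small_iff (hsX _)).1 (hsn n).2.1 _ ⟨z, hsX _ z hz⟩ (hxs n) hz
  have h₃ := hN₁ n (by omega)
  have h₄ : (1 / 2 : El R) ^ n ≤ (1 / 2) ^ N₂ :=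
    pow_le_pow_of_le_one (by norm_num) (by norm_num) (by omega)
  rw [hd.comm] at h₃
  linarith

/-- This clause is where completeness in M enters. If no member of S absorbs a, shrinking
neighborhoods of a, none contained in a member of S, form an external branch. A branch in M would
converge to a point of O, and the member of S around it would swallow a late stage. -/
theorem openExt_sUnion [Archimedean (El R)] (hi : DenseRange i) {S : M} (hSτ : SubsetIn S τ)
    {O : El τ} (hO : ∀ x, x ∈ O.1 ↔ ∃ P ∈ S, x ∈ P) :
    openExt i O = {a | ∃ P : El τ, P.1 ∈ S ∧ a ∈ openExt i P} := by
  refine Subset.antisymm (fun a ha => ?_)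
    (fun a ⟨P, hP, ha⟩ => openExt_mono (fun x hx => (hO x).2 ⟨_, hP, hx⟩) ha)
  by_contra hcon
  have hcon' : ∀ P : El τ, P.1 ∈ S → a ∉ openExt i P := fun P hP h => hcon ⟨P, hP, h⟩
  obtain ⟨w, hw⟩ := exists_omega (M := M)
  obtain ⟨e, he, hen⟩ := hR.exists_internal_pow hw (1 / 2)
  have := Fact.mk he
  have := Fact.mk hd.d_internal
  have := Fact.mk hR.le_internal
  obtain ⟨ε₀, hε₀, h₀⟩ := ha
  -- B and δ keep the limit of the internal branch in O: a point closer than δ to B is within ε₀/2 +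
  -- ε₀/2 of a.
  obtain ⟨B, hB, hBa⟩ := exists_small_openExt hR hd hij hi a (half_pos hε₀)
  obtain ⟨δ, hδ, hδε⟩ := exists_map_lt j (half_pos hε₀)
  have step : ∀ (n : ℕ) (P : {P : El τ // a ∈ openExt i P}),
      ∃ P' : {P : El τ // a ∈ openExt i P}, SubsetIn P'.1.1 P.1.1 ∧
        Small d P'.1.1 ((1 / 2 : El R) ^ n).1 := by
    rintro n ⟨P, hP⟩
    have hpos : 0 < j ((1 / 2 : El R) ^ n) := by
      rw [← map_zero j]
      exact (map_lt_map_iff' j).2 (by positivity)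
    obtain ⟨N, hN, hNa⟩ := exists_small_openExt hR hd hij hi a (half_pos hpos)
    obtain ⟨Q, hQ⟩ := exists_inter hT P N
    refine ⟨⟨Q, by rw [openExt_inter hQ]; exact ⟨hP, hN⟩⟩, fun x hx => ((hQ x).1 hx).1,
      (small_iff (hT.sub _ Q.2)).2 fun x y hx hy => ?_⟩
    rw [← map_lt_map_iff' j, ← hij]
    have h₁ := hNa x ((hQ _).1 hx).2
    have h₂ := hNa y ((hQ _).1 hy).2
    have := dist_triangle_right (i x) (i y) a
    linarith
  choose next h₁ h₂ using step
  let b : ℕ → {P : El τ // a ∈ openExt i P} := fun n => n.rec ⟨B, hB⟩ fun n P => next n P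
  obtain ⟨s, hs, hs0, hsn⟩ := exists_internal_branch hw τ
    (fun n P P' => SubsetIn P' P ∧ (∀ ε, Graph e n ε → Small d P' ε) ∧ (∃ x, x ∈ P') ∧
      ∀ Q ∈ S, ¬ SubsetIn P' Q) (fun n => (b n).1) (by
      intro n
      refine ⟨h₁ n (b n), fun ε hε => ?_, ?_, fun Q hQ hsub => ?_⟩
      · rw [← (graph_iff (x := hw.nat n)).1 hε, hen]
        exact h₂ n (b n)
      · obtain ⟨x, hx, -⟩ := exists_of_mem_openExt hi (b (n + 1)).2 one_pos
        exact ⟨_, hx⟩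
      · exact hcon' ⟨Q, hSτ Q hQ⟩ hQ (openExt_mono hsub (b (n + 1)).2))
  refine false_of_shrinking hT hd hw hSτ hO hδ (B := B.1) (fun x z hx hxz => h₀ z ?_) s hs
    (congrArg El.val hs0) fun n => ⟨(hsn n).1, ?_, (hsn n).2.2⟩
  · have := dist_triangle (i z) (i x) a
    have := hBa x hx
    rw [hd.comm, ← map_lt_map_iff' j, ← hij] at hxz
    linarith
  · rw [← hen]
    exact (hsn n).2.1 _ ((graph_iff (x := hw.nat n)).2 rfl)

/-- The preinterpretation of a complete metric space of the model in a metric space in which it is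
dense. -/
noncomputable def metricPreinterp [Archimedean (El R)] (hi : DenseRange i) : Preinterp X τ A where
  pt := i
  op := openExt i
  t0 := inferInstance
  mem_iff _ _ := mem_openExt_iff hd hij
  op_inter _ _ _ h := openExt_inter h
  op_union _ hS _ hO := openExt_sUnion hT hR hd hij hi hS hO
  op_empty O hO := eq_empty_of_forall_notMem fun a ha => by
    obtain ⟨x, hx, -⟩ := exists_of_mem_openExt hi ha one_pos
    exact hO _ hx
  op_univ O hO := eq_univ_of_forall fun a => ⟨1, one_pos, fun x _ => hO ▸ x.2⟩
  basis := isTopologicalBasis_openExt hR hd hij hi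

/-- Balls cover X, so a filter contains sets P n with distances below 2⁻ⁿ. Points chosen in them
form a Cauchy sequence because members of the filter meet; points of O ∩ P n converge to the same
limit, which is thus in the closure of every π(O). -/
theorem isInterpretation_metricPreinterp [Archimedean (El R)] [CompleteSpace A]
    (hi : DenseRange i) : IsInterpretation (metricPreinterp hT hR hd hij hi) := by
  have := Fact.mk hd.d_internal
  have := Fact.mk hR.le_internal
  let p := metricPreinterp hT hR hd hij hi
  rw [isInterpretation_iff hT]
  intro H hH
  have hsmall : ∀ n : ℕ, ∃ P ∈ H, Small d P.1 ((1 / 2 : El R) ^ n).1 := by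
    intro n
    refine hH.cover_univ hT (fun P => Small d P ((1 / 2 : El R) ^ n).1) fun x hx => ?_
    obtain ⟨B, hB⟩ := hd.exists_ball hR ⟨x, hx⟩ ((1 / 2 : El R) ^ n / 2)
    have hpos : (0 : El R) < (1 / 2 : El R) ^ n := by positivity
    refine ⟨B, (small_iff (hT.sub _ B.2)).2 fun y z hy hz => ?_, (hB _).2 (by
      rw [hd.self]; linarith)⟩
    have h₁ := (hB y).1 hy
    have h₂ := (hB z).1 hz
    have := hd.triangle y ⟨x, hx⟩ z
    rw [hd.comm] at h₁
    linarith
  choose P hP hPn using hsmall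
  have hne : ∀ n, ∃ x : El X, x.1 ∈ (P n).1 := fun n => by
    obtain ⟨x, hx⟩ := hH.nonempty _ (hP n)
    exact ⟨⟨x, hT.sub _ (P n).2 x hx⟩, hx⟩
  choose x hx using hne
  have hdist : ∀ n (y : El X), y.1 ∈ (P n).1 → dist (i (x n)) (i y) < (1 / 2 : ℝ) ^ n := by
    intro n y hy
    have := (small_iff (hT.sub _ (P n).2)).1 (hPn n) (x n) y (hx n) hy
    rwa [← map_lt_map_iff' j, ← hij, map_pow, map_div₀, map_one, map_ofNat] at this
  have hlim : Filter.Tendsto (fun n : ℕ => (1 / 2 : ℝ) ^ n) Filter.atTop (𝓝 0) :=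
    tendsto_pow_atTop_nhds_zero_of_lt_one (by norm_num) (by norm_num)
  have hcauchy : CauchySeq fun n => i (x n) := by
    refine cauchySeq_of_le_tendsto_0 (fun n : ℕ => (1 / 2 : ℝ) ^ n + (1 / 2 : ℝ) ^ n)
      (fun n m N hn hm => ?_) (by simpa using hlim.add hlim)
    obtain ⟨z, hz, hz'⟩ := hH.exists_mem hT (hP n) (hP m)
    obtain ⟨z, rfl⟩ := mem_el (hT.sub _ (P n).2 z hz)
    have h₁ := hdist n z hz
    have h₂ := hdist m z hz'
    have h₃ := dist_triangle_right (i (x n)) (i (x m)) (i z)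
    have h₄ : (1 / 2 : ℝ) ^ n ≤ (1 / 2) ^ N :=
      pow_le_pow_of_le_one (by norm_num) (by norm_num) hn
    have h₅ : (1 / 2 : ℝ) ^ m ≤ (1 / 2) ^ N :=
      pow_le_pow_of_le_one (by norm_num) (by norm_num) hm
    linarith
  obtain ⟨a, ha⟩ := cauchySeq_tendsto_of_complete hcauchy
  refine ⟨a, p.nbhd_eq_of_mem_closure hT (hd.isReg hT hR) hH fun O hO => ?_⟩
  have hz : ∀ n, ∃ z : El X, z.1 ∈ O.1 ∧ z.1 ∈ (P n).1 := fun n => by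
    obtain ⟨z, hz, hz'⟩ := hH.exists_mem hT hO (hP n)
    exact ⟨⟨z, hT.sub _ O.2 z hz⟩, hz, hz'⟩
  choose z hzO hzP using hz
  have hza : Filter.Tendsto (fun n => i (z n)) Filter.atTop (𝓝 a) := by
    refine tendsto_of_tendsto_of_dist ha (squeeze_zero (fun _ => dist_nonneg)
      (fun n => (hdist n _ (hzP n)).le) hlim)
  exact mem_closure_of_tendsto hza (Filter.Eventually.of_forall fun n =>
    (p.mem_iff _ _).1 (hzO n))

omit [TransModel M] hT hR hij in
/-- The completion of a complete metric space of the model. -/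
theorem exists_metric_completion (j : El R →+*o ℝ) :
    ∃ (A : Type u) (_ : MetricSpace A) (_ : CompleteSpace A) (i : El X → A),
      (∀ x y, dist (i x) (i y) = j (d x y)) ∧ DenseRange i := by
  have hnn : ∀ x y, 0 ≤ d x y := fun x y => by
    have := hd.triangle x y x
    rw [hd.self, hd.comm y x] at this
    linarith
  let e := equivShrink.{u} (El X)
  let _ : MetricSpace (Shrink.{u} (El X)) :=
    { dist := fun a b => j (d (e.symm a) (e.symm b))
      dist_self := fun a => by rw [hd.self, map_zero]
      dist_comm := fun a b => by rw [hd.comm]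
      dist_triangle := fun a b c => by
        rw [← map_add]
        exact OrderHomClass.mono j (hd.triangle _ _ _)
      eq_of_dist_eq_zero := fun {a b} h => by
        refine e.symm.injective ((hd.eq_zero _ _).1 ?_)
        exact RingHom.injective (j : El R →+* ℝ) (h.trans (map_zero j).symm) }
  refine ⟨UniformSpace.Completion (Shrink.{u} (El X)), inferInstance, inferInstance,
    fun x => (e x : UniformSpace.Completion (Shrink.{u} (El X))), fun x y => ?_, ?_⟩
  · rw [UniformSpace.Completion.dist_eq]
    change j (d (e.symm (e x)) (e.symm (e y))) = _
    rw [Equiv.symm_apply_apply, Equiv.symm_apply_apply]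
  · exact UniformSpace.Completion.denseRange_coe.comp e.surjective.denseRange
      (UniformSpace.Completion.continuous_coe _)

end Metric

/-! ### Density of X in its preinterpretations and transport of a metric along an equivalence. -/

section Transport

variable {M : Set ZFSet.{u}} {X τ : M} {A B : Type u} [TopologicalSpace A]

theorem Preinterp.denseRange_pt [TransModel M] (p : Preinterp X τ A) (hT : IsTopIn X τ) :
    DenseRange p.pt := by
  intro a
  rw [p.basis.mem_closure_iff]
  rintro _ ⟨O, rfl⟩ ha
  obtain ⟨x, hx⟩ := p.nonempty_of_mem ha
  exact ⟨_, (p.mem_iff ⟨x, hT.sub _ O.2 x hx⟩ O).1 hx, _, rfl⟩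

/-- Pullback along h carries the basis of sets `q.op O` to the basis of sets `p.op O`. -/
theorem IsReduction.isInducing [TopologicalSpace B] {p : Preinterp X τ A} {q : Preinterp X τ B}
    {h : A → B} (hh : IsReduction p q h) : IsInducing h := by
  refine isInducing_iff_nhds.2 fun a => ?_
  ext s
  rw [p.mem_nhds_iff, Filter.mem_comap]
  constructor
  · rintro ⟨O, hO, hOs⟩
    rw [← hh.2 O] at hOs
    refine ⟨q.op O, (q.isOpen_op O).mem_nhds ?_, hOs⟩
    rw [← Preinterp.nbhd_of_isReduction hh] at hO
    exact hO
  · rintro ⟨t, ht, hts⟩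
    obtain ⟨O, hO, hOt⟩ := q.mem_nhds_iff.1 ht
    rw [Preinterp.nbhd_of_isReduction hh] at hO
    exact ⟨O, hO, by rw [← hh.2 O]; exact (preimage_mono hOt).trans hts⟩

end Transport

section Main

variable {M : Set ZFSet.{u}} [TransModel M] {X τ : M}

theorem exists_metric_of_isInterpretation {A B : Type u} [t : TopologicalSpace A] [MetricSpace B]
    [CompleteSpace B] {p : Preinterp X τ A} {q : Preinterp X τ B} (hT : IsTopIn X τ)
    (hp : IsInterpretation p) (hq : IsInterpretation q) :
    ∃ m : MetricSpace A, m.toUniformSpace.toTopologicalSpace = t ∧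
      @CompleteSpace A m.toUniformSpace ∧
      (∀ x y, m.dist (p.pt x) (p.pt y) = dist (q.pt x) (q.pt y)) ∧ @DenseRange A t _ p.pt := by
  obtain ⟨h, hh, hb⟩ := hp.equivalent hq
  let m : MetricSpace A := MetricSpace.induced h hb.1 inferInstance
  have hc : @CompleteSpace A m.toUniformSpace :=
    (IsUniformInducing.completeSpace_congr (f := h) ⟨rfl⟩ hb.2).2 inferInstance
  refine ⟨m, hh.isInducing.eq_induced.symm, hc, fun x y => ?_, p.denseRange_pt hT⟩
  rw [hh.1 x, hh.1 y]
  rfl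

end Main

end TopInterp

open TopInterp
theorem mainTheorem3 (M : Set ZFSet.{u})
    (htrans : ∀ x ∈ M, ∀ y ∈ x, y ∈ M) (hM : ModelsZFC M) :
    -- completeness systems
    (∀ (X τ U : M) (le : El U → El U → Prop) (f : El U → El τ),
      RegularHausdorffIn X τ → CompletenessSystemIn X τ U le f →
      (∃ (A : Type u) (_ : TopologicalSpace A) (p : Preinterp X τ A),
        CompletenessSystem le (fun a => p.op (f a))) ∧
      (∀ (A B : Type u) [TopologicalSpace A] [TopologicalSpace B]
        (p : Preinterp X τ A) (q : Preinterp X τ B),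
        CompletenessSystem le (fun a => p.op (f a)) →
        CompletenessSystem le (fun a => q.op (f a)) → Equivalent p q) ∧
      (∀ (A : Type u) [TopologicalSpace A] (p : Preinterp X τ A),
        CompletenessSystem le (fun a => p.op (f a)) ↔ IsInterpretation p)) ∧
    -- compact Hausdorff spaces
    (∀ X τ : M, IsTopIn X τ → HausdorffIn X τ → CompactIn X τ →
      (∃ (A : Type u) (_ : TopologicalSpace A) (_ : Preinterp X τ A), CompactSpace A) ∧
      (∀ (A B : Type u) [TopologicalSpace A] [TopologicalSpace B]
        (p : Preinterp X τ A) (q : Preinterp X τ B),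
        CompactSpace A → CompactSpace B → Equivalent p q) ∧
      (∀ (A : Type u) [TopologicalSpace A] (p : Preinterp X τ A),
        CompactSpace A ↔ IsInterpretation p) ∧
      (∀ (A : Type u) [TopologicalSpace A] (p : Preinterp X τ A),
        IsInterpretation p → CompactSpace A ∧ T2Space A)) ∧
    -- completely metrizable spaces
    (∀ (X τ R : M) [Field (El R)] [LinearOrder (El R)] [IsStrictOrderedRing (El R)]
      (d : El X → El X → El R),
      IsTopIn X τ → RealFieldIn R → CompleteMetricIn X τ d →
      ∃ j : El R →+*o ℝ, (∀ j' : El R →+*o ℝ, j' = j) ∧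
        (∃ (A : Type u) (_ : TopologicalSpace A) (p : Preinterp X τ A), IsInterpretation p) ∧
        (∀ (A : Type u) [t : TopologicalSpace A] (p : Preinterp X τ A), IsInterpretation p →
          ∃ m : MetricSpace A, m.toUniformSpace.toTopologicalSpace = t ∧
            @CompleteSpace A m.toUniformSpace ∧
            (∀ x y, m.dist (p.pt x) (p.pt y) = j (d x y)) ∧ DenseRange p.pt) ∧
        (∀ (A : Type u) [MetricSpace A] [CompleteSpace A] (i : El X → A),
          (∀ x y, dist (i x) (i y) = j (d x y)) → DenseRange i →
            ∃ p : Preinterp X τ A, p.pt = i ∧ IsInterpretation p)) ∧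
    -- Čech complete spaces
    (∀ X τ : M, CechCompleteIn X τ →
      (∃ (A : Type u) (_ : TopologicalSpace A) (p : Preinterp X τ A), IsInterpretation p) ∧
      (∀ (A : Type u) [TopologicalSpace A] (p : Preinterp X τ A),
        IsInterpretation p → CechComplete A)) ∧
    -- interpretable spaces
    (∀ X τ : M, InterpretableIn X τ →
      (∃ (A : Type u) (_ : TopologicalSpace A) (p : Preinterp X τ A), IsInterpretation p) ∧
      (∀ (A : Type u) [TopologicalSpace A] (p : Preinterp X τ A),
        IsInterpretation p → Interpretable A)) := by
  have : TransModel M := ⟨htrans, hM⟩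
  refine ⟨?_, ?_, ?_, ?_, ?_⟩
  · intro X τ U le f hX hU
    have hT := hX.1
    have hR := hX.2.2.isReg hT
    refine ⟨?_, fun A B _ _ p q hp hq => ?_, fun A _ p => completenessSystem_iff hT hR hU p⟩
    · obtain ⟨A, t, p, hp⟩ := exists_isInterpretation hT
      exact ⟨A, t, p, (completenessSystem_iff hT hR hU p).2 hp⟩
    · exact ((completenessSystem_iff hT hR hU p).1 hp).equivalent
        ((completenessSystem_iff hT hR hU q).1 hq)
  · intro X τ hT hH hC
    have hR := hC.isReg hT hH
    refine ⟨?_, fun A B _ _ p q hp hq => ?_, fun A _ p => compactSpace_iff hT hR hC p,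
      fun A _ p hp => ⟨(compactSpace_iff hT hR hC p).2 hp, p.t2Space hT hR⟩⟩
    · obtain ⟨A, t, p, hp⟩ := exists_isInterpretation hT
      exact ⟨A, t, p, (compactSpace_iff hT hR hC p).2 hp⟩
    · exact ((compactSpace_iff hT hR hC p).1 hp).equivalent ((compactSpace_iff hT hR hC q).1 hq)
  · intro X τ R _ _ _ d hT hR hd
    -- The archimedean property makes the ordered field embedding into ℝ exist and be unique.
    have := hR.archimedean
    let j : El R →+*o ℝ := ConditionallyCompleteLinearOrderedField.inducedOrderRingHom (El R) ℝ
    refine ⟨j, fun j' => Subsingleton.elim _ _, exists_isInterpretation hT, fun A t p hp => ?_,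
      fun A _ _ i hij hi => ?_⟩
    · obtain ⟨B, _, _, i, hij, hi⟩ := exists_metric_completion hd j
      obtain ⟨m, hm, hc, hdist, hdense⟩ := exists_metric_of_isInterpretation hT hp
        (isInterpretation_metricPreinterp hT hR hd hij hi)
      exact ⟨m, hm, hc, fun x y => (hdist x y).trans (hij x y), by subst hm; exact hdense⟩
    · exact ⟨metricPreinterp hT hR hd hij hi, rfl,
        isInterpretation_metricPreinterp hT hR hd hij hi⟩
  · intro X τ hX
    obtain ⟨K, σ, w, e, G, h⟩ := hX.exists_embedding
    exact ⟨exists_isInterpretation h.top, fun A _ p hp => h.cechComplete p hp⟩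
  · intro X τ hX
    exact ⟨exists_isInterpretation hX.1.1, fun A _ p hp => hX.interpretable p hp⟩
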